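/- Conventions. Manifolds are smooth, finite-dimensional, Hausdorff, second countable and without boundary. An orbifold groupoid is a proper étale Lie groupoid; $|\mathcal G|$ is its space of objects modulo arrows, with the quotient topology, $\mathcal G_x$ is the isotropy group of an object $x$, and $\mathcal G|_U$ is the restriction of $\mathcal G$ to an open set $U$ of objects. A homomorphism of Lie groupoids (smooth functor) $\phi:\mathcal H\to\mathcal G$ is an equivalence if $(g,y)\mapsto t(g)$ is a surjective submersion from $G_1\times_{s,G_0,\phi_0}H_0$ onto $G_0$, and $H_1$, with the maps $(s,t)$ and $\phi_1$, is the fibered product of $\phi_0\times\phi_0:H_0\times H_0\to G_0\times G_0$ and $(s,t):G_1\to G_0\times G_0$. For a smooth action of a compact Lie group $G$ on a manifold $M$, $[M/G]$ denotes the translation groupoid $G\ltimes M$; an orbifold groupoid representation of it is an orbifold groupoid $\mathcal G$ together with an equivalence $\mathcal G\to[M/G]$. The action is locally free if all isotropy groups $G_p$ are discrete. A strong $G$-equivariant immersion $\iota:N\to M$ is a $G$-equivariant immersion such that for every $p\in M$ the group $G_p$ acts transitively on $\iota^{-1}(p)$. Consider the following conditions on a homomorphism $\phi:\mathcal H\to\mathcal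 G$ of orbifold groupoids: (1) $\phi_0:H_0\to G_0$ is an immersion; (2) for every $x\in\operatorname{im}\phi_0$ any two points of $\phi_0^{-1}(x)$ are joined by an arrow of $\mathcal H$, and there are arbitrarily small open neighborhoods $U_x$ of $x$ with $\mathcal G|_{U_x}\cong \mathcal G_x\ltimes U_x$ such that each $y\in\phi_0^{-1}(x)$ has an open neighborhood $V_y\subset H_0$ with $\mathcal H|_{V_y}\cong \mathcal H_y\ltimes V_y$ and $$\mathcal H|_{\phi_0^{-1}(U_x)}\cong \mathcal G_x\ltimes(\mathcal G_x\times_{\mathcal H_y}V_y),$$ where $\mathcal G_x\times_{\mathcal H_y}V_y$ is the quotient of $\mathcal G_x\times V_y$ by $(k\phi_1(h),z)\sim(k,h\cdot z)$, the isomorphism sends $[1,z]$ to $z$, and it identifies $\phi$ with the homomorphism $(\gamma,e)\mapsto(\gamma,\phi_0(e))$ to $\mathcal G_x\ltimes U_x$; (3) $|\phi|:|\mathcal H|\to|\mathcal G|$ is injective; (4) $|\phi|$ is proper. The homomorphism $\phi$ is called an orbifold embedding if (1)–(4) hold. Proposition. Let $G$ be a compact Lie group, let $M$ and $N$ be $G$-manifolds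 with locally free actions, and let $\iota:N\to M$ be a strong $G$-equivariant immersion. Then there are orbifold groupoid representations $\varepsilon_N:\mathcal H\to[N/G]$ and $\varepsilon_M:\mathcal G\to[M/G]$ and a homomorphism $\phi_\iota:\mathcal H\to\mathcal G$ induced by $\iota$, i.e. $\varepsilon_M\circ\phi_\iota=[\iota]\circ\varepsilon_N$ with $[\iota]:[N/G]\to[M/G]$, $(g,q)\mapsto(g,\iota(q))$, which satisfies (1), (2) and (3); in particular the map $|\phi_\iota|$ between quotient spaces is injective. If moreover $\iota$ is a proper map (for example if $N$ is compact), then $\phi_\iota$ also satisfies (4), so that it is an orbifold embedding. -/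

import Mathlib

open Set Filter Topology
open scoped Manifold ContDiff

universe u v u' v' u'' v'' uG uM uN

noncomputable section

/-! Lie groupoids -/

/-- A Lie groupoid whose manifold of objects is modelled on `I₀` and whose manifold of arrows is
modelled on `I₁`.  `mul g h` is the composite "first `h`, then `g`"; it is meaningful only for
composable pairs, that is when `src g = tgt h`, and its other values are irrelevant.
The set of composable pairs is an embedded submanifold of `Arr × Arr`, because `src` is a submersion,
and `ContMDiffOn` on this set expresses that multiplication is smooth on that submanifold. -/
structure LieGroupoid
    {E₀ : Type*} [NormedAddCommGroup E₀] [NormedSpace ℝ E₀] {X₀ : Type*} [TopologicalSpace X₀]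
    {E₁ : Type*} [NormedAddCommGroup E₁] [NormedSpace ℝ E₁] {X₁ : Type*} [TopologicalSpace X₁]
    (I₀ : ModelWithCorners ℝ E₀ X₀) (I₁ : ModelWithCorners ℝ E₁ X₁) where
  /-- the objects -/
  Ob : Type u
  /-- the arrows -/
  Arr : Type v
  [topOb : TopologicalSpace Ob]
  [chartedOb : ChartedSpace X₀ Ob]
  [manifoldOb : IsManifold I₀ ∞ Ob]
  [topArr : TopologicalSpace Arr]
  [chartedArr : ChartedSpace X₁ Arr]
  [manifoldArr : IsManifold I₁ ∞ Arr]
  src : Arr → Ob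
  tgt : Arr → Ob
  unit : Ob → Arr
  inv : Arr → Arr
  mul : Arr → Arr → Arr
  src_unit : ∀ x, src (unit x) = x
  tgt_unit : ∀ x, tgt (unit x) = x
  src_inv : ∀ g, src (inv g) = tgt g
  tgt_inv : ∀ g, tgt (inv g) = src g
  src_mul : ∀ g h, src g = tgt h → src (mul g h) = src h
  tgt_mul : ∀ g h, src g = tgt h → tgt (mul g h) = tgt g
  mul_assoc : ∀ f g h, src f = tgt g → src g = tgt h → mul (mul f g) h = mul f (mul g h)
  mul_unit : ∀ g, mul g (unit (src g)) = g
  unit_mul : ∀ g, mul (unit (tgt g)) g = g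
  inv_mul : ∀ g, mul (inv g) g = unit (src g)
  mul_inv : ∀ g, mul g (inv g) = unit (tgt g)
  smooth_src : ContMDiff I₁ I₀ ∞ src
  smooth_tgt : ContMDiff I₁ I₀ ∞ tgt
  smooth_unit : ContMDiff I₀ I₁ ∞ unit
  smooth_inv : ContMDiff I₁ I₁ ∞ inv
  smooth_mul : ContMDiffOn (I₁.prod I₁) I₁ ∞ (fun p : Arr × Arr => mul p.1 p.2)
    {p | src p.1 = tgt p.2}
  submersion_src : ∀ g, Function.Surjective (mfderiv I₁ I₀ src g)

attribute [instance] LieGroupoid.topOb LieGroupoid.chartedOb LieGroupoid.manifoldOb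
  LieGroupoid.topArr LieGroupoid.chartedArr LieGroupoid.manifoldArr

namespace LieGroupoid

variable
  {E₀ : Type*} [NormedAddCommGroup E₀] [NormedSpace ℝ E₀] {X₀ : Type*} [TopologicalSpace X₀]
  {E₁ : Type*} [NormedAddCommGroup E₁] [NormedSpace ℝ E₁] {X₁ : Type*} [TopologicalSpace X₁]
  {I₀ : ModelWithCorners ℝ E₀ X₀} {I₁ : ModelWithCorners ℝ E₁ X₁}
  {E₀' : Type*} [NormedAddCommGroup E₀'] [NormedSpace ℝ E₀'] {X₀' : Type*} [TopologicalSpace X₀']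
  {E₁' : Type*} [NormedAddCommGroup E₁'] [NormedSpace ℝ E₁'] {X₁' : Type*} [TopologicalSpace X₁']
  {I₀' : ModelWithCorners ℝ E₀' X₀'} {I₁' : ModelWithCorners ℝ E₁' X₁'}
  {E₀'' : Type*} [NormedAddCommGroup E₀''] [NormedSpace ℝ E₀'']
  {X₀'' : Type*} [TopologicalSpace X₀'']
  {E₁'' : Type*} [NormedAddCommGroup E₁''] [NormedSpace ℝ E₁'']
  {X₁'' : Type*} [TopologicalSpace X₁'']
  {I₀'' : ModelWithCorners ℝ E₀'' X₀''} {I₁'' : ModelWithCorners ℝ E₁'' X₁''}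

/-- A proper groupoid: `(src, tgt)` is a proper map. -/
def IsProper (K : LieGroupoid.{u, v} I₀ I₁) : Prop :=
  IsProperMap (fun g : K.Arr => (K.src g, K.tgt g))

/-- An étale groupoid: `src` and `tgt` are local diffeomorphisms. -/
def IsEtale (K : LieGroupoid.{u, v} I₀ I₁) : Prop :=
  IsLocalDiffeomorph I₁ I₀ ∞ K.src ∧ IsLocalDiffeomorph I₁ I₀ ∞ K.tgt

/-- An orbifold groupoid: a proper étale Lie groupoid.  Manifolds are Hausdorff and second
countable. -/
structure IsOrbifoldGroupoid (K : LieGroupoid.{u, v} I₀ I₁) : Prop where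
  t2_ob : T2Space K.Ob
  secondCountable_ob : SecondCountableTopology K.Ob
  t2_arr : T2Space K.Arr
  secondCountable_arr : SecondCountableTopology K.Arr
  proper : K.IsProper
  etale : K.IsEtale

/-- Two objects are equivalent if there is an arrow from the first to the second. -/
def orbitSetoid (K : LieGroupoid.{u, v} I₀ I₁) : Setoid K.Ob where
  r x y := ∃ g, K.src g = x ∧ K.tgt g = y
  iseqv :=
    { refl := fun x => ⟨K.unit x, K.src_unit x, K.tgt_unit x⟩
      symm := by
        rintro x y ⟨g, rfl, rfl⟩
        exact ⟨K.inv g, K.src_inv g, K.tgt_inv g⟩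
      trans := by
        rintro x y z ⟨g, rfl, rfl⟩ ⟨h, hs, rfl⟩
        exact ⟨K.mul h g, K.src_mul h g hs, K.tgt_mul h g hs⟩ }

/-- The quotient space `|K|` of a groupoid, with the quotient topology. -/
def QuotientSpace (K : LieGroupoid.{u, v} I₀ I₁) : Type u := Quotient K.orbitSetoid

instance (K : LieGroupoid.{u, v} I₀ I₁) : TopologicalSpace K.QuotientSpace :=
  inferInstanceAs (TopologicalSpace (Quotient K.orbitSetoid))

/-! Isotropy groups -/

/-- The isotropy group of an object: the arrows from the object to itself. -/
def Isotropy (K : LieGroupoid.{u, v} I₀ I₁) (x : K.Ob) : Type v :=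
  {g : K.Arr // K.src g = x ∧ K.tgt g = x}

instance (K : LieGroupoid.{u, v} I₀ I₁) (x : K.Ob) : Group (K.Isotropy x) where
  mul g h := ⟨K.mul g.1 h.1,
    (K.src_mul _ _ (g.2.1.trans h.2.2.symm)).trans h.2.1,
    (K.tgt_mul _ _ (g.2.1.trans h.2.2.symm)).trans g.2.2⟩
  one := ⟨K.unit x, K.src_unit x, K.tgt_unit x⟩
  inv g := ⟨K.inv g.1, (K.src_inv _).trans g.2.2, (K.tgt_inv _).trans g.2.1⟩
  mul_assoc f g h := Subtype.ext
    (K.mul_assoc _ _ _ (f.2.1.trans g.2.2.symm) (g.2.1.trans h.2.2.symm))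
  one_mul g := Subtype.ext (by
    have h := K.unit_mul g.1
    rw [g.2.2] at h
    exact h)
  mul_one g := Subtype.ext (by
    have h := K.mul_unit g.1
    rw [g.2.1] at h
    exact h)
  inv_mul_cancel g := Subtype.ext (by
    have h := K.inv_mul g.1
    rw [g.2.1] at h
    exact h)

/-- Isotropy groups carry the discrete topology; for an étale groupoid this is the topology induced
from the arrows. -/
instance (K : LieGroupoid.{u, v} I₀ I₁) (x : K.Ob) : TopologicalSpace (K.Isotropy x) := ⊥

instance (K : LieGroupoid.{u, v} I₀ I₁) (x : K.Ob) : DiscreteTopology (K.Isotropy x) := ⟨rfl⟩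

/-- A discrete group is a zero-dimensional manifold. -/
instance (K : LieGroupoid.{u, v} I₀ I₁) (x : K.Ob) :
    ChartedSpace (EuclideanSpace ℝ (Fin 0)) (K.Isotropy x) :=
  ChartedSpace.ofDiscreteTopology

instance (K : LieGroupoid.{u, v} I₀ I₁) (x : K.Ob) : LieGroup (𝓡 0) ∞ (K.Isotropy x) where
  toIsManifold := IsManifold.of_discreteTopology ∞
  contMDiff_mul := contMDiff_of_discreteTopology
  contMDiff_inv := contMDiff_of_discreteTopology

/-! Homomorphisms and equivalences -/

/-- A homomorphism of Lie groupoids: a smooth functor. -/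
@[ext]
structure Hom (K : LieGroupoid.{u, v} I₀ I₁) (L : LieGroupoid.{u', v'} I₀' I₁') where
  ob : K.Ob → L.Ob
  arr : K.Arr → L.Arr
  smooth_ob : ContMDiff I₀ I₀' ∞ ob
  smooth_arr : ContMDiff I₁ I₁' ∞ arr
  src_arr : ∀ g, L.src (arr g) = ob (K.src g)
  tgt_arr : ∀ g, L.tgt (arr g) = ob (K.tgt g)
  map_unit : ∀ x, arr (K.unit x) = L.unit (ob x)
  map_inv : ∀ g, arr (K.inv g) = L.inv (arr g)
  map_mul : ∀ g h, K.src g = K.tgt h → arr (K.mul g h) = L.mul (arr g) (arr h)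

namespace Hom

variable {K : LieGroupoid.{u, v} I₀ I₁} {L : LieGroupoid.{u', v'} I₀' I₁'}
  {P : LieGroupoid.{u'', v''} I₀'' I₁''}

/-- Composition of homomorphisms. -/
def comp (ψ : Hom L P) (φ : Hom K L) : Hom K P where
  ob := ψ.ob ∘ φ.ob
  arr := ψ.arr ∘ φ.arr
  smooth_ob := ψ.smooth_ob.comp φ.smooth_ob
  smooth_arr := ψ.smooth_arr.comp φ.smooth_arr
  src_arr g := by simp [ψ.src_arr, φ.src_arr]
  tgt_arr g := by simp [ψ.tgt_arr, φ.tgt_arr]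
  map_unit x := by simp [ψ.map_unit, φ.map_unit]
  map_inv g := by simp [ψ.map_inv, φ.map_inv]
  map_mul g h e := by
    have e' : L.src (φ.arr g) = L.tgt (φ.arr h) := by rw [φ.src_arr, φ.tgt_arr, e]
    simp [φ.map_mul g h e, ψ.map_mul _ _ e']

/-- The map `|φ|` between quotient spaces. -/
def quotientMap (φ : Hom K L) : K.QuotientSpace → L.QuotientSpace :=
  Quotient.map φ.ob (by
    rintro x y ⟨g, rfl, rfl⟩
    exact ⟨φ.arr g, φ.src_arr g, φ.tgt_arr g⟩)

/-- The homomorphism between isotropy groups. -/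
def isotropyMap (φ : Hom K L) {y : K.Ob} {x : L.Ob} (hy : φ.ob y = x) :
    K.Isotropy y →* L.Isotropy x where
  toFun g := ⟨φ.arr g.1, by rw [φ.src_arr, g.2.1, hy], by rw [φ.tgt_arr, g.2.2, hy]⟩
  map_one' := Subtype.ext ((φ.map_unit y).trans (congrArg L.unit hy))
  map_mul' g h := Subtype.ext (φ.map_mul g.1 h.1 (g.2.1.trans h.2.2.symm))

end Hom

end LieGroupoid

/-- An immersion of manifolds: a smooth map whose derivative is injective at every point. -/
def IsImmersionOfManifolds
    {E : Type*} [NormedAddCommGroup E] [NormedSpace ℝ E] {X : Type*} [TopologicalSpace X]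
    (I : ModelWithCorners ℝ E X)
    {E' : Type*} [NormedAddCommGroup E'] [NormedSpace ℝ E'] {X' : Type*} [TopologicalSpace X']
    (I' : ModelWithCorners ℝ E' X')
    {M : Type*} [TopologicalSpace M] [ChartedSpace X M]
    {N : Type*} [TopologicalSpace N] [ChartedSpace X' N] (f : M → N) : Prop :=
  ContMDiff I I' ∞ f ∧ ∀ x, Function.Injective (mfderiv I I' f x)

/-- The commutative square given by `p : P → A`, `q : P → B`, `f : A → C`, `g : B → C` is a fibered
product of manifolds: `(p, q)` is a smooth embedding of `P` into `A × B` whose image is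
`{(a, b) | f a = g b}`. -/
structure IsFiberedProductOfManifolds
    {E : Type*} [NormedAddCommGroup E] [NormedSpace ℝ E] {X : Type*} [TopologicalSpace X]
    (I : ModelWithCorners ℝ E X)
    {E' : Type*} [NormedAddCommGroup E'] [NormedSpace ℝ E'] {X' : Type*} [TopologicalSpace X']
    (I' : ModelWithCorners ℝ E' X')
    {E'' : Type*} [NormedAddCommGroup E''] [NormedSpace ℝ E'']
    {X'' : Type*} [TopologicalSpace X''] (I'' : ModelWithCorners ℝ E'' X'')
    {P : Type*} [TopologicalSpace P] [ChartedSpace X P]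
    {A : Type*} [TopologicalSpace A] [ChartedSpace X' A]
    {B : Type*} [TopologicalSpace B] [ChartedSpace X'' B] {C : Type*}
    (p : P → A) (q : P → B) (f : A → C) (g : B → C) : Prop where
  immersion : IsImmersionOfManifolds I (I'.prod I'') (fun z => (p z, q z))
  embedding : IsEmbedding (fun z => (p z, q z))
  range_eq : range (fun z => (p z, q z)) = {w : A × B | f w.1 = g w.2}

namespace LieGroupoid

variable
  {E₀ : Type*} [NormedAddCommGroup E₀] [NormedSpace ℝ E₀] {X₀ : Type*} [TopologicalSpace X₀]
  {E₁ : Type*} [NormedAddCommGroup E₁] [NormedSpace ℝ E₁] {X₁ : Type*} [TopologicalSpace X₁]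
  {I₀ : ModelWithCorners ℝ E₀ X₀} {I₁ : ModelWithCorners ℝ E₁ X₁}
  {E₀' : Type*} [NormedAddCommGroup E₀'] [NormedSpace ℝ E₀'] {X₀' : Type*} [TopologicalSpace X₀']
  {E₁' : Type*} [NormedAddCommGroup E₁'] [NormedSpace ℝ E₁'] {X₁' : Type*} [TopologicalSpace X₁']
  {I₀' : ModelWithCorners ℝ E₀' X₀'} {I₁' : ModelWithCorners ℝ E₁' X₁'}

/-- An equivalence of Lie groupoids.  The first two conditions say that
`(g, y) ↦ tgt g`, defined on the fibered product `{(g, y) | src g = φ y}` of arrows of `L` and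
objects of `K`, is a surjective submersion; since `src` is a submersion, this fibered product is a
manifold whose tangent space at `(g, y)` consists of the pairs `(v, w)` of tangent vectors with
`d src v = d φ w`. -/
structure Hom.IsEquivalence {K : LieGroupoid.{u, v} I₀ I₁} {L : LieGroupoid.{u', v'} I₀' I₁'}
    (φ : Hom K L) : Prop where
  essentially_surjective : ∀ x : L.Ob, ∃ (g : L.Arr) (y : K.Ob), L.src g = φ.ob y ∧ L.tgt g = x
  submersion : ∀ (g : L.Arr) (y : K.Ob), L.src g = φ.ob y →
    ∀ ξ : TangentSpace I₀' (L.tgt g),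
      ∃ (v : TangentSpace I₁' g) (w : TangentSpace I₀ y),
        mfderiv I₁' I₀' L.src g v = mfderiv I₀ I₀' φ.ob y w ∧ mfderiv I₁' I₀' L.tgt g v = ξ
  fibered_product : IsFiberedProductOfManifolds I₁ (I₀.prod I₀) I₁'
    (fun h : K.Arr => (K.src h, K.tgt h)) φ.arr
    (fun w : K.Ob × K.Ob => (φ.ob w.1, φ.ob w.2)) (fun g : L.Arr => (L.src g, L.tgt g))

/-- `φ` restricts to an isomorphism of Lie groupoids from `K` onto the restriction of `L` to
the open set `U` of objects (all arrows of `L` with source and target in `U`): on objects and on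
arrows it is an injective local diffeomorphism, hence a diffeomorphism onto its open image, and the
image is `U`, respectively the set of arrows of the restriction. -/
structure Hom.IsIsoOntoRestriction {K : LieGroupoid.{u, v} I₀ I₁}
    {L : LieGroupoid.{u', v'} I₀' I₁'} (φ : Hom K L) (U : Set L.Ob) : Prop where
  injective_ob : Function.Injective φ.ob
  localDiffeo_ob : IsLocalDiffeomorph I₀ I₀' ∞ φ.ob
  range_ob : range φ.ob = U
  injective_arr : Function.Injective φ.arr
  localDiffeo_arr : IsLocalDiffeomorph I₁ I₁' ∞ φ.arr
  range_arr : range φ.arr = {g | L.src g ∈ U ∧ L.tgt g ∈ U}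

end LieGroupoid

/-! Translation groupoids -/

/-- The translation groupoid `G ⋉ M` of a smooth action: the arrow `(g, x)` goes from `x` to
`g • x`. -/
@[reducible]
def translationGroupoid
    {E : Type*} [NormedAddCommGroup E] [NormedSpace ℝ E] {X : Type*} [TopologicalSpace X]
    (I : ModelWithCorners ℝ E X)
    {E' : Type*} [NormedAddCommGroup E'] [NormedSpace ℝ E'] {X' : Type*} [TopologicalSpace X']
    (I' : ModelWithCorners ℝ E' X')
    (G : Type v) [Group G] [TopologicalSpace G] [ChartedSpace X G] [LieGroup I ∞ G]
    (M : Type u) [TopologicalSpace M] [ChartedSpace X' M] [IsManifold I' ∞ M]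
    [MulAction G M] [ContMDiffSMul I I' ∞ G M] :
    LieGroupoid.{u, max v u} I' (I.prod I') where
  Ob := M
  Arr := G × M
  src p := p.2
  tgt p := p.1 • p.2
  unit x := (1, x)
  inv p := (p.1⁻¹, p.1 • p.2)
  mul p q := (p.1 * q.1, q.2)
  src_unit _ := rfl
  tgt_unit x := one_smul G x
  src_inv _ := rfl
  tgt_inv p := inv_smul_smul p.1 p.2
  src_mul _ _ _ := rfl
  tgt_mul p q h := by simp [mul_smul, h]
  mul_assoc f g h _ _ := by simp [_root_.mul_assoc]
  mul_unit g := by simp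
  unit_mul g := by simp
  inv_mul g := by simp
  mul_inv g := by simp
  smooth_src := contMDiff_snd
  smooth_tgt := ContMDiffSMul.contMDiff_smul
  smooth_unit := contMDiff_const.prodMk contMDiff_id
  smooth_inv := ((contMDiff_inv I ∞).comp contMDiff_fst).prodMk ContMDiffSMul.contMDiff_smul
  smooth_mul := ((((contMDiff_mul I ∞).comp
    ((contMDiff_fst.comp contMDiff_fst).prodMk (contMDiff_fst.comp contMDiff_snd)))).prodMk
    (contMDiff_snd.comp contMDiff_snd)).contMDiffOn
  submersion_src p := by
    rw [show (fun p : G × M => p.2) = Prod.snd from rfl, mfderiv_snd]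
    exact fun w => ⟨(0, w), rfl⟩

/-- The homomorphism of translation groupoids induced by an equivariant smooth map. -/
def translationHom
    {E : Type*} [NormedAddCommGroup E] [NormedSpace ℝ E] {X : Type*} [TopologicalSpace X]
    (I : ModelWithCorners ℝ E X)
    {E' : Type*} [NormedAddCommGroup E'] [NormedSpace ℝ E'] {X' : Type*} [TopologicalSpace X']
    (I' : ModelWithCorners ℝ E' X')
    {E'' : Type*} [NormedAddCommGroup E''] [NormedSpace ℝ E'']
    {X'' : Type*} [TopologicalSpace X''] (I'' : ModelWithCorners ℝ E'' X'')
    (G : Type v) [Group G] [TopologicalSpace G] [ChartedSpace X G] [LieGroup I ∞ G]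
    {N : Type u} [TopologicalSpace N] [ChartedSpace X' N] [IsManifold I' ∞ N]
    [MulAction G N] [ContMDiffSMul I I' ∞ G N]
    {M : Type u'} [TopologicalSpace M] [ChartedSpace X'' M] [IsManifold I'' ∞ M]
    [MulAction G M] [ContMDiffSMul I I'' ∞ G M]
    (f : N → M) (hf : ContMDiff I' I'' ∞ f) (hequiv : ∀ (g : G) (x : N), f (g • x) = g • f x) :
    LieGroupoid.Hom (translationGroupoid I I' G N) (translationGroupoid I I'' G M) where
  ob := f
  arr p := (p.1, f p.2)
  smooth_ob := hf
  smooth_arr := contMDiff_fst.prodMk (hf.comp contMDiff_snd)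
  src_arr _ := rfl
  tgt_arr p := (hequiv p.1 p.2).symm
  map_unit _ := rfl
  map_inv p := Prod.ext rfl (hequiv p.1 p.2)
  map_mul _ _ _ := rfl

/-! The balanced product -/

section BalancedProduct

variable {Γ : Type*} [Group Γ] {Δ : Type*} [Group Δ] (f : Δ →* Γ) (V : Type*) [MulAction Δ V]

/-- The orbit relation of the action `h · (k, z) = (k f(h)⁻¹, h • z)` of `Δ` on `Γ × V`. -/
def balancedSetoid : Setoid (Γ × V) where
  r a b := ∃ h : Δ, b = (a.1 * (f h)⁻¹, h • a.2)
  iseqv :=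
    { refl := fun a => ⟨1, by simp⟩
      symm := by
        rintro a b ⟨h, rfl⟩
        exact ⟨h⁻¹, by simp⟩
      trans := by
        rintro a b c ⟨h, rfl⟩ ⟨h', rfl⟩
        exact ⟨h' * h, by simp [mul_smul, _root_.mul_assoc]⟩ }

/-- The balanced product `Γ ×_Δ V`. -/
def BalancedProduct : Type _ := Quotient (balancedSetoid f V)

/-- The class `[k, z]`. -/
def BalancedProduct.mk (p : Γ × V) : BalancedProduct f V := Quotient.mk (balancedSetoid f V) p

/-- `Γ` acts on `Γ ×_Δ V` by `γ • [k, z] = [γ k, z]`. -/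
instance : MulAction Γ (BalancedProduct f V) where
  smul γ := Quotient.map (fun p : Γ × V => (γ * p.1, p.2)) (by
    rintro a b ⟨h, rfl⟩
    exact ⟨h, by simp [_root_.mul_assoc]⟩)
  one_smul := by
    rintro ⟨p⟩
    exact congrArg (Quotient.mk _) (by simp)
  mul_smul γ γ' := by
    rintro ⟨p⟩
    exact congrArg (Quotient.mk _) (by simp [_root_.mul_assoc])

/-- The quotient topology. -/
instance [TopologicalSpace Γ] [TopologicalSpace V] : TopologicalSpace (BalancedProduct f V) :=
  inferInstanceAs (TopologicalSpace (Quotient (balancedSetoid f V)))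

end BalancedProduct

/-! Orbifold embeddings -/

namespace LieGroupoid

variable
  {E₀ : Type*} [NormedAddCommGroup E₀] [NormedSpace ℝ E₀] {X₀ : Type*} [TopologicalSpace X₀]
  {E₁ : Type*} [NormedAddCommGroup E₁] [NormedSpace ℝ E₁] {X₁ : Type*} [TopologicalSpace X₁]
  {I₀ : ModelWithCorners ℝ E₀ X₀} {I₁ : ModelWithCorners ℝ E₁ X₁}
  {E₀' : Type*} [NormedAddCommGroup E₀'] [NormedSpace ℝ E₀'] {X₀' : Type*} [TopologicalSpace X₀']
  {E₁' : Type*} [NormedAddCommGroup E₁'] [NormedSpace ℝ E₁'] {X₁' : Type*} [TopologicalSpace X₁']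
  {I₀' : ModelWithCorners ℝ E₀' X₀'} {I₁' : ModelWithCorners ℝ E₁' X₁'}

/-- An isomorphism `K|_U ≅ K_x ⋉ U`, where `U` is an open neighborhood of `x` and `K_x ⋉ U` is formed
with a given smooth action of the isotropy group `K_x` on `U`.  It is the identity on objects, and at `x` it identifies the elements of
`K_x` with themselves. -/
structure LocalChart (K : LieGroupoid.{u, v} I₀ I₁) (x : K.Ob) (U : TopologicalSpace.Opens K.Ob)
    [MulAction (K.Isotropy x) U] [ContMDiffSMul (𝓡 0) I₀ ∞ (K.Isotropy x) U] where
  mem : x ∈ U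
  hom : Hom (translationGroupoid (𝓡 0) I₀ (K.Isotropy x) U) K
  iso : hom.IsIsoOntoRestriction (U : Set K.Ob)
  hom_ob : ∀ z : U, hom.ob z = z
  hom_arr : ∀ γ : K.Isotropy x, hom.arr (γ, ⟨x, mem⟩) = γ.1

/-- The local model of an orbifold embedding `φ : K → L` near `x = φ y`, with respect to a chart
`L|_U ≅ L_x ⋉ U` and the action of `K_y` on `V` given by a chart `K|_V ≅ K_y ⋉ V`: an isomorphism of Lie groupoids
`K|_{φ⁻¹(U)} ≅ L_x ⋉ (L_x ×_{K_y} V)`.  The quotient manifold structure of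
`L_x ×_{K_y} V` is the unique one for which the projection from `L_x × V` is a local
diffeomorphism.  The isomorphism extends the inclusion of `V` (it sends `[1, z]` to `z`), and under it
and the chart of `L` at `x` the homomorphism `φ` becomes `(γ, e) ↦ (γ, φ e)` on arrows. -/
structure LocalModel {K : LieGroupoid.{u, v} I₀ I₁} {L : LieGroupoid.{u', v'} I₀' I₁'}
    (φ : Hom K L) {x : L.Ob} {y : K.Ob} (hy : φ.ob y = x)
    {U : TopologicalSpace.Opens L.Ob}
    [MulAction (L.Isotropy x) U] [ContMDiffSMul (𝓡 0) I₀' ∞ (L.Isotropy x) U]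
    (cU : L.LocalChart x U)
    (V : TopologicalSpace.Opens K.Ob) [MulAction (K.Isotropy y) V] where
  [charted : ChartedSpace X₀ (BalancedProduct (φ.isotropyMap hy) V)]
  [manifold : IsManifold I₀ ∞ (BalancedProduct (φ.isotropyMap hy) V)]
  localDiffeo_mk : IsLocalDiffeomorph ((𝓡 0).prod I₀) I₀ ∞
    (BalancedProduct.mk (φ.isotropyMap hy) V)
  [smooth_action : ContMDiffSMul (𝓡 0) I₀ ∞ (L.Isotropy x)
    (BalancedProduct (φ.isotropyMap hy) V)]
  hom : Hom (translationGroupoid (𝓡 0) I₀ (L.Isotropy x)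
    (BalancedProduct (φ.isotropyMap hy) V)) K
  iso : hom.IsIsoOntoRestriction (φ.ob ⁻¹' (U : Set L.Ob))
  hom_mk_one : ∀ z : V, hom.ob (BalancedProduct.mk (φ.isotropyMap hy) V (1, z)) = z
  map_hom : ∀ (γ : L.Isotropy x) (e : BalancedProduct (φ.isotropyMap hy) V) (w : U),
    φ.ob (hom.ob e) = w → φ.arr (hom.arr (γ, e)) = cU.hom.arr (γ, w)

/-- The conditions in the definition of an orbifold embedding apart from properness of `|φ|`. -/
structure Hom.IsInjectiveOrbifoldImmersion {K : LieGroupoid.{u, v} I₀ I₁}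
    {L : LieGroupoid.{u', v'} I₀' I₁'} (φ : Hom K L) : Prop where
  immersion : IsImmersionOfManifolds I₀ I₀' φ.ob
  /-- `K` acts transitively on the fibers of `φ` on objects -/
  transitive : ∀ y y' : K.Ob, φ.ob y = φ.ob y' → ∃ h : K.Arr, K.src h = y ∧ K.tgt h = y'
  /-- for arbitrarily small chart neighborhoods `U` of a point `x` of the image, the restriction of
  `K` to the preimage of `U` is given by the local model at every `y` over `x` -/
  local_model : ∀ x ∈ range φ.ob, ∀ W ∈ 𝓝 x,
    ∃ (U : TopologicalSpace.Opens L.Ob)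
      (_ : MulAction (L.Isotropy x) U) (_ : ContMDiffSMul (𝓡 0) I₀' ∞ (L.Isotropy x) U)
      (cU : L.LocalChart x U), (U : Set L.Ob) ⊆ W ∧
      ∀ (y : K.Ob) (hy : φ.ob y = x),
        ∃ (V : TopologicalSpace.Opens K.Ob)
          (_ : MulAction (K.Isotropy y) V) (_ : ContMDiffSMul (𝓡 0) I₀ ∞ (K.Isotropy y) V),
          Nonempty (K.LocalChart y V) ∧ Nonempty (LocalModel φ hy cU V)
  injective : Function.Injective φ.quotientMap

/-- An orbifold embedding. -/
structure Hom.IsOrbifoldEmbedding {K : LieGroupoid.{u, v} I₀ I₁}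
    {L : LieGroupoid.{u', v'} I₀' I₁'} (φ : Hom K L) : Prop
    extends φ.IsInjectiveOrbifoldImmersion where
  proper : IsProperMap φ.quotientMap

end LieGroupoid

/-! Equivariant immersions -/

/-- An action is locally free if all isotropy groups are discrete. -/
def IsLocallyFreeAction (G : Type*) [Group G] [TopologicalSpace G] (M : Type*) [MulAction G M] :
    Prop :=
  ∀ p : M, DiscreteTopology (MulAction.stabilizer G p)

/-- A strong `G`-equivariant immersion: for every point `p`, the isotropy group of `p` acts
transitively on the fiber over `p`. -/
structure IsStrongEquivariantImmersion
    {E' : Type*} [NormedAddCommGroup E'] [NormedSpace ℝ E'] {X' : Type*} [TopologicalSpace X']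
    (I' : ModelWithCorners ℝ E' X')
    {E'' : Type*} [NormedAddCommGroup E''] [NormedSpace ℝ E'']
    {X'' : Type*} [TopologicalSpace X''] (I'' : ModelWithCorners ℝ E'' X'')
    (G : Type*) [Group G]
    {N : Type*} [TopologicalSpace N] [ChartedSpace X' N] [MulAction G N]
    {M : Type*} [TopologicalSpace M] [ChartedSpace X'' M] [MulAction G M]
    (f : N → M) : Prop where
  immersion : IsImmersionOfManifolds I' I'' f
  equivariant : ∀ (g : G) (x : N), f (g • x) = g • f x
  strong : ∀ (p : M) (q q' : N), f q = p → f q' = p →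
    ∃ g ∈ MulAction.stabilizer G p, g • q = q'

end

/-! Both translation groupoids are replaced by their pullbacks to transversals meeting every orbit,
chosen so compatibly that `ι` restricts to a map between the transversals.

Local freeness makes every orbit map an immersion at `1` (`mfderiv_orbitMap_injective`): the
integral curve of the left-invariant field of a killed vector would run inside a discrete
stabilizer. Hence through each `p` in `M` there is a transversal `σ` with `(g, s) ↦ g • σ s` étale,
and a transversal at a point of `N` over `p` can be moved pointwise by elements of `G` to a `b` with
`ι ∘ b = σ ∘ φ` (`exists_adapted_transversal`). Since `ι` is strong, the fiber over `p` is empty or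
an orbit of the finite stabilizer of `p`, so all its points can be treated at once.
`exists_shrinking` then uses compactness of `G` and of closed balls to make the maps `φ` proper over
a neighborhood `U` of `0` and to lift every arrow from a point of the image to a point of `U`.
Countably many `p` suffice. The objects downstairs are the disjoint union of their `U`, those
upstairs the disjoint union of the disks at all points over them. The whole fiber is needed, because
a lifted arrow may end on another disk.

The pullback of a translation groupoid along an étale transversal is a proper étale groupoid, and is
equivalent to it when all orbits are met. The induced homomorphism is an immersion on objects
because `σ ∘ φ = ι ∘ b`; transitivity on fibers and injectivity on orbit spaces are the strongness
of `ι`. The local model is a general fact on étale groupoids (`LieGroupoid.Hom.exists_local_model`):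
near `x` the arrows are sections indexed by the finite isotropy group of `x`. They lift uniquely, so
this group acts on the preimage of a neighborhood, and the fiber over `x` is one orbit whose
stabilizer at `y` is the isotropy group of `y`. Since the map on objects is closed, the translates
of a slice at `y` fill the preimage of a small neighborhood, which is therefore a balanced product.

If `ι` is proper it is closed. Closed sets of the upper orbit space are closed invariant sets of
`N`, so the injective map of orbit spaces is a closed embedding and hence proper. -/

/-! ### Calculus of local diffeomorphisms. -/

section LocalDiffeo

variable
  {E : Type*} [NormedAddCommGroup E] [NormedSpace ℝ E] {X : Type*} [TopologicalSpace X]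
  {I : ModelWithCorners ℝ E X}
  {E' : Type*} [NormedAddCommGroup E'] [NormedSpace ℝ E'] {X' : Type*} [TopologicalSpace X']
  {I' : ModelWithCorners ℝ E' X'}
  {E'' : Type*} [NormedAddCommGroup E''] [NormedSpace ℝ E''] {X'' : Type*} [TopologicalSpace X'']
  {I'' : ModelWithCorners ℝ E'' X''}
  {E₃ : Type*} [NormedAddCommGroup E₃] [NormedSpace ℝ E₃] {X₃ : Type*} [TopologicalSpace X₃]
  {I₃ : ModelWithCorners ℝ E₃ X₃}
  {M : Type*} [TopologicalSpace M] [ChartedSpace X M]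
  {N : Type*} [TopologicalSpace N] [ChartedSpace X' N]
  {P : Type*} [TopologicalSpace P] [ChartedSpace X'' P]
  {Q : Type*} [TopologicalSpace Q] [ChartedSpace X₃ Q]

theorem IsLocalDiffeomorphAt.congr_of_eventuallyEq {f g : M → N} {x : M}
    (hf : IsLocalDiffeomorphAt I I' ∞ f x) (h : g =ᶠ[𝓝 x] f) :
    IsLocalDiffeomorphAt I I' ∞ g x := by
  obtain ⟨Φ, hx, heq⟩ := hf
  obtain ⟨U, hU, hUo, hxU⟩ := eventually_nhds_iff.1 h
  let e : OpenPartialHomeomorph M N := Φ.toOpenPartialHomeomorph.restr U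
  have he : e.source = Φ.source ∩ U := by
    rw [OpenPartialHomeomorph.restr_source, hUo.interior_eq]
    rfl
  refine ⟨⟨e.toPartialEquiv, e.open_source, e.open_target, ?_, ?_⟩, ?_, ?_⟩
  · exact Φ.contMDiffOn_toFun.mono (by rw [he]; exact inter_subset_left)
  · refine Φ.contMDiffOn_invFun.mono ?_
    intro y hy
    exact hy.1
  · exact he.symm ▸ (⟨hx, hxU⟩ : x ∈ Φ.source ∩ U)
  · intro y hy
    have hy' : y ∈ Φ.source ∩ U := he ▸ hy
    exact (hU y hy'.2).trans (heq hy'.1)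

theorem isLocalDiffeomorphAt_of_contMDiffOn {f : M → N} {x : M} (e : OpenPartialHomeomorph M N)
    (hx : x ∈ e.source) (hf : EqOn f e e.source) (h : ContMDiffOn I I' ∞ e e.source)
    (h' : ContMDiffOn I' I ∞ e.symm e.target) : IsLocalDiffeomorphAt I I' ∞ f x :=
  ⟨⟨e.toPartialEquiv, e.open_source, e.open_target, h, h'⟩, hx, hf⟩

theorem isLocalDiffeomorph_id : IsLocalDiffeomorph I I ∞ (id : M → M) := fun _ =>
  isLocalDiffeomorphAt_of_contMDiffOn (OpenPartialHomeomorph.refl M) (mem_univ _)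
    (fun _ _ => rfl) contMDiffOn_id contMDiffOn_id

/-- A continuous lift of a smooth map through a local diffeomorphism is smooth. -/
theorem ContMDiffWithinAt.of_localDiffeo_comp {f : M → N} {Ψ : N → P} {s : Set M} {x : M}
    (h : ContMDiffWithinAt I I'' ∞ (Ψ ∘ f) s x) (hΨ : IsLocalDiffeomorphAt I' I'' ∞ Ψ (f x))
    (hf : ContinuousWithinAt f s x) : ContMDiffWithinAt I I' ∞ f s x := by
  have h1 : ContMDiffWithinAt I I' ∞ (hΨ.localInverse ∘ (Ψ ∘ f)) s x :=
    ContMDiffAt.comp_contMDiffWithinAt x hΨ.localInverse_contMDiffAt h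
  have hx : hΨ.localInverse (Ψ (f x)) = f x := hΨ.localInverse_left_inv hΨ.localInverse_mem_target
  refine h1.congr_of_eventuallyEq ?_ hx.symm
  filter_upwards [hf.eventually hΨ.localInverse_eventuallyEq_left] with y hy
  exact hy.symm

theorem ContMDiffAt.of_localDiffeo_comp {f : M → N} {Ψ : N → P} {x : M}
    (h : ContMDiffAt I I'' ∞ (Ψ ∘ f) x) (hΨ : IsLocalDiffeomorphAt I' I'' ∞ Ψ (f x))
    (hf : ContinuousAt f x) : ContMDiffAt I I' ∞ f x :=
  ContMDiffWithinAt.of_localDiffeo_comp h hΨ hf.continuousWithinAt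

theorem ContMDiff.of_localDiffeo_comp {f : M → N} {Ψ : N → P}
    (h : ContMDiff I I'' ∞ (Ψ ∘ f)) (hΨ : IsLocalDiffeomorph I' I'' ∞ Ψ)
    (hf : Continuous f) : ContMDiff I I' ∞ f :=
  fun x => ContMDiffAt.of_localDiffeo_comp (h x) (hΨ _) hf.continuousAt

/-- Compose with a local inverse of `Ψ`. Continuity of `f` is needed: it keeps the values of `f`
near `f x`, where that inverse undoes `Ψ`. Without it `f` could jump between sheets of `Ψ`. -/
theorem IsLocalDiffeomorphAt.of_comp_left {f : M → N} {Ψ : N → P} {x : M}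
    (h : IsLocalDiffeomorphAt I I'' ∞ (Ψ ∘ f) x) (hΨ : IsLocalDiffeomorphAt I' I'' ∞ Ψ (f x))
    (hf : ContinuousAt f x) : IsLocalDiffeomorphAt I I' ∞ f x := by
  refine (h.comp I' N (g := hΨ.localInverse)
    hΨ.localInverse_isLocalDiffeomorphAt).congr_of_eventuallyEq ?_
  filter_upwards [hf.eventually hΨ.localInverse_eventuallyEq_left] with y hy
  exact hy.symm

theorem IsLocalDiffeomorph.of_comp_left {f : M → N} {Ψ : N → P}
    (h : IsLocalDiffeomorph I I'' ∞ (Ψ ∘ f)) (hΨ : IsLocalDiffeomorph I' I'' ∞ Ψ)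
    (hf : Continuous f) : IsLocalDiffeomorph I I' ∞ f :=
  fun x => (h x).of_comp_left (hΨ _) hf.continuousAt

theorem IsLocalDiffeomorph.comp {f : M → N} {Ψ : N → P}
    (hΨ : IsLocalDiffeomorph I' I'' ∞ Ψ) (hf : IsLocalDiffeomorph I I' ∞ f) :
    IsLocalDiffeomorph I I'' ∞ (Ψ ∘ f) :=
  fun x => (hf x).comp I'' P (hΨ _)

/-- Local diffeomorphisms can be cancelled on the right. -/
theorem IsLocalDiffeomorphAt.of_comp_right {f : M → N} {Ψ : N → P} {x : M}
    (h : IsLocalDiffeomorphAt I I'' ∞ (Ψ ∘ f) x) (hf : IsLocalDiffeomorphAt I I' ∞ f x) :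
    IsLocalDiffeomorphAt I' I'' ∞ Ψ (f x) := by
  have hx : hf.localInverse (f x) = x := hf.localInverse_left_inv hf.localInverse_mem_target
  have h1 := hf.localInverse_isLocalDiffeomorphAt.comp I'' P (g := Ψ ∘ f) (by rwa [hx])
  refine h1.congr_of_eventuallyEq ?_
  filter_upwards [hf.localInverse_eventuallyEq_right] with y hy
  exact congrArg Ψ (hy.symm : y = f (hf.localInverse y))

theorem IsLocalDiffeomorphAt.prodMap {f : M → N} {g : P → Q} {x : M} {y : P}
    (hf : IsLocalDiffeomorphAt I I' ∞ f x) (hg : IsLocalDiffeomorphAt I'' I₃ ∞ g y) :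
    IsLocalDiffeomorphAt (I.prod I'') (I'.prod I₃) ∞ (Prod.map f g) (x, y) := by
  obtain ⟨Φ, hx, heq⟩ := hf
  obtain ⟨Ψ, hy, heq'⟩ := hg
  refine isLocalDiffeomorphAt_of_contMDiffOn
    (Φ.toOpenPartialHomeomorph.prod Ψ.toOpenPartialHomeomorph) ⟨hx, hy⟩ ?_ ?_ ?_
  · rintro ⟨a, b⟩ ⟨ha, hb⟩
    exact Prod.ext (heq ha) (heq' hb)
  · exact Φ.contMDiffOn_toFun.prodMap Ψ.contMDiffOn_toFun
  · exact Φ.contMDiffOn_invFun.prodMap Ψ.contMDiffOn_invFun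

theorem IsLocalDiffeomorphAt.eventually {f : M → N} {x : M}
    (hf : IsLocalDiffeomorphAt I I' ∞ f x) : ∀ᶠ y in 𝓝 x, IsLocalDiffeomorphAt I I' ∞ f y := by
  obtain ⟨Φ, hx, heq⟩ := hf
  filter_upwards [Φ.open_source.mem_nhds hx] with y hy
  exact ⟨Φ, hy, heq⟩

/-- A local diffeomorphism is injective near each point. -/
theorem IsLocalDiffeomorphAt.exists_injOn {f : M → N} {x : M}
    (hf : IsLocalDiffeomorphAt I I' ∞ f x) : ∃ U ∈ 𝓝 x, InjOn f U := by
  obtain ⟨Φ, hx, heq⟩ := hf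
  exact ⟨Φ.source, Φ.open_source.mem_nhds hx, heq.injOn_iff.2 Φ.toPartialEquiv.injOn⟩

theorem IsLocalDiffeomorphAt.map_nhds_eq {f : M → N} {x : M}
    (hf : IsLocalDiffeomorphAt I I' ∞ f x) : map f (𝓝 x) = 𝓝 (f x) := by
  obtain ⟨Φ, hx, heq⟩ := hf
  have h1 : f =ᶠ[𝓝 x] Φ := eventually_of_mem (Φ.open_source.mem_nhds hx) heq
  rw [Filter.map_congr h1, heq hx]
  exact Φ.toOpenPartialHomeomorph.map_nhds_eq hx

theorem IsLocalDiffeomorphAt.mfderiv_bijective {f : M → N} {x : M}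
    (hf : IsLocalDiffeomorphAt I I' ∞ f x) : Function.Bijective (mfderiv I I' f x) := by
  rw [← hf.mfderivToContinuousLinearEquiv_coe (by simp)]
  exact (hf.mfderivToContinuousLinearEquiv (by simp)).bijective

theorem isLocalDiffeomorphAt_chartAt [IsManifold I ∞ M] (x : M) {y : M}
    (hy : y ∈ (chartAt X x).source) : IsLocalDiffeomorphAt I I ∞ (chartAt X x) y :=
  isLocalDiffeomorphAt_of_contMDiffOn _ hy (fun _ _ => rfl) contMDiffOn_chart contMDiffOn_chart_symm

theorem isLocalDiffeomorph_subtype_val (U : TopologicalSpace.Opens M) [IsManifold I ∞ M] :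
    IsLocalDiffeomorph I I ∞ (Subtype.val : U → M) := by
  intro x
  -- The chart of an open subset is the restriction of the ambient chart, so the inclusion is the
  -- identity in charts.
  have hc : (chartAt X (x : M)) ∘ (Subtype.val : U → M) = chartAt X x := by
    ext z
    rfl
  have h1 := isLocalDiffeomorphAt_chartAt (I := I) x (mem_chart_source X x)
  rw [← hc] at h1
  exact h1.of_comp_left (isLocalDiffeomorphAt_chartAt (I := I) (x : M) (mem_chart_source X (x : M)))
    continuous_subtype_val.continuousAt

/-- The projection of the product of a discrete space and a manifold is a local diffeomorphism. -/
theorem isLocalDiffeomorph_snd_of_discrete {Γ : Type*} [TopologicalSpace Γ] [DiscreteTopology Γ]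
    [ChartedSpace (EuclideanSpace ℝ (Fin 0)) Γ] :
    IsLocalDiffeomorph ((𝓡 0).prod I) I ∞ (Prod.snd : Γ × M → M) := by
  rintro ⟨γ, x⟩
  let e : OpenPartialHomeomorph (Γ × M) M :=
    { toFun := Prod.snd
      invFun := fun y => (γ, y)
      source := {γ} ×ˢ univ
      target := univ
      map_source' := fun _ _ => mem_univ _
      map_target' := fun y _ => ⟨rfl, mem_univ _⟩
      left_inv' := by
        rintro ⟨a, b⟩ ⟨ha, -⟩
        exact Prod.ext (Eq.symm ha) rfl
      right_inv' := fun _ _ => rfl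
      open_source := (isOpen_discrete _).prod isOpen_univ
      open_target := isOpen_univ
      continuousOn_toFun := continuous_snd.continuousOn
      continuousOn_invFun := (Continuous.prodMk_right γ).continuousOn }
  exact isLocalDiffeomorphAt_of_contMDiffOn e ⟨rfl, mem_univ _⟩ (fun _ _ => rfl)
    contMDiff_snd.contMDiffOn (contMDiff_const.prodMk contMDiff_id).contMDiffOn

end LocalDiffeo

/-! ### Manifold structures pulled back along local homeomorphisms. -/

section PullbackManifold

variable
  {E : Type*} [NormedAddCommGroup E] [NormedSpace ℝ E] {H : Type*} [TopologicalSpace H]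
  (I : ModelWithCorners ℝ E H)
  {X : Type*} [TopologicalSpace X] {Y : Type*} [TopologicalSpace Y] [ChartedSpace H Y]
  {f : X → Y} (hf : IsLocalHomeomorph f)

/-- The manifold structure pulled back along a local homeomorphism. -/
@[reducible]
noncomputable def IsLocalHomeomorph.pullbackChartedSpace : ChartedSpace H X where
  atlas := range fun x => (hf.localInverseAt x).symm.trans (chartAt H (f x))
  chartAt x := (hf.localInverseAt x).symm.trans (chartAt H (f x))
  mem_chart_source x := by simp
  chart_mem_atlas x := mem_range_self x

/-- In a change of charts the two local inverses of `f` cancel, so it is a restriction of a change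
of charts of `Y` to an open set. -/
theorem IsLocalHomeomorph.pullback_isManifold [IsManifold I ∞ Y] :
    @IsManifold ℝ _ E _ _ H _ I ∞ X _ hf.pullbackChartedSpace := by
  letI := hf.pullbackChartedSpace (H := H)
  refine @IsManifold.mk' _ _ _ _ _ _ _ _ _ _ _ _ ⟨?_⟩
  rintro _ _ ⟨x, rfl⟩ ⟨y, rfl⟩
  have h : (chartAt H (f x)).symm.trans (chartAt H (f y)) ∈ contDiffGroupoid ∞ I :=
    HasGroupoid.compatible (chart_mem_atlas H _) (chart_mem_atlas H _)
  set e := ((hf.localInverseAt x).symm.trans (chartAt H (f x))).symm.trans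
    ((hf.localInverseAt y).symm.trans (chartAt H (f y))) with he
  refine (contDiffGroupoid ∞ I).mem_of_eqOnSource
    (closedUnderRestriction' h e.open_source) ?_
  refine ⟨?_, ?_⟩
  · rw [OpenPartialHomeomorph.restr_source, e.open_source.interior_eq]
    refine (inter_eq_self_of_subset_right ?_).symm
    intro z hz
    simp only [he, OpenPartialHomeomorph.trans_source,
      OpenPartialHomeomorph.trans_symm_eq_symm_trans_symm, OpenPartialHomeomorph.symm_symm,
      mem_inter_iff, mem_preimage, OpenPartialHomeomorph.symm_source,
      OpenPartialHomeomorph.coe_trans, Function.comp_apply,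
      IsLocalHomeomorph.localInverseAt_symm] at hz
    obtain ⟨⟨h1, h2⟩, h3, h4⟩ := hz
    rw [hf.apply_localInverseAt_of_mem h2] at h4
    simp [h1, h4]
  · intro z hz
    simp only [he, OpenPartialHomeomorph.trans_source,
      OpenPartialHomeomorph.trans_symm_eq_symm_trans_symm, OpenPartialHomeomorph.symm_symm,
      mem_inter_iff, mem_preimage, OpenPartialHomeomorph.symm_source,
      OpenPartialHomeomorph.coe_trans, Function.comp_apply,
      IsLocalHomeomorph.localInverseAt_symm] at hz
    obtain ⟨⟨h1, h2⟩, h3, h4⟩ := hz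
    simp [he, hf.apply_localInverseAt_of_mem h2]

theorem IsLocalHomeomorph.pullback_isLocalDiffeomorph [IsManifold I ∞ Y] :
    @IsLocalDiffeomorph ℝ _ E _ _ E _ _ H _ H _ I I X _ hf.pullbackChartedSpace Y _ _ ∞ f := by
  letI := hf.pullbackChartedSpace (H := H)
  haveI := hf.pullback_isManifold I
  intro x
  have h1 := isLocalDiffeomorphAt_chartAt (I := I) x (mem_chart_source H x)
  have hc : (chartAt H (f x)) ∘ f = chartAt H x := by
    ext z
    change _ = ((hf.localInverseAt x).symm.trans (chartAt H (f x))) z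
    simp
  rw [← hc] at h1
  exact h1.of_comp_left (isLocalDiffeomorphAt_chartAt (I := I) (f x) (mem_chart_source H (f x)))
    hf.continuous.continuousAt

end PullbackManifold

/-! ### The inverse function theorem for boundaryless manifolds. -/

section InverseFunction

variable
  {E : Type*} [NormedAddCommGroup E] [NormedSpace ℝ E] [CompleteSpace E]
  {H : Type*} [TopologicalSpace H]
  {I : ModelWithCorners ℝ E H} [I.Boundaryless]
  {E' : Type*} [NormedAddCommGroup E'] [NormedSpace ℝ E'] [CompleteSpace E']
  {H' : Type*} [TopologicalSpace H']
  {I' : ModelWithCorners ℝ E' H'} [I'.Boundaryless]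
  {M : Type*} [TopologicalSpace M] [ChartedSpace H M] [IsManifold I ∞ M]
  {N : Type*} [TopologicalSpace N] [ChartedSpace H' N] [IsManifold I' ∞ N]

/-- The inverse function theorem supplies a local homeomorphism whose inverse is smooth wherever the
derivative is invertible. Invertible operators form an open set, so restricting to the points with
invertible derivative keeps a neighborhood of `a` and makes the inverse smooth on the whole target.
-/
theorem ContDiffOn.isLocalDiffeomorphAt {f : E → E'} {s : Set E} (hs : IsOpen s) {a : E}
    (ha : a ∈ s) (hf : ContDiffOn ℝ ∞ f s) (hb : Function.Bijective (fderiv ℝ f a)) :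
    IsLocalDiffeomorphAt 𝓘(ℝ, E) 𝓘(ℝ, E') ∞ f a := by
  let L : E ≃L[ℝ] E' := ContinuousLinearEquiv.ofBijective (fderiv ℝ f a)
    (LinearMap.ker_eq_bot.2 hb.1) (LinearMap.range_eq_top.2 hb.2)
  have hfa : ContDiffAt ℝ ∞ f a := hf.contDiffAt (hs.mem_nhds ha)
  have hL : HasFDerivAt f (L : E →L[ℝ] E') a := (hfa.differentiableAt (by simp)).hasFDerivAt
  let e₀ := hfa.toOpenPartialHomeomorph f hL (by simp)
  have hopen : IsOpen (s ∩ fderiv ℝ f ⁻¹' (range ((↑) : (E ≃L[ℝ] E') → E →L[ℝ] E'))) :=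
    (hf.continuousOn_fderiv_of_isOpen hs (by simp)).isOpen_inter_preimage hs
      ContinuousLinearEquiv.isOpen
  let e := e₀.restr (s ∩ fderiv ℝ f ⁻¹' (range ((↑) : (E ≃L[ℝ] E') → E →L[ℝ] E')))
  have hes : e.source =
      e₀.source ∩ (s ∩ fderiv ℝ f ⁻¹' (range ((↑) : (E ≃L[ℝ] E') → E →L[ℝ] E'))) := by
    simp only [e, OpenPartialHomeomorph.restr_source, hopen.interior_eq]
  refine isLocalDiffeomorphAt_of_contMDiffOn e ?_ (fun _ _ => rfl) ?_ ?_
  · rw [hes]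
    exact ⟨hfa.mem_toOpenPartialHomeomorph_source hL (by simp), ha, L, rfl⟩
  · exact (hf.mono (by rw [hes]; exact fun x hx => hx.2.1)).contMDiffOn
  · refine ContDiffOn.contMDiffOn ?_
    intro y hy
    have hy' : e.symm y ∈ e.source := e.map_target hy
    obtain ⟨-, h2, L', hL'⟩ := hes ▸ hy'
    have h3 : ContDiffAt ℝ ∞ f (e.symm y) := hf.contDiffAt (hs.mem_nhds h2)
    refine (e.contDiffAt_symm (f₀' := L') hy ?_ h3).contDiffWithinAt
    rw [hL']
    exact (h3.differentiableAt (by simp)).hasFDerivAt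

theorem isLocalDiffeomorphAt_extChartAt (x : M) {y : M} (hy : y ∈ (chartAt H x).source) :
    IsLocalDiffeomorphAt I 𝓘(ℝ, E) ∞ (extChartAt I x) y :=
  ⟨⟨extChartAt I x, isOpen_extChartAt_source x, isOpen_extChartAt_target x,
    by rw [extChartAt_source]; exact contMDiffOn_extChartAt, contMDiffOn_extChartAt_symm x⟩,
    by rwa [← extChartAt_source I] at hy, fun _ _ => rfl⟩

theorem isLocalDiffeomorphAt_extChartAt_symm (x : M) {y : E} (hy : y ∈ (extChartAt I x).target) :
    IsLocalDiffeomorphAt 𝓘(ℝ, E) I ∞ (extChartAt I x).symm y :=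
  ⟨⟨(extChartAt I x).symm, isOpen_extChartAt_target x, isOpen_extChartAt_source x,
    contMDiffOn_extChartAt_symm x,
    by
      show ContMDiffOn I 𝓘(ℝ, E) ∞ (extChartAt I x) (extChartAt I x).source
      rw [extChartAt_source]; exact contMDiffOn_extChartAt⟩, hy, fun _ _ => rfl⟩

/-- The inverse function theorem for manifolds without boundary. -/
theorem ContMDiffOn.isLocalDiffeomorphAt {f : M → N} {s : Set M} (hs : IsOpen s) {x : M}
    (hx : x ∈ s) (hf : ContMDiffOn I I' ∞ f s) (hb : Function.Bijective (mfderiv I I' f x)) :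
    IsLocalDiffeomorphAt I I' ∞ f x := by
  let c := extChartAt I x
  let c' := extChartAt I' (f x)
  have hcx : c.symm (c x) = x := extChartAt_to_inv x
  have hcs := isLocalDiffeomorphAt_extChartAt_symm (I := I) x (mem_extChartAt_target x)
  have hc' := isLocalDiffeomorphAt_extChartAt (I := I') (f x) (mem_chart_source H' (f x))
  let t : Set M := s ∩ f ⁻¹' c'.source
  have ht : IsOpen t := hf.continuousOn.isOpen_inter_preimage hs (isOpen_extChartAt_source _)
  let u : Set E := c.target ∩ c.symm ⁻¹' t
  have hu : IsOpen u := (continuousOn_extChartAt_symm x).isOpen_inter_preimage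
    (isOpen_extChartAt_target x) ht
  have hxu : c x ∈ u := ⟨mem_extChartAt_target x, by
    simp only [mem_preimage, hcx]
    exact ⟨hx, mem_extChartAt_source (f x)⟩⟩
  have hF : ContDiffOn ℝ ∞ (c' ∘ f ∘ c.symm) u := by
    rw [← contMDiffOn_iff_contDiffOn]
    have h1 : ContMDiffOn I' 𝓘(ℝ, E') ∞ c' c'.source := by
      simp only [c', extChartAt_source]; exact contMDiffOn_extChartAt
    refine h1.comp (t := c'.source) ?_ (fun z hz => hz.2.2)
    refine hf.comp (t := s) ?_ (fun z hz => hz.2.1)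
    exact (contMDiffOn_extChartAt_symm x).mono inter_subset_left
  have hfx : MDifferentiableAt I I' f x :=
    (hf.contMDiffAt (hs.mem_nhds hx)).mdifferentiableAt (by simp)
  have hder : Function.Bijective (fderiv ℝ (c' ∘ f ∘ c.symm) (c x)) := by
    rw [← mfderiv_eq_fderiv]
    have e1 : mfderiv 𝓘(ℝ, E) I' (f ∘ c.symm) (c x) =
        (mfderiv I I' f (c.symm (c x))).comp (mfderiv 𝓘(ℝ, E) I c.symm (c x)) :=
      mfderiv_comp _ (by rwa [hcx]) (hcs.mdifferentiableAt (by simp))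
    have e2 : mfderiv 𝓘(ℝ, E) 𝓘(ℝ, E') (c' ∘ f ∘ c.symm) (c x) =
        (mfderiv I' 𝓘(ℝ, E') c' (f (c.symm (c x)))).comp
          (mfderiv 𝓘(ℝ, E) I' (f ∘ c.symm) (c x)) := by
      refine mfderiv_comp _ ?_ ?_
      · simp only [Function.comp_apply, hcx]; exact hc'.mdifferentiableAt (by simp)
      · exact MDifferentiableAt.comp _ (by rwa [hcx]) (hcs.mdifferentiableAt (by simp))
    rw [e2, e1]
    have b1 := hcs.mfderiv_bijective
    have b2 : Function.Bijective (mfderiv I I' f (c.symm (c x))) := by rwa [hcx]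
    have b3 : Function.Bijective (mfderiv I' 𝓘(ℝ, E') c' (f (c.symm (c x)))) := by
      rw [hcx]; exact hc'.mfderiv_bijective
    exact b3.comp (b2.comp b1)
  -- The coordinate expression is a local diffeomorphism; the two charts are then cancelled, `c'` on
  -- the left and `c.symm` on the right.
  have h1 : IsLocalDiffeomorphAt 𝓘(ℝ, E) 𝓘(ℝ, E') ∞ (c' ∘ f ∘ c.symm) (c x) :=
    hF.isLocalDiffeomorphAt hu hxu hder
  have h2 : IsLocalDiffeomorphAt 𝓘(ℝ, E) I' ∞ (f ∘ c.symm) (c x) := by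
    refine h1.of_comp_left ?_ ?_
    · simp only [Function.comp_apply, hcx]; exact hc'
    · refine ContinuousAt.comp ?_ ?_
      · rw [hcx]; exact hfx.continuousAt
      · exact hcs.contMDiffAt.continuousAt
  have h3 := h2.of_comp_right hcs
  rwa [hcx] at h3

end InverseFunction

/-! ### Translations and orbit maps of smooth actions. -/

theorem contMDiff_smul_left (k : ℕ) {m : ℕ}
    {G : Type*} [Group G] [TopologicalSpace G] [ChartedSpace (EuclideanSpace ℝ (Fin k)) G]
    {M : Type*} [TopologicalSpace M] [ChartedSpace (EuclideanSpace ℝ (Fin m)) M]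
    [MulAction G M] [ContMDiffSMul (𝓡 k) (𝓡 m) ∞ G M] (g : G) :
    ContMDiff (𝓡 m) (𝓡 m) ∞ fun x : M => g • x :=
  (ContMDiffSMul.contMDiff_smul (I := 𝓡 k) (I' := 𝓡 m) (n := ∞)).comp
    (contMDiff_const.prodMk contMDiff_id)

theorem isLocalDiffeomorph_smul_left (k : ℕ) {m : ℕ}
    {G : Type*} [Group G] [TopologicalSpace G] [ChartedSpace (EuclideanSpace ℝ (Fin k)) G]
    {M : Type*} [TopologicalSpace M] [ChartedSpace (EuclideanSpace ℝ (Fin m)) M]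
    [MulAction G M] [ContMDiffSMul (𝓡 k) (𝓡 m) ∞ G M] (g : G) :
    IsLocalDiffeomorph (𝓡 m) (𝓡 m) ∞ fun x : M => g • x :=
  Diffeomorph.isLocalDiffeomorph (𝕜 := ℝ)
    { toEquiv := MulAction.toPerm g
      contMDiff_toFun := contMDiff_smul_left k g
      contMDiff_invFun := contMDiff_smul_left k g⁻¹ : Diffeomorph (𝓡 m) (𝓡 m) M M ∞ }

section OrbitMap

variable {k m : ℕ}
  {G : Type*} [Group G] [TopologicalSpace G] [ChartedSpace (EuclideanSpace ℝ (Fin k)) G]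
  [LieGroup (𝓡 k) ∞ G]
  {M : Type*} [TopologicalSpace M] [ChartedSpace (EuclideanSpace ℝ (Fin m)) M]
  [IsManifold (𝓡 m) ∞ M] [MulAction G M] [ContMDiffSMul (𝓡 k) (𝓡 m) ∞ G M]

theorem contMDiff_orbitMap (p : M) : ContMDiff (𝓡 k) (𝓡 m) ∞ fun g : G => g • p :=
  (ContMDiffSMul.contMDiff_smul (I := 𝓡 k) (I' := 𝓡 m) (n := ∞)).comp
    (contMDiff_id.prodMk contMDiff_const)

theorem isLocalDiffeomorph_mul_left (g : G) :
    IsLocalDiffeomorph (𝓡 k) (𝓡 k) ∞ fun x : G => g * x :=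
  Diffeomorph.isLocalDiffeomorph (𝕜 := ℝ)
    { toEquiv := Equiv.mulLeft g
      contMDiff_toFun := contMDiff_mul_left
      contMDiff_invFun := contMDiff_mul_left : Diffeomorph (𝓡 k) (𝓡 k) G G ∞ }

/-- Differentiate `(g * x) • p = g • (x • p)` at `x = 1`: the orbit map intertwines the two
translations by `g`, so a vector in the kernel at `1` is left-translated into the kernel at `g`. -/
theorem mfderiv_orbitMap_mulInvariantVectorField (p : M) (g : G) (v : GroupLieAlgebra (𝓡 k) G)
    (hv : mfderiv (𝓡 k) (𝓡 m) (fun g : G => g • p) 1 v = 0) :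
    mfderiv (𝓡 k) (𝓡 m) (fun g : G => g • p) g (mulInvariantVectorField v g) = 0 := by
  have h1 : (fun x : G => x • p) ∘ (fun x => g * x) =
      (fun y : M => g • y) ∘ fun x : G => x • p := by
    ext x
    exact mul_smul g x p
  have hd : MDifferentiable (𝓡 k) (𝓡 m) fun x : G => x • p :=
    (contMDiff_orbitMap p).mdifferentiable (by simp)
  have e1 := mfderiv_comp (I := 𝓡 k) (I' := 𝓡 k) (I'' := 𝓡 m) (1 : G)
    (hd (g * 1)) ((contMDiff_mul_left (I := 𝓡 k) (n := ∞) (a := g)).mdifferentiable (by simp) 1)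
  have e2 := mfderiv_comp (I := 𝓡 k) (I' := 𝓡 m) (I'' := 𝓡 m) (1 : G)
    ((contMDiff_smul_left k g).mdifferentiable (by simp) ((1 : G) • p)) (hd 1)
  rw [h1, e2] at e1
  have e3 := congrArg (fun L => L v) e1
  simp only [ContinuousLinearMap.comp_apply] at e3
  have e4 : mfderiv (𝓡 k) (𝓡 m) (fun x : G => x • p) (g * 1)
      (mfderiv (𝓡 k) (𝓡 k) (fun x => g * x) 1 v) = 0 := by
    refine e3.symm.trans ?_
    have : mfderiv (𝓡 m) (𝓡 m) (fun y : M => g • y) ((1 : G) • p) 0 = 0 := map_zero _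
    exact (congrArg _ hv).trans this
  -- The chain rule yields the derivative at `g * 1`. Generalizing this point allows it to be
  -- replaced by `g` although the tangent spaces depend on it.
  have e5 : ∀ g', g' = g → mfderiv (𝓡 k) (𝓡 m) (fun x : G => x • p) g'
      (mfderiv (𝓡 k) (𝓡 k) (fun x => g * x) 1 v) = 0 →
      mfderiv (𝓡 k) (𝓡 m) (fun g : G => g • p) g (mulInvariantVectorField v g) = 0 := by
    rintro g' rfl h
    exact h
  exact e5 _ (mul_one g) e4

/-- If the stabilizer of `p` is discrete, the orbit map of `p` is an immersion at `1`. -/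
theorem mfderiv_orbitMap_injective [T2Space M] (p : M)
    [DiscreteTopology (MulAction.stabilizer G p)] :
    Function.Injective (mfderiv (𝓡 k) (𝓡 m) (fun g : G => g • p) 1) := by
  have : LieGroup (𝓡 k) (minSmoothness ℝ 3) G :=
    LieGroup.of_le (n := ∞) (by
      rw [minSmoothness_of_isRCLikeNormedField]; exact WithTop.coe_le_coe.2 le_top)
  have : IsManifold (𝓡 k) 1 G := IsManifold.of_le (n := ∞) (by simp)
  have : IsManifold (𝓡 m) 1 M := IsManifold.of_le (n := ∞) (by simp)
  -- Flow along the left-invariant field of a killed vector `v`: the curve `c` then moves `p` with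
  -- velocity zero, so it stays in the stabilizer; discreteness makes it constant, and its initial
  -- velocity `v` vanishes.
  refine (injective_iff_map_eq_zero _).2 fun v hv => ?_
  let w : GroupLieAlgebra (𝓡 k) G := v
  have hX : ContMDiffAt (𝓡 k) (𝓡 k).tangent 1
      (fun g : G => (⟨g, mulInvariantVectorField w g⟩ : TangentBundle (𝓡 k) G)) 1 :=
    (contMDiffAt_mulInvariantVectorField w).of_le (by
      simp [minSmoothness_of_isRCLikeNormedField])
  obtain ⟨c, hc0, hc⟩ := exists_isMIntegralCurveAt_of_contMDiffAt_boundaryless 0 hX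
  have hF : IsMIntegralCurveAt (I := 𝓡 m) (fun t => c t • p) (fun _ => 0) 0 := by
    filter_upwards [hc] with t ht
    have h1 := ((contMDiff_orbitMap (k := k) (m := m) p).mdifferentiable (by simp)
      (c t)).hasMFDerivAt.comp t ht
    refine h1.congr_mfderiv (ContinuousLinearMap.ext fun s => ?_)
    change ℝ at s
    have h2 := mfderiv_orbitMap_mulInvariantVectorField p (c t) w hv
    have h3 : mfderiv (𝓡 k) (𝓡 m) (fun g : G => g • p) (c t)
        ((s : ℝ) • mulInvariantVectorField w (c t)) = (s : ℝ) • 0 :=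
      (map_smul _ _ _).trans (congrArg _ h2)
    exact h3
  have hconst : IsMIntegralCurveAt (I := 𝓡 m) (fun _ : ℝ => p) (fun _ => 0) 0 := by
    refine Eventually.of_forall fun t => ?_
    refine (hasMFDerivAt_const p t).congr_mfderiv (ContinuousLinearMap.ext fun s => ?_)
    change ℝ at s
    exact (smul_zero (A := EuclideanSpace ℝ (Fin m)) s).symm
  -- Both curves are integral curves of the zero field on `M` through `p`, so uniqueness applies.
  have heq : (fun t => c t • p) =ᶠ[𝓝 0] fun _ => p := by
    refine isMIntegralCurveAt_eventuallyEq_of_contMDiffAt_boundaryless (I := 𝓡 m) ?_ hF hconst ?_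
    · exact (Bundle.contMDiff_zeroSection ℝ (TangentSpace (𝓡 m) : M → Type _)).contMDiffAt
    · simp [hc0]
  have hcc : ContinuousAt c 0 := hc.continuousAt
  obtain ⟨U, hU, hU1⟩ : ∃ U ∈ 𝓝 (1 : G), ∀ g ∈ U, g • p = p → g = 1 := by
    have h1 : ({1} : Set (MulAction.stabilizer G p)) ∈ 𝓝 1 := by simp [nhds_discrete]
    rw [nhds_subtype] at h1
    obtain ⟨U, hU, hU'⟩ := h1
    refine ⟨U, hU, fun g hg hgp => ?_⟩
    have : (⟨g, hgp⟩ : MulAction.stabilizer G p) ∈ ({1} : Set _) := hU' hg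
    exact congrArg Subtype.val this
  have hc1 : c =ᶠ[𝓝 0] fun _ => 1 := by
    have h2 : ∀ᶠ t in 𝓝 (0 : ℝ), c t ∈ U := hcc (by rwa [hc0])
    filter_upwards [heq, h2] with t h3 h4
    exact hU1 _ h4 h3
  have hd1 := hc.hasMFDerivAt
  have hd2 : HasMFDerivAt 𝓘(ℝ, ℝ) (𝓡 k) c 0 0 :=
    (hasMFDerivAt_const (1 : G) (0 : ℝ)).congr_of_eventuallyEq hc1
  have h5 : (1 : ℝ) • mulInvariantVectorField w (c 0) = 0 :=
    congrArg (fun L => L 1) (hasMFDerivAt_unique hd1 hd2)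
  have h6 : ∀ g : G, g = 1 → (1 : ℝ) • mulInvariantVectorField w g = 0 → v = 0 := by
    rintro _ rfl h
    have h7 : mfderiv (𝓡 k) (𝓡 k) (fun x : G => 1 * x) 1 v = 0 := (one_smul ℝ _).symm.trans h
    exact (isLocalDiffeomorph_mul_left (1 : G) 1).mfderiv_bijective.1 (h7.trans (map_zero _).symm)
  exact h6 _ hc0 h5

end OrbitMap

/-! ### Transversals to orbits. -/

section Transversals

variable {k m n : ℕ}

/-- The range of `D` has dimension `k`, so a complement has dimension `m - k`; injectivity forces `k
≤ m`, which makes the natural subtraction exact. -/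
theorem exists_complement_of_injective
    (D : EuclideanSpace ℝ (Fin k) →ₗ[ℝ] EuclideanSpace ℝ (Fin m)) (hD : Function.Injective D) :
    ∃ L : EuclideanSpace ℝ (Fin (m - k)) →L[ℝ] EuclideanSpace ℝ (Fin m),
      Function.Bijective fun x : EuclideanSpace ℝ (Fin k) × EuclideanSpace ℝ (Fin (m - k)) =>
        D x.1 + L x.2 := by
  obtain ⟨C, hC⟩ := Submodule.exists_isCompl (LinearMap.range D)
  have h1 := Submodule.finrank_add_eq_of_isCompl hC
  rw [LinearMap.finrank_range_of_inj hD, finrank_euclideanSpace_fin, finrank_euclideanSpace_fin]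
    at h1
  let e : EuclideanSpace ℝ (Fin (m - k)) ≃ₗ[ℝ] C := LinearEquiv.ofFinrankEq _ _ (by
    rw [finrank_euclideanSpace_fin]; omega)
  let f := ((LinearEquiv.ofInjective D hD).prodCongr e).trans
    (Submodule.prodEquivOfIsCompl _ C hC)
  refine ⟨(C.subtype ∘ₗ e.toLinearMap).toContinuousLinearMap, ?_⟩
  convert f.bijective using 1
  ext1 x
  simp [f]

variable
  {G : Type*} [Group G] [TopologicalSpace G] [ChartedSpace (EuclideanSpace ℝ (Fin k)) G]
  [LieGroup (𝓡 k) ∞ G]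
  {M : Type*} [TopologicalSpace M] [ChartedSpace (EuclideanSpace ℝ (Fin m)) M]
  [IsManifold (𝓡 m) ∞ M] [MulAction G M] [ContMDiffSMul (𝓡 k) (𝓡 m) ∞ G M]

/-- If `(g, s) ↦ g • a s` is a local diffeomorphism at `(1, s)`, it is one at every `(g, s)`. -/
theorem isLocalDiffeomorphAt_smul_of_one {E : Type*} [NormedAddCommGroup E] [NormedSpace ℝ E]
    {X : Type*} [TopologicalSpace X] {I : ModelWithCorners ℝ E X}
    {A : Type*} [TopologicalSpace A] [ChartedSpace X A] [IsManifold I ∞ A] {a : A → M} {s : A}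
    (h : IsLocalDiffeomorphAt ((𝓡 k).prod I) (𝓡 m) ∞ (fun x : G × A => x.1 • a x.2) (1, s))
    (g : G) :
    IsLocalDiffeomorphAt ((𝓡 k).prod I) (𝓡 m) ∞ (fun x : G × A => x.1 • a x.2) (g, s) := by
  have h1 : IsLocalDiffeomorphAt ((𝓡 k).prod I) ((𝓡 k).prod I) ∞
      (Prod.map (fun x : G => g⁻¹ * x) (id : A → A)) (g, s) :=
    (isLocalDiffeomorph_mul_left g⁻¹ g).prodMap (isLocalDiffeomorph_id s)
  have h2 := (h1.comp (𝓡 m) M (g := fun x : G × A => x.1 • a x.2) (by simpa using h)).comp (𝓡 m) M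
    (isLocalDiffeomorph_smul_left k g _)
  refine h2.congr_of_eventuallyEq (Eventually.of_forall ?_)
  rintro ⟨x, y⟩
  simp [smul_smul]

/-- A transversal to the orbit through a point with discrete stabilizer. -/
theorem exists_transversal [T2Space M] (p : M) [DiscreteTopology (MulAction.stabilizer G p)] :
    ∃ (σ : EuclideanSpace ℝ (Fin (m - k)) → M) (O : Set (EuclideanSpace ℝ (Fin (m - k)))),
      IsOpen O ∧ 0 ∈ O ∧ σ 0 = p ∧ ContMDiffOn (𝓡 (m - k)) (𝓡 m) ∞ σ O ∧
      ∀ (g : G), ∀ s ∈ O, IsLocalDiffeomorphAt ((𝓡 k).prod (𝓡 (m - k))) (𝓡 m) ∞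
        (fun x : G × EuclideanSpace ℝ (Fin (m - k)) => x.1 • σ x.2) (g, s) := by
  let c := extChartAt (𝓡 m) p
  have hcl := isLocalDiffeomorphAt_extChartAt (I := 𝓡 m) p (mem_chart_source _ p)
  have hd : MDifferentiable (𝓡 k) (𝓡 m) fun x : G => x • p :=
    (contMDiff_orbitMap p).mdifferentiable (by simp)
  let D : EuclideanSpace ℝ (Fin k) →ₗ[ℝ] EuclideanSpace ℝ (Fin m) :=
    (mfderiv (𝓡 k) 𝓘(ℝ, EuclideanSpace ℝ (Fin m)) (c ∘ fun g : G => g • p) 1).toLinearMap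
  have hDinj : Function.Injective D := by
    have e1 : mfderiv (𝓡 k) 𝓘(ℝ, EuclideanSpace ℝ (Fin m)) (c ∘ fun g : G => g • p) 1 =
        (mfderiv (𝓡 m) 𝓘(ℝ, EuclideanSpace ℝ (Fin m)) c ((1 : G) • p)).comp
          (mfderiv (𝓡 k) (𝓡 m) (fun g : G => g • p) 1) :=
      mfderiv_comp _ (by rw [one_smul]; exact hcl.mdifferentiableAt (by simp)) (hd 1)
    have b1 : Function.Injective
        (mfderiv (𝓡 m) 𝓘(ℝ, EuclideanSpace ℝ (Fin m)) c ((1 : G) • p)) := by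
      rw [one_smul]; exact hcl.mfderiv_bijective.1
    have b2 := b1.comp (mfderiv_orbitMap_injective (k := k) (G := G) (m := m) p)
    have : (D : EuclideanSpace ℝ (Fin k) → EuclideanSpace ℝ (Fin m)) =
        (mfderiv (𝓡 m) 𝓘(ℝ, EuclideanSpace ℝ (Fin m)) c ((1 : G) • p)) ∘
          (mfderiv (𝓡 k) (𝓡 m) (fun g : G => g • p) 1) := congrArg DFunLike.coe e1
    rw [this]
    exact b2
  obtain ⟨L, hL⟩ := exists_complement_of_injective D hDinj
  -- In a chart at `p` the transversal is the affine subspace through `c p` in a direction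
  -- complementary to the tangent space of the orbit.
  let τ : EuclideanSpace ℝ (Fin (m - k)) → EuclideanSpace ℝ (Fin m) := fun s => c p + L s
  have hτ : ContDiff ℝ ∞ τ := contDiff_const.add L.contDiff
  have hτ0 : τ 0 = c p := by simp [τ]
  let σ : EuclideanSpace ℝ (Fin (m - k)) → M := c.symm ∘ τ
  let O₁ := τ ⁻¹' c.target
  have hO₁ : IsOpen O₁ := (isOpen_extChartAt_target p).preimage hτ.continuous
  have h0 : (0 : EuclideanSpace ℝ (Fin (m - k))) ∈ O₁ := by
    simp only [O₁, mem_preimage, hτ0]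
    exact mem_extChartAt_target p
  have hσ0 : σ 0 = p := by
    simp only [σ, Function.comp_apply, hτ0]
    exact extChartAt_to_inv p
  have hσ : ContMDiffOn (𝓡 (m - k)) (𝓡 m) ∞ σ O₁ :=
    (contMDiffOn_extChartAt_symm p).comp hτ.contMDiff.contMDiffOn (fun _ h => h)
  let Φ : G × EuclideanSpace ℝ (Fin (m - k)) → M := fun x => x.1 • σ x.2
  have hΦ : ContMDiffOn ((𝓡 k).prod (𝓡 (m - k))) (𝓡 m) ∞ Φ (univ ×ˢ O₁) :=
    (ContMDiffSMul.contMDiff_smul (I := 𝓡 k) (I' := 𝓡 m) (n := ∞)).comp_contMDiffOn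
      (contMDiffOn_fst.prodMk (hσ.comp contMDiffOn_snd fun x hx => hx.2))
  have hΦ1 : Φ (1, 0) = p := by simp [Φ, hσ0]
  have hW : IsOpen (univ ×ˢ O₁ ∩ Φ ⁻¹' c.source) :=
    hΦ.continuousOn.isOpen_inter_preimage (isOpen_univ.prod hO₁) (isOpen_extChartAt_source p)
  have hΦl : IsLocalDiffeomorphAt ((𝓡 k).prod (𝓡 (m - k))) (𝓡 m) ∞ Φ (1, 0) := by
    have hcΦ : ContMDiffOn ((𝓡 k).prod (𝓡 (m - k))) 𝓘(ℝ, EuclideanSpace ℝ (Fin m)) ∞ (c ∘ Φ)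
        (univ ×ˢ O₁ ∩ Φ ⁻¹' c.source) := by
      have h1 : ContMDiffOn (𝓡 m) 𝓘(ℝ, EuclideanSpace ℝ (Fin m)) ∞ c c.source := by
        simp only [c, extChartAt_source]; exact contMDiffOn_extChartAt
      exact h1.comp (hΦ.mono inter_subset_left) fun x hx => hx.2
    have hmem : ((1 : G), (0 : EuclideanSpace ℝ (Fin (m - k)))) ∈ univ ×ˢ O₁ ∩ Φ ⁻¹' c.source :=
      ⟨⟨mem_univ _, h0⟩, by
        rw [mem_preimage, hΦ1]; exact mem_extChartAt_source p⟩
    have hloc := hcΦ.isLocalDiffeomorphAt hW hmem ?_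
    · refine hloc.of_comp_left ?_ ((hΦ _ hmem.1).contMDiffAt
        ((isOpen_univ.prod hO₁).mem_nhds hmem.1)).continuousAt
      rw [hΦ1]; exact hcl
    · have hmd : MDifferentiableAt ((𝓡 k).prod (𝓡 (m - k))) 𝓘(ℝ, EuclideanSpace ℝ (Fin m))
          (c ∘ Φ) (1, 0) :=
        (hcΦ.contMDiffAt (hW.mem_nhds hmem)).mdifferentiableAt (by simp)
      have e1 : (fun z : G => (c ∘ Φ) (z, 0)) = c ∘ fun g : G => g • p := by
        ext1 z; simp [Φ, hσ0]
      have e2 : mfderiv (𝓡 (m - k)) 𝓘(ℝ, EuclideanSpace ℝ (Fin m))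
          (fun z => (c ∘ Φ) (1, z)) 0 = L := by
        rw [mfderiv_eq_fderiv]
        have e3 : (fun z => (c ∘ Φ) (1, z)) =ᶠ[𝓝 0] τ := by
          filter_upwards [hO₁.mem_nhds h0] with z hz
          simp only [Φ, Function.comp_apply, one_smul, σ]
          exact c.right_inv hz
        rw [e3.fderiv_eq]
        exact (L.hasFDerivAt.const_add (c p)).fderiv
      -- The two partial derivatives are the derivative of the orbit map and the inclusion `L` of
      -- the complement, so together they are bijective.
      have e4 : (mfderiv ((𝓡 k).prod (𝓡 (m - k))) 𝓘(ℝ, EuclideanSpace ℝ (Fin m)) (c ∘ Φ) (1, 0) :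
          EuclideanSpace ℝ (Fin k) × EuclideanSpace ℝ (Fin (m - k)) → EuclideanSpace ℝ (Fin m)) =
          fun x => D x.1 + L x.2 := by
        ext1 x
        have e5 := mfderiv_prod_eq_add_apply (v := x) hmd
        rw [e1] at e5
        rw [e2] at e5
        exact e5
      exact (congrArg Function.Bijective e4).mpr hL
  -- Being étale is an open condition, which settles the points `(1, s)` with `s` small; translation
  -- in `G` then covers every `(g, s)`.
  have hev : ∀ᶠ s in 𝓝 (0 : EuclideanSpace ℝ (Fin (m - k))),
      IsLocalDiffeomorphAt ((𝓡 k).prod (𝓡 (m - k))) (𝓡 m) ∞ Φ (1, s) :=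
    (Continuous.prodMk_right (1 : G)).continuousAt.eventually hΦl.eventually
  obtain ⟨O₂, hO₂, hO₂o, h02⟩ := eventually_nhds_iff.1 hev
  refine ⟨σ, O₁ ∩ O₂, hO₁.inter hO₂o, ⟨h0, h02⟩, hσ0, hσ.mono inter_subset_left, ?_⟩
  intro g s hs
  exact isLocalDiffeomorphAt_smul_of_one (hO₂ s hs.2) g

end Transversals

/-! ### Transversals upstairs adapted to transversals downstairs. -/

section AdaptedTransversals

variable {k m n : ℕ}
  {G : Type*} [Group G] [TopologicalSpace G] [ChartedSpace (EuclideanSpace ℝ (Fin k)) G]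
  [LieGroup (𝓡 k) ∞ G]
  {M : Type*} [TopologicalSpace M] [ChartedSpace (EuclideanSpace ℝ (Fin m)) M]
  [IsManifold (𝓡 m) ∞ M] [MulAction G M] [ContMDiffSMul (𝓡 k) (𝓡 m) ∞ G M]
  {N : Type*} [TopologicalSpace N] [ChartedSpace (EuclideanSpace ℝ (Fin n)) N]
  [IsManifold (𝓡 n) ∞ N] [MulAction G N] [ContMDiffSMul (𝓡 k) (𝓡 n) ∞ G N]

/-- A transversal at `q` which an equivariant map sends into a given transversal at the image. -/
theorem exists_adapted_transversal [T2Space N] {ι : N → M}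
    (hι : ContMDiff (𝓡 n) (𝓡 m) ∞ ι) (hequiv : ∀ (g : G) (x : N), ι (g • x) = g • ι x)
    (q : N) [DiscreteTopology (MulAction.stabilizer G q)]
    {σ : EuclideanSpace ℝ (Fin (m - k)) → M} {O : Set (EuclideanSpace ℝ (Fin (m - k)))}
    (hO : IsOpen O) (h0 : 0 ∈ O) (hσ0 : σ 0 = ι q)
    (hΦ : IsLocalDiffeomorphAt ((𝓡 k).prod (𝓡 (m - k))) (𝓡 m) ∞
        (fun x : G × EuclideanSpace ℝ (Fin (m - k)) => x.1 • σ x.2) (1, 0)) :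
    ∃ (b : EuclideanSpace ℝ (Fin (n - k)) → N)
      (φ : EuclideanSpace ℝ (Fin (n - k)) → EuclideanSpace ℝ (Fin (m - k)))
      (V : Set (EuclideanSpace ℝ (Fin (n - k)))),
      IsOpen V ∧ 0 ∈ V ∧ b 0 = q ∧ φ 0 = 0 ∧ ContMDiffOn (𝓡 (n - k)) (𝓡 n) ∞ b V ∧
      ContMDiffOn (𝓡 (n - k)) (𝓡 (m - k)) ∞ φ V ∧ MapsTo φ V O ∧
      (∀ v ∈ V, σ (φ v) = ι (b v)) ∧
      ∀ (g : G), ∀ v ∈ V, IsLocalDiffeomorphAt ((𝓡 k).prod (𝓡 (n - k))) (𝓡 n) ∞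
        (fun x : G × EuclideanSpace ℝ (Fin (n - k)) => x.1 • b x.2) (g, v) := by
  obtain ⟨b₀, O₀, hO₀, h0₀, hb₀, hb₀s, hb₀l⟩ := exists_transversal (k := k) (G := G) (m := n) q
  let Φ : G × EuclideanSpace ℝ (Fin (m - k)) → M := fun x => x.1 • σ x.2
  let Λ := hΦ.localInverse
  have hΦ1 : Φ (1, 0) = ι q := by simp [Φ, hσ0]
  have hΛq : Λ (ι q) = (1, 0) := by
    rw [← hΦ1]
    exact hΦ.localInverse_left_inv hΦ.localInverse_mem_target
  have hΛs : ContMDiffOn (𝓡 m) ((𝓡 k).prod (𝓡 (m - k))) ∞ Λ Λ.source := hΦ.localInverse_contMDiffOn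
  have hqs : ι q ∈ Λ.source := by rw [← hΦ1]; exact hΦ.localInverse_mem_source
  let W : Set M := Λ.source ∩ Λ ⁻¹' (univ ×ˢ O)
  have hW : IsOpen W := hΛs.continuousOn.isOpen_inter_preimage Λ.open_source (isOpen_univ.prod hO)
  have hιb : ContMDiffOn (𝓡 (n - k)) (𝓡 m) ∞ (ι ∘ b₀) O₀ := hι.comp_contMDiffOn hb₀s
  let V := O₀ ∩ (ι ∘ b₀) ⁻¹' W
  have hV : IsOpen V := hιb.continuousOn.isOpen_inter_preimage hO₀ hW
  have h0V : (0 : EuclideanSpace ℝ (Fin (n - k))) ∈ V := by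
    refine ⟨h0₀, ?_⟩
    simp only [mem_preimage, Function.comp_apply, hb₀, W]
    refine ⟨hqs, ?_⟩
    rw [mem_preimage, hΛq]
    exact ⟨mem_univ _, h0⟩
  have hΛV : ContMDiffOn (𝓡 (n - k)) ((𝓡 k).prod (𝓡 (m - k))) ∞ (Λ ∘ ι ∘ b₀) V :=
    hΛs.comp (hιb.mono inter_subset_left) fun v hv => hv.2.1
  let γ : EuclideanSpace ℝ (Fin (n - k)) → G := fun v => (Λ (ι (b₀ v))).1
  let φ : EuclideanSpace ℝ (Fin (n - k)) → EuclideanSpace ℝ (Fin (m - k)) :=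
    fun v => (Λ (ι (b₀ v))).2
  have hγ : ContMDiffOn (𝓡 (n - k)) (𝓡 k) ∞ γ V := contMDiff_fst.comp_contMDiffOn hΛV
  have hφ : ContMDiffOn (𝓡 (n - k)) (𝓡 (m - k)) ∞ φ V := contMDiff_snd.comp_contMDiffOn hΛV
  -- The étale map downstairs gives `ι (b₀ v)` coordinates: a group element `γ v` and a position `φ
  -- v` on the transversal.
  have hγφ : ∀ v ∈ V, γ v • σ (φ v) = ι (b₀ v) := fun v hv =>
    hΦ.localInverse_right_inv hv.2.1
  have hγinv : ContMDiffOn (𝓡 (n - k)) (𝓡 k) ∞ (fun v => (γ v)⁻¹) V :=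
    (contMDiff_inv (𝓡 k) ∞).comp_contMDiffOn hγ
  -- Undoing the group coordinate, which equivariance allows already in `N`, puts the image exactly
  -- on the transversal of `M`.
  let b : EuclideanSpace ℝ (Fin (n - k)) → N := fun v => (γ v)⁻¹ • b₀ v
  have hb : ContMDiffOn (𝓡 (n - k)) (𝓡 n) ∞ b V :=
    (ContMDiffSMul.contMDiff_smul (I := 𝓡 k) (I' := 𝓡 n) (n := ∞)).comp_contMDiffOn
      (hγinv.prodMk (hb₀s.mono inter_subset_left))
  refine ⟨b, φ, V, hV, h0V, ?_, ?_, hb, hφ, fun v hv => hv.2.2.2, ?_, ?_⟩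
  · simp only [b, γ, hb₀, hΛq, inv_one, one_smul]
  · simp only [φ, hb₀, hΛq]
  · intro v hv
    simp only [b]
    rw [hequiv, ← hγφ v hv, inv_smul_smul]
  · intro g v hv
    -- This shear is a diffeomorphism that turns `(g, v) ↦ g • b₀ v` into `(g, v) ↦ g • b v`, so the
    -- correction preserves étaleness.
    let e : OpenPartialHomeomorph (G × EuclideanSpace ℝ (Fin (n - k)))
        (G × EuclideanSpace ℝ (Fin (n - k))) :=
      { toFun := fun x => (x.1 * (γ x.2)⁻¹, x.2)
        invFun := fun x => (x.1 * γ x.2, x.2)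
        source := univ ×ˢ V
        target := univ ×ˢ V
        map_source' := fun x hx => ⟨mem_univ _, hx.2⟩
        map_target' := fun x hx => ⟨mem_univ _, hx.2⟩
        left_inv' := fun x _ => by simp
        right_inv' := fun x _ => by simp
        open_source := isOpen_univ.prod hV
        open_target := isOpen_univ.prod hV
        continuousOn_toFun := by
          have : ContMDiffOn ((𝓡 k).prod (𝓡 (n - k))) ((𝓡 k).prod (𝓡 (n - k))) ∞
              (fun x : G × EuclideanSpace ℝ (Fin (n - k)) => (x.1 * (γ x.2)⁻¹, x.2))
              (univ ×ˢ V) :=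
            (contMDiffOn_fst.mul (hγinv.comp contMDiffOn_snd fun x hx => hx.2)).prodMk
              contMDiffOn_snd
          exact this.continuousOn
        continuousOn_invFun := by
          have : ContMDiffOn ((𝓡 k).prod (𝓡 (n - k))) ((𝓡 k).prod (𝓡 (n - k))) ∞
              (fun x : G × EuclideanSpace ℝ (Fin (n - k)) => (x.1 * γ x.2, x.2))
              (univ ×ˢ V) :=
            (contMDiffOn_fst.mul (hγ.comp contMDiffOn_snd fun x hx => hx.2)).prodMk
              contMDiffOn_snd
          exact this.continuousOn }
    have he : IsLocalDiffeomorphAt ((𝓡 k).prod (𝓡 (n - k))) ((𝓡 k).prod (𝓡 (n - k))) ∞ e (g, v) :=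
      isLocalDiffeomorphAt_of_contMDiffOn e ⟨mem_univ _, hv⟩ (fun _ _ => rfl)
        ((contMDiffOn_fst.mul (hγinv.comp contMDiffOn_snd fun x hx => hx.2)).prodMk
              contMDiffOn_snd)
        ((contMDiffOn_fst.mul (hγ.comp contMDiffOn_snd fun x hx => hx.2)).prodMk
              contMDiffOn_snd)
    have h2 := he.comp (𝓡 n) N (g := fun x : G × EuclideanSpace ℝ (Fin (n - k)) => x.1 • b₀ x.2)
      (hb₀l _ _ hv.1)
    refine h2.congr_of_eventuallyEq (Eventually.of_forall fun x => ?_)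
    simp only [b, smul_smul]
    rfl

end AdaptedTransversals

/-! ### Finiteness of stabilizers and of the fibers of a strong map. -/

section FiniteFibers

variable {k m : ℕ}
  {G : Type*} [Group G] [TopologicalSpace G] [CompactSpace G]
  {M : Type*} [TopologicalSpace M] [T2Space M] [MulAction G M] [ContinuousSMul G M]

theorem finite_stabilizer (p : M) [DiscreteTopology (MulAction.stabilizer G p)] :
    Finite (MulAction.stabilizer G p) := by
  have hc : IsClosed (MulAction.stabilizer G p : Set G) :=
    isClosed_singleton.preimage
      (continuous_id.smul continuous_const : Continuous fun g : G => g • p)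
  have : CompactSpace (MulAction.stabilizer G p) := isCompact_iff_compactSpace.1 hc.isCompact
  exact finite_of_compact_of_discrete

/-- A nonempty fiber is contained in one orbit of the stabilizer of `p`, which is closed in a
compact group and discrete, hence finite. -/
theorem finite_fiber_of_strong {N : Type*} [MulAction G N] {ι : N → M} {p : M}
    (hs : ∀ q q' : N, ι q = p → ι q' = p → ∃ g ∈ MulAction.stabilizer G p, g • q = q')
    [DiscreteTopology (MulAction.stabilizer G p)] : (ι ⁻¹' {p}).Finite := by
  rcases (ι ⁻¹' {p}).eq_empty_or_nonempty with h | ⟨q, hq⟩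
  · rw [h]; exact finite_empty
  · have := finite_stabilizer (G := G) p
    refine (finite_range fun g : MulAction.stabilizer G p => (g : G) • q).subset ?_
    intro q' hq'
    obtain ⟨g, hg, rfl⟩ := hs q q' hq hq'
    exact ⟨⟨g, hg⟩, rfl⟩

end FiniteFibers

/-! ### Simultaneous shrinking of the transversals over a fiber. -/

section TransversalFamily

variable {k m n : ℕ}
  {G : Type*} [Group G] [TopologicalSpace G] [CompactSpace G]
  {M : Type*} [TopologicalSpace M] [T2Space M] [MulAction G M] [ContinuousSMul G M]
  {N : Type*} [TopologicalSpace N] [T2Space N] [MulAction G N] [ContinuousSMul G N]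
  {E : Type*} [NormedAddCommGroup E] [NormedSpace ℝ E]
  {E' : Type*} [NormedAddCommGroup E'] [NormedSpace ℝ E'] [ProperSpace E']

/-- Given transversals at `p` and at the finitely many points over `p`, one finds smaller ones on
which the map between them is proper, every arrow between points of the image lifts, and
the transversals upstairs are disjoint. -/
theorem exists_shrinking {ι : N → M}
    (hequiv : ∀ (g : G) (x : N), ι (g • x) = g • ι x) {p : M} (hfin : (ι ⁻¹' {p}).Finite)
    {σ : E → M} {O : Set E} (hO : IsOpen O) (h0 : 0 ∈ O) (hσ0 : σ 0 = p) (hσ : ContinuousOn σ O)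
    (hσinj : ∃ A ∈ 𝓝 ((1 : G), (0 : E)), InjOn (fun x : G × E => x.1 • σ x.2) A)
    {b : N → E' → N} {φ : N → E' → E} {V : N → Set E'}
    (hV : ∀ c, IsOpen (V c)) (h0V : ∀ c, 0 ∈ V c) (hb0 : ∀ c, b c 0 = c)
    (hφ0 : ∀ c, φ c 0 = 0) (hb : ∀ c, ContinuousOn (b c) (V c))
    (hφ : ∀ c, ContinuousOn (φ c) (V c)) (hφO : ∀ c, ι c = p → MapsTo (φ c) (V c) O)
    (hσφ : ∀ c, ι c = p → ∀ v ∈ V c, σ (φ c v) = ι (b c v))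
    (hbinj : ∀ c, ∃ A ∈ 𝓝 ((1 : G), (0 : E')), InjOn (fun x : G × E' => x.1 • b c x.2) A)
    (hbnhds : ∀ c, map (fun x : G × E' => x.1 • b c x.2) (𝓝 (1, 0)) = 𝓝 c) :
    ∃ (r : ℝ) (U : Set E), 0 < r ∧ IsOpen U ∧ 0 ∈ U ∧ U ⊆ O ∧
      (∀ c, ι c = p → Metric.closedBall 0 r ⊆ V c) ∧
      (∀ c, ι c = p → ∀ v ∈ Metric.closedBall (0 : E') r, φ c v ∈ U → v ∈ Metric.ball (0 : E') r) ∧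
      (∀ c, ι c = p → ∀ v ∈ Metric.closedBall (0 : E') r, ∀ u ∈ U, ∀ g : G,
        g • σ (φ c v) = σ u → ∃ c', ι c' = p ∧ ∃ v' ∈ Metric.closedBall (0 : E') r,
          b c' v' = g • b c v ∧ φ c' v' = u) ∧
      (∀ c c', ι c = p → ι c' = p → ∀ v ∈ Metric.closedBall (0 : E') r,
        ∀ v' ∈ Metric.closedBall (0 : E') r, b c v = b c' v' → c = c' ∧ v = v') := by
  -- Disjoint neighborhoods of the points of the fiber; the disk centered at `c` will be kept inside
  -- `D c`.
  obtain ⟨D, hD, hDdisj⟩ := hfin.t2_separation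
  have hgood : ∀ c, ∀ᶠ v in 𝓝 (0 : E'), v ∈ V c ∧ b c v ∈ D c := by
    intro c
    refine ((hV c).eventually_mem (h0V c)).and ?_
    have : ContinuousAt (b c) 0 := (hb c).continuousAt ((hV c).mem_nhds (h0V c))
    refine this.eventually_mem ?_
    rw [hb0]
    exact (hD c).2.mem_nhds (hD c).1
  have hinj : ∀ c, ∃ B ∈ 𝓝 (0 : E'), InjOn (b c) B := by
    intro c
    obtain ⟨A, hA, hAinj⟩ := hbinj c
    refine ⟨(fun v => ((1 : G), v)) ⁻¹' A, (Continuous.prodMk_right (1 : G)).continuousAt hA, ?_⟩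
    intro v hv v' hv' h
    have := hAinj hv hv' (by simpa using h)
    exact (Prod.ext_iff.1 this).2
  choose B hB hBinj using hinj
  have hall : ∀ᶠ v in 𝓝 (0 : E'), ∀ c ∈ ι ⁻¹' {p}, (v ∈ V c ∧ b c v ∈ D c) ∧ v ∈ B c :=
    hfin.eventually_all.2 fun c _ => (hgood c).and (hB c)
  -- Finiteness of the fiber permits a single radius for all its points.
  obtain ⟨r, hr, hrsub⟩ := Metric.nhds_basis_closedBall.eventually_iff.1 hall
  have hmem : ∀ c, ι c = p → ∀ v ∈ Metric.closedBall (0 : E') r,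
      (v ∈ V c ∧ b c v ∈ D c) ∧ v ∈ B c := fun c hc v hv => hrsub hv c hc
  have hsep : ∀ c c', ι c = p → ι c' = p → ∀ v ∈ Metric.closedBall (0 : E') r,
      b c v ∈ D c' → c = c' := by
    intro c c' hc hc' v hv h
    by_contra hne
    exact (disjoint_left.1 (hDdisj hc hc' hne)) (hmem c hc v hv).1.2 h
  have hrmem0 : (0 : E') ∈ Metric.closedBall (0 : E') r := Metric.mem_closedBall_self hr.le
  -- points over `p`
  have hfib : ∀ c, ι c = p → ∀ v ∈ Metric.closedBall (0 : E') r, φ c v = 0 → v = 0 := by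
    intro c hc v hv h
    have h1 : ι (b c v) = p := by rw [← hσφ c hc v (hmem c hc v hv).1.1, h, hσ0]
    -- The point `b c v` belongs to the fiber, so it lies in its own neighborhood as well as in that
    -- of `c`; disjointness identifies the two.
    have h2 : c = b c v := hsep c _ hc h1 v hv (hD _).1
    exact hBinj c (hmem c hc v hv).2 (hmem c hc 0 hrmem0).2 (by rw [hb0]; exact h2.symm)
  -- The image of the boundary sphere is compact and misses `0`. Over a small `U` nothing escapes
  -- through the boundary of the ball, which later gives properness.
  have hsphere : ∀ᶠ u in 𝓝 (0 : E), ∀ c ∈ ι ⁻¹' {p}, u ∉ φ c '' Metric.sphere (0 : E') r := by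
    refine hfin.eventually_all.2 fun c hc => ?_
    have hK : IsCompact (φ c '' Metric.sphere (0 : E') r) :=
      (isCompact_sphere _ _).image_of_continuousOn ((hφ c).mono fun v hv =>
        (hmem c hc v (Metric.sphere_subset_closedBall hv)).1.1)
    refine hK.isClosed.isOpen_compl.eventually_mem ?_
    rintro ⟨v, hv, h⟩
    have := hfib c hc v (Metric.sphere_subset_closedBall hv) h
    rw [this, mem_sphere_zero_iff_norm, norm_zero] at hv
    exact hr.ne hv
  have hlift : ∀ᶠ u in 𝓝 (0 : E), ∀ c ∈ ι ⁻¹' {p},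
      ∀ x ∈ (univ : Set G) ×ˢ Metric.closedBall (0 : E') r,
        x.1 • σ (φ c x.2) = σ u → ∃ c', ι c' = p ∧ ∃ v' ∈ Metric.closedBall (0 : E') r,
          b c' v' = x.1 • b c x.2 ∧ φ c' v' = u := by
    refine hfin.eventually_all.2 fun c hc => ?_
    -- Compactness of `G` times the closed ball reduces the claim to a neighborhood of one pair `(g,
    -- v)`, with `u` near `0`.
    refine (isCompact_univ.prod
      (isCompact_closedBall (0 : E') r)).eventually_forall_of_forall_eventually ?_
    rintro ⟨g, v⟩ ⟨-, hv⟩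
    have hvV : v ∈ V c := (hmem c hc v hv).1.1
    have hφv : ContinuousAt (φ c) v := (hφ c).continuousAt ((hV c).mem_nhds hvV)
    have hbv : ContinuousAt (b c) v := (hb c).continuousAt ((hV c).mem_nhds hvV)
    have hσv : ContinuousAt σ (φ c v) := hσ.continuousAt (hO.mem_nhds (hφO c hc hvV))
    have hσ0' : ContinuousAt σ 0 := hσ.continuousAt (hO.mem_nhds h0)
    have hfst : Tendsto (fun z : E × (G × E') => z.2.1) (𝓝 (0, (g, v))) (𝓝 g) :=
      (continuous_fst.comp continuous_snd).continuousAt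
    have hsnd : Tendsto (fun z : E × (G × E') => z.2.2) (𝓝 (0, (g, v))) (𝓝 v) :=
      (continuous_snd.comp continuous_snd).continuousAt
    have hu : Tendsto (fun z : E × (G × E') => z.1) (𝓝 (0, (g, v))) (𝓝 0) :=
      continuous_fst.continuousAt
    -- If the limiting arrow ends at `p`, then `g • b c v` is a point `c'` of the fiber, near which
    -- the translates of the disk of `c'` cover `N`. Otherwise the two sides of the equation have
    -- distinct limits, and the Hausdorff property excludes nearby solutions.
    by_cases hp : g • σ (φ c v) = p
    · have hpb : ι (g • b c v) = p := by rw [hequiv, ← hσφ c hc v hvV, hp]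
      set c' := g • b c v with hc'
      obtain ⟨A, hA, hAinj⟩ := hσinj
      have hφ0' : ContinuousAt (φ c') 0 := (hφ c').continuousAt ((hV c').mem_nhds (h0V c'))
      have hnear : ∀ᶠ y in 𝓝 ((1 : G), (0 : E')),
          y.2 ∈ Metric.closedBall (0 : E') r ∧ (y.1, φ c' y.2) ∈ A := by
        refine (continuous_snd.continuousAt.eventually_mem
          (Metric.closedBall_mem_nhds (0 : E') hr)).and ?_
        have : Tendsto (fun y : G × E' => (y.1, φ c' y.2)) (𝓝 (1, 0)) (𝓝 (1, 0)) := by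
          refine Tendsto.prodMk_nhds continuous_fst.continuousAt ?_
          have h1 : Tendsto (φ c') (𝓝 0) (𝓝 0) := by
            have := hφ0'.tendsto
            rwa [hφ0] at this
          exact h1.comp continuous_snd.continuousAt
        exact this.eventually_mem hA
      have himg : (fun x : G × E' => x.1 • b c' x.2) '' {y | y.2 ∈ Metric.closedBall (0 : E') r ∧
          (y.1, φ c' y.2) ∈ A} ∈ 𝓝 c' := by
        rw [← hbnhds c']
        exact image_mem_map hnear
      have e1 : ∀ᶠ z : E × (G × E') in 𝓝 (0, (g, v)), z.2.1 • b c z.2.2 ∈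
          (fun x : G × E' => x.1 • b c' x.2) '' {y | y.2 ∈ Metric.closedBall (0 : E') r ∧
          (y.1, φ c' y.2) ∈ A} :=
        (hfst.smul (hbv.tendsto.comp hsnd)).eventually_mem himg
      have e2 : ∀ᶠ z : E × (G × E') in 𝓝 (0, (g, v)), ((1 : G), z.1) ∈ A :=
        (tendsto_const_nhds.prodMk_nhds hu).eventually_mem hA
      have e3 : ∀ᶠ z : E × (G × E') in 𝓝 (0, (g, v)), z.2.2 ∈ V c :=
        hsnd.eventually_mem ((hV c).mem_nhds hvV)
      filter_upwards [e1, e2, e3]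
      rintro ⟨u, ⟨g₁, v₁⟩⟩ ⟨⟨g', v'⟩, ⟨hv', hA'⟩, h1⟩ h2 h3 h4
      simp only at hv' hA' h1 h2 h3 h4
      have hv'V : v' ∈ V c' := (hmem c' hpb v' hv').1.1
      have h5 : g' • σ (φ c' v') = (1 : G) • σ u := by
        rw [one_smul, ← h4, hσφ c' hpb v' hv'V, hσφ c hc v₁ h3, ← hequiv, ← hequiv, h1]
      -- Both parameters are close to `(1, 0)`, where the étale map downstairs is injective. So the
      -- group correction is trivial and the lifted arrow ends exactly on the disk, over `u`.
      have h6 := hAinj hA' h2 h5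
      rw [Prod.mk.injEq] at h6
      refine ⟨c', hpb, v', hv', ?_, h6.2⟩
      rw [← h1, h6.1, one_smul]
    · have h1 : Tendsto (fun z : E × (G × E') => z.2.1 • σ (φ c z.2.2)) (𝓝 (0, (g, v)))
          (𝓝 (g • σ (φ c v))) := hfst.smul ((hσv.tendsto.comp hφv.tendsto).comp hsnd)
      have h2 : Tendsto (fun z : E × (G × E') => σ z.1) (𝓝 (0, (g, v))) (𝓝 p) := by
        have := hσ0'.tendsto.comp hu
        rwa [hσ0] at this
      filter_upwards [(h1.prodMk_nhds h2).eventually_mem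
        (isClosed_diagonal.isOpen_compl.mem_nhds
          (hp : (g • σ (φ c v), p) ∉ diagonal M))] with z hz h
      exact absurd h hz
  obtain ⟨U, hU, hUo, h0U⟩ := eventually_nhds_iff.1
    ((hO.eventually_mem h0).and (hsphere.and hlift))
  refine ⟨r, U, hr, hUo, h0U, fun u hu => (hU u hu).1, fun c hc v hv => (hmem c hc v hv).1.1,
    ?_, ?_, ?_⟩
  · intro c hc v hv hvU
    rw [mem_ball_zero_iff]
    refine lt_of_le_of_ne (mem_closedBall_zero_iff.1 hv) fun h => ?_
    exact (hU _ hvU).2.1 c hc ⟨v, mem_sphere_zero_iff_norm.2 h, rfl⟩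
  · intro c hc v hv u hu g h
    exact (hU u hu).2.2 c hc (g, v) ⟨mem_univ _, hv⟩ h
  · intro c c' hc hc' v hv v' hv' h
    have hcc : c = c' := hsep c c' hc hc' v hv (h ▸ (hmem c' hc' v' hv').1.2)
    subst hcc
    exact ⟨rfl, hBinj c (hmem c hc v hv).2 (hmem c hc v' hv').2 h⟩

end TransversalFamily

/-! ### Compatible families of transversals. -/

section TransversalFamily

/-- Transversals to the orbits through all points of `M` and `N`, together with local
representatives `φ` of an equivariant map `ι : N → M`. -/
structure TransversalFamily (k m n : ℕ)
    (G : Type*) [Group G] [TopologicalSpace G] [ChartedSpace (EuclideanSpace ℝ (Fin k)) G]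
    {M : Type*} [TopologicalSpace M] [ChartedSpace (EuclideanSpace ℝ (Fin m)) M] [MulAction G M]
    {N : Type*} [TopologicalSpace N] [ChartedSpace (EuclideanSpace ℝ (Fin n)) N] [MulAction G N]
    (ι : N → M) where
  σ : M → EuclideanSpace ℝ (Fin (m - k)) → M
  U : M → TopologicalSpace.Opens (EuclideanSpace ℝ (Fin (m - k)))
  b : N → EuclideanSpace ℝ (Fin (n - k)) → N
  φ : N → EuclideanSpace ℝ (Fin (n - k)) → EuclideanSpace ℝ (Fin (m - k))
  V : N → TopologicalSpace.Opens (EuclideanSpace ℝ (Fin (n - k)))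
  zero_mem_U : ∀ p, 0 ∈ U p
  σ_zero : ∀ p, σ p 0 = p
  etale_σ : ∀ (p : M) (g : G), ∀ s ∈ U p, IsLocalDiffeomorphAt ((𝓡 k).prod (𝓡 (m - k))) (𝓡 m) ∞
    (fun x : G × EuclideanSpace ℝ (Fin (m - k)) => x.1 • σ p x.2) (g, s)
  zero_mem_V : ∀ c, 0 ∈ V c
  b_zero : ∀ c, b c 0 = c
  etale_b : ∀ (c : N) (g : G), ∀ s ∈ V c, IsLocalDiffeomorphAt ((𝓡 k).prod (𝓡 (n - k))) (𝓡 n) ∞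
    (fun x : G × EuclideanSpace ℝ (Fin (n - k)) => x.1 • b c x.2) (g, s)
  smooth_φ : ∀ c, ContMDiffOn (𝓡 (n - k)) (𝓡 (m - k)) ∞ (φ c) (V c)
  mapsTo_φ : ∀ c, ∀ v ∈ V c, φ c v ∈ U (ι c)
  σ_φ : ∀ c, ∀ v ∈ V c, σ (ι c) (φ c v) = ι (b c v)
  lift : ∀ c, ∀ v ∈ V c, ∀ u ∈ U (ι c), ∀ g : G, g • σ (ι c) (φ c v) = σ (ι c) u →
    ∃ c', ι c' = ι c ∧ ∃ v' ∈ V c', b c' v' = g • b c v ∧ φ c' v' = u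
  injective : ∀ c c', ι c = ι c' → ∀ v ∈ V c, ∀ v' ∈ V c', b c v = b c' v' → c = c' ∧ v = v'
  proper : ∀ c Q, IsCompact Q → Q ⊆ U (ι c) → IsCompact {v | v ∈ V c ∧ φ c v ∈ Q}

variable {k m n : ℕ}
  {G : Type*} [Group G] [TopologicalSpace G] [ChartedSpace (EuclideanSpace ℝ (Fin k)) G]
  [LieGroup (𝓡 k) ∞ G] [CompactSpace G]
  {M : Type*} [TopologicalSpace M] [ChartedSpace (EuclideanSpace ℝ (Fin m)) M]
  [IsManifold (𝓡 m) ∞ M] [MulAction G M] [ContMDiffSMul (𝓡 k) (𝓡 m) ∞ G M] [T2Space M]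
  {N : Type*} [TopologicalSpace N] [ChartedSpace (EuclideanSpace ℝ (Fin n)) N]
  [IsManifold (𝓡 n) ∞ N] [MulAction G N] [ContMDiffSMul (𝓡 k) (𝓡 n) ∞ G N] [T2Space N]

/-- The order of choices matters: transversals of `M` first, then at each point of `N` one adapted
to that of its image, and finally for each `p` a shrinking common to all points over `p`. -/
theorem exists_transversalFamily (hM : IsLocallyFreeAction G M) (hN : IsLocallyFreeAction G N)
    {ι : N → M} (hι : IsStrongEquivariantImmersion (𝓡 n) (𝓡 m) G ι) :
    Nonempty (TransversalFamily k m n G ι) := by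
  have : ContinuousSMul G M := ContMDiffSMul.continuousSMul (I := 𝓡 k) (I' := 𝓡 m) ∞
  have : ContinuousSMul G N := ContMDiffSMul.continuousSMul (I := 𝓡 k) (I' := 𝓡 n) ∞
  have hMp : ∀ p : M, DiscreteTopology (MulAction.stabilizer G p) := hM
  have hNp : ∀ p : N, DiscreteTopology (MulAction.stabilizer G p) := hN
  have hfin : ∀ p : M, (ι ⁻¹' {p}).Finite := fun p => finite_fiber_of_strong (hι.strong p)
  choose σ O hO h0 hσ0 hσ hσl using fun p : M => exists_transversal (k := k) (G := G) (m := m) p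
  choose b φ V hV h0V hb0 hφ0 hb hφ hφO hσφ hbl using fun q : N =>
    exists_adapted_transversal hι.immersion.1 hι.equivariant q (hO (ι q)) (h0 (ι q)) (hσ0 (ι q))
      (hσl (ι q) 1 0 (h0 (ι q)))
  choose r U hr hU h0U hUO hrV hball hlift hinj using fun p : M =>
    exists_shrinking hι.equivariant (hfin p) (hO p) (h0 p) (hσ0 p)
      (hσ p).continuousOn (hσl p 1 0 (h0 p)).exists_injOn hV h0V hb0 hφ0
      (fun c => (hb c).continuousOn) (fun c => (hφ c).continuousOn)
      (by rintro c rfl; exact hφO c) (by rintro c rfl; exact hσφ c)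
      (fun c => (hbl c 1 0 (h0V c)).exists_injOn)
      (fun c => (hbl c 1 0 (h0V c)).map_nhds_eq.trans (by simp [hb0]))
  have hsub : ∀ c, Metric.closedBall 0 (r (ι c)) ⊆ V c := fun c => hrV (ι c) c rfl
  have hopen : ∀ c, IsOpen (Metric.ball 0 (r (ι c)) ∩ φ c ⁻¹' U (ι c)) := fun c =>
    ((hφ c).continuousOn.mono (Metric.ball_subset_closedBall.trans (hsub c))).isOpen_inter_preimage
      Metric.isOpen_ball (hU (ι c))
  have hVsub : ∀ c, Metric.ball 0 (r (ι c)) ∩ φ c ⁻¹' U (ι c) ⊆ V c := fun c v hv =>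
    hsub c (Metric.ball_subset_closedBall hv.1)
  exact ⟨{
    σ := σ
    U := fun p => ⟨U p, hU p⟩
    b := b
    φ := φ
    -- The full preimage of `U` in the ball is taken, so that `φ c` maps into `U` and can be proper
    -- over it.
    V := fun c => ⟨Metric.ball 0 (r (ι c)) ∩ φ c ⁻¹' U (ι c), hopen c⟩
    zero_mem_U := h0U
    σ_zero := hσ0
    etale_σ := fun p g s hs => hσl p g s (hUO p hs)
    zero_mem_V := fun c => ⟨Metric.mem_ball_self (hr _), by
      rw [mem_preimage, hφ0]; exact h0U _⟩
    b_zero := hb0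
    etale_b := fun c g s hs => hbl c g s (hVsub c hs)
    smooth_φ := fun c => (hφ c).mono (hVsub c)
    mapsTo_φ := fun c v hv => hv.2
    σ_φ := fun c v hv => hσφ c v (hVsub c hv)
    lift := by
      intro c v hv u hu g h
      obtain ⟨c', hc', v', hv', h1, h2⟩ := hlift (ι c) c rfl v
        (Metric.ball_subset_closedBall hv.1) u hu g h
      have hu' : φ c' v' ∈ U (ι c) := by rw [h2]; exact hu
      refine ⟨c', hc', v', ?_, h1, h2⟩
      change v' ∈ Metric.ball 0 (r (ι c')) ∩ φ c' ⁻¹' U (ι c')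
      rw [hc']
      exact ⟨hball (ι c) c' hc' v' hv' hu', hu'⟩
    injective := fun c c' hcc v hv v' hv' h => hinj (ι c) c c' rfl hcc.symm v
      (Metric.ball_subset_closedBall hv.1) v' (by
        rw [hcc]; exact Metric.ball_subset_closedBall hv'.1) h
    proper := by
      intro c Q hQ hQU
      -- No boundary point of the ball lies over `U`, so the closed ball may replace the open one;
      -- the set is then closed in a compact set.
      have h1 : {v | v ∈ Metric.ball 0 (r (ι c)) ∩ φ c ⁻¹' U (ι c) ∧ φ c v ∈ Q} =
          Metric.closedBall 0 (r (ι c)) ∩ φ c ⁻¹' Q := by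
        ext v
        constructor
        · rintro ⟨h, h'⟩
          exact ⟨Metric.ball_subset_closedBall h.1, h'⟩
        · rintro ⟨h, h'⟩
          exact ⟨⟨hball (ι c) c rfl v h (hQU h'), hQU h'⟩, h'⟩
      refine (congrArg IsCompact h1).mpr ?_
      exact (isCompact_closedBall _ _).of_isClosed_subset
        (((hφ c).continuousOn.mono (hsub c)).preimage_isClosed_of_isClosed
          Metric.isClosed_closedBall hQ.isClosed) inter_subset_left }⟩

end TransversalFamily

/-! ### Disjoint unions of Euclidean open sets. -/

noncomputable section Sheets

variable {d : ℕ} {D : Type*} (V : D → TopologicalSpace.Opens (EuclideanSpace ℝ (Fin d)))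

/-- The disjoint union of a family of open subsets of a Euclidean space. -/
def Sheets : Type _ := Σ c, V c

namespace Sheets

instance : TopologicalSpace (Sheets V) := inferInstanceAs (TopologicalSpace (Σ c, V c))

instance : T2Space (Sheets V) := inferInstanceAs (T2Space (Σ c, V c))

instance [Countable D] : SecondCountableTopology (Sheets V) :=
  inferInstanceAs (SecondCountableTopology (Σ c, V c))

variable {V}

/-- The inclusion of a member of the family. -/
def incl (c : D) (v : V c) : Sheets V := Sigma.mk c v

theorem isOpenEmbedding_incl (c : D) : IsOpenEmbedding (incl c : V c → Sheets V) :=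
  IsOpenEmbedding.sigmaMk (σ := fun c => V c)

/-- The coordinate of a point. -/
def coord (x : Sheets V) : EuclideanSpace ℝ (Fin d) := x.2

theorem ext {x y : Sheets V} (h1 : x.1 = y.1) (h2 : x.coord = y.coord) : x = y := by
  obtain ⟨c, v⟩ := x
  obtain ⟨c', v'⟩ := y
  obtain rfl : c = c' := h1
  exact congrArg (incl c) (Subtype.ext h2)

theorem isLocalHomeomorph_coord : IsLocalHomeomorph (coord : Sheets V → _) := by
  rintro ⟨c, v⟩
  let f : V c → Sheets V := incl c
  have hf : IsOpenEmbedding f := isOpenEmbedding_incl c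
  let v' : V c := v
  have : Nonempty (V c) := ⟨v'⟩
  have hv : IsOpenEmbedding (Subtype.val : V c → EuclideanSpace ℝ (Fin d)) :=
    (V c).isOpen.isOpenEmbedding_subtypeVal
  let e := (hf.toOpenPartialHomeomorph f).symm.trans (hv.toOpenPartialHomeomorph _)
  have he : (⟨c, v⟩ : Sheets V) ∈ (e.source) := by
    simp only [e, mfld_simps, f]
    exact ⟨v, rfl⟩
  have heq : EqOn coord e e.source := by
    intro x hx
    simp only [e, mfld_simps, f] at hx
    obtain ⟨w, rfl⟩ := hx
    simp only [e, OpenPartialHomeomorph.coe_trans, Function.comp_apply]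
    have h1 : (hf.toOpenPartialHomeomorph f).symm (f w) = w :=
      hf.toOpenPartialHomeomorph_left_inv
    change coord (f w) = ((hf.toOpenPartialHomeomorph f).symm (f w)).1
    rw [h1]
    rfl
  exact (IsLocalHomeomorphOn.mk (coord : Sheets V → _) {⟨c, v⟩} (by
    rintro x rfl; exact ⟨e, he, heq⟩)) _ rfl

instance : ChartedSpace (EuclideanSpace ℝ (Fin d)) (Sheets V) :=
  isLocalHomeomorph_coord.pullbackChartedSpace

instance : IsManifold (𝓡 d) ∞ (Sheets V) :=
  isLocalHomeomorph_coord.pullback_isManifold _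

theorem isLocalDiffeomorph_coord : IsLocalDiffeomorph (𝓡 d) (𝓡 d) ∞ (coord : Sheets V → _) :=
  isLocalHomeomorph_coord.pullback_isLocalDiffeomorph _

theorem eventually_fst_eq (x : Sheets V) : ∀ᶠ y in 𝓝 x, y.1 = x.1 := by
  have : IsOpen (range (incl x.1 : V x.1 → Sheets V)) :=
    (isOpenEmbedding_incl x.1).isOpen_range
  filter_upwards [this.mem_nhds ⟨x.2, rfl⟩]
  rintro _ ⟨w, rfl⟩
  rfl

variable {E' : Type*} [NormedAddCommGroup E'] [NormedSpace ℝ E'] {X' : Type*} [TopologicalSpace X']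
  {I' : ModelWithCorners ℝ E' X'} {W : Type*} [TopologicalSpace W] [ChartedSpace X' W]

theorem contMDiff_of_forall {F : D → EuclideanSpace ℝ (Fin d) → W}
    (hF : ∀ c, ContMDiffOn (𝓡 d) I' ∞ (F c) (V c)) :
    ContMDiff (𝓡 d) I' ∞ fun x : Sheets V => F x.1 x.coord := by
  intro x
  have h1 : ContMDiffAt (𝓡 d) I' ∞ (F x.1 ∘ coord) x :=
    ((hF x.1).contMDiffAt ((V x.1).isOpen.mem_nhds x.2.2)).comp x
      isLocalDiffeomorph_coord.contMDiff.contMDiffAt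
  refine h1.congr_of_eventuallyEq ?_
  filter_upwards [eventually_fst_eq x] with y hy
  simp [hy]

theorem isLocalDiffeomorph_smul {k m : ℕ}
    {G : Type*} [Group G] [TopologicalSpace G] [ChartedSpace (EuclideanSpace ℝ (Fin k)) G]
    {M : Type*} [TopologicalSpace M] [ChartedSpace (EuclideanSpace ℝ (Fin m)) M] [MulAction G M]
    {F : D → EuclideanSpace ℝ (Fin d) → M}
    (hF : ∀ (c : D) (g : G), ∀ s ∈ V c, IsLocalDiffeomorphAt ((𝓡 k).prod (𝓡 d)) (𝓡 m) ∞
      (fun x : G × EuclideanSpace ℝ (Fin d) => x.1 • F c x.2) (g, s)) :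
    IsLocalDiffeomorph ((𝓡 k).prod (𝓡 d)) (𝓡 m) ∞
      fun x : G × Sheets V => x.1 • F x.2.1 x.2.coord := by
  rintro ⟨g, x⟩
  have h1 : IsLocalDiffeomorphAt ((𝓡 k).prod (𝓡 d)) ((𝓡 k).prod (𝓡 d)) ∞
      (Prod.map (id : G → G) (coord : Sheets V → _)) (g, x) :=
    (isLocalDiffeomorph_id g).prodMap (isLocalDiffeomorph_coord x)
  refine (h1.comp (𝓡 m) M (hF x.1 g x.coord x.2.2)).congr_of_eventuallyEq ?_
  have : ∀ᶠ y : G × Sheets V in 𝓝 (g, x), y.2.1 = x.1 :=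
    (continuous_snd.continuousAt (x := (g, x))).eventually (eventually_fst_eq x)
  filter_upwards [this] with y hy
  simp [hy]

variable {d' : ℕ} {D' : Type*} {U : D' → TopologicalSpace.Opens (EuclideanSpace ℝ (Fin d'))}
  (f : D → D') (φ : D → EuclideanSpace ℝ (Fin d) → EuclideanSpace ℝ (Fin d'))
  (hmaps : ∀ c, ∀ v ∈ V c, φ c v ∈ U (f c))

/-- The map of disjoint unions given by maps between the members. -/
def map (x : Sheets V) : Sheets U := ⟨f x.1, φ x.1 x.2, hmaps x.1 x.2 x.2.2⟩

variable {f φ}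

theorem continuous_map (hφ : ∀ c, ContMDiffOn (𝓡 d) (𝓡 d') ∞ (φ c) (V c)) :
    Continuous (map f φ hmaps : Sheets V → Sheets U) := by
  refine continuous_sigma fun c => ?_
  have h1 : Continuous fun v : V c => (⟨φ c v, hmaps c v v.2⟩ : U (f c)) :=
    (continuousOn_iff_continuous_domRestrict.1 (hφ c).continuousOn).subtype_mk _
  exact (isOpenEmbedding_incl (V := U) (f c)).continuous.comp h1

theorem contMDiff_map (hφ : ∀ c, ContMDiffOn (𝓡 d) (𝓡 d') ∞ (φ c) (V c)) :
    ContMDiff (𝓡 d) (𝓡 d') ∞ (map f φ hmaps : Sheets V → Sheets U) :=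
  ContMDiff.of_localDiffeo_comp (Ψ := coord) (contMDiff_of_forall hφ) isLocalDiffeomorph_coord
    (continuous_map hmaps hφ)

/-- Near a point of the sheet `p` only the finitely many sheets over `p` matter, and each meets the
preimage of a compact neighborhood `Q` in a compact set. An ultrafilter with convergent image
contains their union `S`, hence converges. -/
theorem isProperMap_map (hφ : ∀ c, ContMDiffOn (𝓡 d) (𝓡 d') ∞ (φ c) (V c))
    (hf : ∀ p, (f ⁻¹' {p}).Finite)
    (hproper : ∀ c Q, IsCompact Q → Q ⊆ U (f c) → IsCompact {v | v ∈ V c ∧ φ c v ∈ Q}) :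
    IsProperMap (map f φ hmaps : Sheets V → Sheets U) := by
  have hcont := continuous_map hmaps hφ
  refine isProperMap_iff_ultrafilter.2 ⟨hcont, ?_⟩
  rintro F ⟨p, u⟩ hF
  obtain ⟨Q, hQ, hQU, huQ⟩ : ∃ Q, IsCompact Q ∧ Q ⊆ (U p : Set _) ∧
      Q ∈ 𝓝 (u : EuclideanSpace ℝ (Fin d')) := by
    obtain ⟨Q, hQ, h1, h2⟩ := local_compact_nhds ((U p).isOpen.mem_nhds u.2)
    exact ⟨Q, h2, h1, hQ⟩
  let S : Set (Sheets V) := ⋃ c ∈ f ⁻¹' {p}, (incl c : V c → Sheets V) '' {v | φ c v ∈ Q}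
  have hS : IsCompact S := by
    refine (hf p).isCompact_biUnion fun c hc => ?_
    have hc' : f c = p := hc
    refine IsCompact.image ?_ (isOpenEmbedding_incl c).continuous
    rw [Subtype.isCompact_iff]
    convert hproper c Q hQ (by rw [hc']; exact hQU) using 1
    ext v
    constructor
    · rintro ⟨v, hv, rfl⟩
      exact ⟨v.2, hv⟩
    · rintro ⟨hv, hv'⟩
      exact ⟨⟨v, hv⟩, hv', rfl⟩
  have hSF : S ∈ F := by
    have e1 := hF.eventually (eventually_fst_eq (⟨p, u⟩ : Sheets U))
    have e2 := hF.eventually ((isLocalHomeomorph_coord.continuous.continuousAt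
      (x := (⟨p, u⟩ : Sheets U))).eventually_mem huQ)
    filter_upwards [e1, e2]
    rintro ⟨c, v⟩ h1 h2
    exact mem_biUnion (show c ∈ f ⁻¹' {p} from h1) ⟨v, h2, rfl⟩
  obtain ⟨x, -, hx⟩ := hS.ultrafilter_le_nhds F (le_principal_iff.2 hSF)
  exact ⟨x, tendsto_nhds_unique (hcont.continuousAt.mono_left hx) hF, hx⟩

end Sheets

end Sheets

/-! ### The pullback of a translation groupoid to a transversal. -/

noncomputable section PullbackGroupoid

variable {k m d : ℕ}
  {G : Type uG} [Group G] [TopologicalSpace G] [ChartedSpace (EuclideanSpace ℝ (Fin k)) G]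
  [LieGroup (𝓡 k) ∞ G]
  {M : Type uM} [TopologicalSpace M] [ChartedSpace (EuclideanSpace ℝ (Fin m)) M]
  [IsManifold (𝓡 m) ∞ M] [MulAction G M] [ContMDiffSMul (𝓡 k) (𝓡 m) ∞ G M]
  {A : Type u} [TopologicalSpace A] [ChartedSpace (EuclideanSpace ℝ (Fin d)) A]
  [IsManifold (𝓡 d) ∞ A]

/-- The map `a : A → M` is transverse to the orbits, of complementary dimension. -/
def IsEtaleTransversal (k m d : ℕ) (G : Type uG) [Group G] [TopologicalSpace G]
    [ChartedSpace (EuclideanSpace ℝ (Fin k)) G]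
    {M : Type uM} [TopologicalSpace M] [ChartedSpace (EuclideanSpace ℝ (Fin m)) M] [MulAction G M]
    {A : Type u} [TopologicalSpace A] [ChartedSpace (EuclideanSpace ℝ (Fin d)) A] (a : A → M) :
    Prop :=
  IsLocalDiffeomorph ((𝓡 k).prod (𝓡 d)) (𝓡 m) ∞ fun x : G × A => x.1 • a x.2

/-- The arrows of the pullback of the translation groupoid of `G` on `M` along `a : A → M`. -/
@[nolint unusedArguments]
def PullbackArr {a : A → M} (_ : IsEtaleTransversal k m d G a) : Type (max uG u) :=
  {x : A × G × A // x.2.1 • a x.1 = a x.2.2}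

variable {a : A → M} (ha : IsEtaleTransversal k m d G a)

theorem IsEtaleTransversal.contMDiff {a : A → M} (ha : IsEtaleTransversal k m d G a) :
    ContMDiff (𝓡 d) (𝓡 m) ∞ a := by
  have h : ContMDiff (𝓡 d) (𝓡 m) ∞ ((fun x : G × A => x.1 • a x.2) ∘ fun s => (1, s)) :=
    (IsLocalDiffeomorph.contMDiff ha).comp (contMDiff_const.prodMk contMDiff_id)
  exact h.congr fun s => (one_smul G (a s)).symm

/-- An arrow from `s` with group element `g` and target `t` satisfies `a s = g⁻¹ • a t`; this form
lets `(g, t)` be solved for in terms of the source. -/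
theorem IsEtaleTransversal.isLocalDiffeomorph_inv {a : A → M}
    (ha : IsEtaleTransversal k m d G a) :
    IsLocalDiffeomorph ((𝓡 k).prod (𝓡 d)) (𝓡 m) ∞ fun x : G × A => x.1⁻¹ • a x.2 := by
  have hinv : IsLocalDiffeomorph (𝓡 k) (𝓡 k) ∞ fun g : G => g⁻¹ :=
    Diffeomorph.isLocalDiffeomorph (𝕜 := ℝ)
      { toEquiv := Equiv.inv G
        contMDiff_toFun := contMDiff_inv _ _
        contMDiff_invFun := contMDiff_inv _ _ : Diffeomorph (𝓡 k) (𝓡 k) G G ∞ }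
  rintro ⟨g, s⟩
  exact ((hinv g).prodMap (isLocalDiffeomorph_id s)).comp (𝓡 m) M (ha (g⁻¹, s))

namespace PullbackArr

variable {ha}

def src (x : PullbackArr ha) : A := x.1.1
def elt (x : PullbackArr ha) : G := x.1.2.1
def tgt (x : PullbackArr ha) : A := x.1.2.2

theorem smul_src (x : PullbackArr ha) : x.elt • a x.src = a x.tgt := x.2

theorem ext {x y : PullbackArr ha} (h1 : x.src = y.src) (h2 : x.elt = y.elt)
    (h3 : x.tgt = y.tgt) : x = y :=
  Subtype.ext (Prod.ext h1 (Prod.ext h2 h3))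

variable (ha) in
def mk (s : A) (g : G) (t : A) (h : g • a s = a t) : PullbackArr ha := ⟨(s, g, t), h⟩

instance : TopologicalSpace (PullbackArr ha) :=
  inferInstanceAs (TopologicalSpace {x : A × G × A // x.2.1 • a x.1 = a x.2.2})

theorem isEmbedding_val : IsEmbedding (fun x : PullbackArr ha => (x.src, x.elt, x.tgt)) :=
  IsEmbedding.subtypeVal

instance [T2Space A] [T2Space G] : T2Space (PullbackArr ha) :=
  inferInstanceAs (T2Space {x : A × G × A // x.2.1 • a x.1 = a x.2.2})

instance [SecondCountableTopology A] [SecondCountableTopology G] :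
    SecondCountableTopology (PullbackArr ha) :=
  TopologicalSpace.Subtype.secondCountableTopology {x : A × G × A | x.2.1 • a x.1 = a x.2.2}

theorem continuous_src : Continuous (src : PullbackArr ha → A) :=
  continuous_fst.comp isEmbedding_val.continuous

theorem continuous_elt : Continuous (elt : PullbackArr ha → G) :=
  (continuous_fst.comp continuous_snd).comp isEmbedding_val.continuous

theorem continuous_tgt : Continuous (tgt : PullbackArr ha → A) :=
  (continuous_snd.comp continuous_snd).comp isEmbedding_val.continuous

open Classical in
-- Apply a local inverse of the étale map `(g, t) ↦ g⁻¹ • a t` to `a s`: it returns the only nearby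
-- group element and target of an arrow starting at `s`.
theorem isLocalHomeomorph_src : IsLocalHomeomorph (src : PullbackArr ha → A) := by
  refine IsLocalHomeomorph.mk _ fun x₀ => ?_
  have hΨ := ha.isLocalDiffeomorph_inv (x₀.elt, x₀.tgt)
  let Λ := hΨ.localInverse
  have hx₀ : x₀.elt⁻¹ • a x₀.tgt = a x₀.src := by rw [← x₀.smul_src, inv_smul_smul]
  have hright : ∀ s, a s ∈ Λ.source → (Λ (a s)).1 • a s = a (Λ (a s)).2 := by
    intro s hs
    have := hΨ.localInverse_right_inv hs
    rw [inv_smul_eq_iff] at this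
    exact this.symm
  let sec : A → PullbackArr ha := fun s =>
    if h : (Λ (a s)).1 • a s = a (Λ (a s)).2 then mk ha s (Λ (a s)).1 (Λ (a s)).2 h else x₀
  have hsec : ∀ s (hs : a s ∈ Λ.source), sec s = mk ha s (Λ (a s)).1 (Λ (a s)).2 (hright s hs) :=
    fun s hs => dif_pos (hright s hs)
  have hat : Continuous a := ha.contMDiff.continuous
  let pr : PullbackArr ha → G × A := fun x => (x.elt, x.tgt)
  have hpr : Continuous pr := continuous_elt.prodMk continuous_tgt
  have hleft : ∀ x : PullbackArr ha, pr x ∈ Λ.target → Λ (a x.src) = pr x := by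
    intro x hx
    have h1 := hΨ.localInverse_left_inv hx
    have h2 : x.elt⁻¹ • a x.tgt = a x.src := by rw [← x.smul_src, inv_smul_smul]
    rw [← h2]
    exact h1
  have hsrc : ∀ x : PullbackArr ha, pr x ∈ Λ.target → a x.src ∈ Λ.source := by
    intro x hx
    have h1 := Λ.map_target' hx
    have h2 : Λ.symm (pr x) = a x.src := by
      have h3 : Λ (Λ.symm (pr x)) = pr x := Λ.right_inv' hx
      have h4 : Λ.symm (pr x) ∈ Λ.source := h1
      have h5 := hΨ.localInverse_right_inv h4
      have h6 : x.elt⁻¹ • a x.tgt = a x.src := by rw [← x.smul_src, inv_smul_smul]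
      rw [← h5, ← h6]
      exact congrArg (fun y : G × A => y.1⁻¹ • a y.2) h3
    rw [← h2]
    exact h1
  let e : OpenPartialHomeomorph (PullbackArr ha) A :=
    { toFun := src
      invFun := sec
      source := pr ⁻¹' Λ.target
      target := a ⁻¹' Λ.source
      map_source' := hsrc
      map_target' := by
        intro s hs
        rw [mem_preimage, hsec s hs]
        exact Λ.map_source' hs
      left_inv' := by
        intro x hx
        rw [hsec _ (hsrc x hx)]
        have := hleft x hx
        exact ext rfl (congrArg Prod.fst this) (congrArg Prod.snd this)
      right_inv' := by
        intro s hs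
        rw [hsec s hs]
        rfl
      open_source := Λ.open_target.preimage hpr
      open_target := Λ.open_source.preimage hat
      continuousOn_toFun := continuous_src.continuousOn
      continuousOn_invFun := by
        rw [isEmbedding_val.isInducing.continuousOn_iff]
        have hc : ContinuousOn (fun s => Λ (a s)) (a ⁻¹' Λ.source) :=
          Λ.contMDiffOn_toFun.continuousOn.comp hat.continuousOn fun s hs => hs
        refine (continuousOn_id.prodMk hc).congr fun s hs => ?_
        simp only [Function.comp_apply, hsec s hs]
        rfl }
  refine ⟨e, ?_, fun _ _ => rfl⟩
  exact hΨ.localInverse_mem_target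

/-- Charts come from the source map. This makes `src` étale by construction, and smoothness of a
continuous map into the arrows can be tested after `src`. -/
instance : ChartedSpace (EuclideanSpace ℝ (Fin d)) (PullbackArr ha) :=
  isLocalHomeomorph_src.pullbackChartedSpace

instance : IsManifold (𝓡 d) ∞ (PullbackArr ha) := isLocalHomeomorph_src.pullback_isManifold _

theorem isLocalDiffeomorph_src : IsLocalDiffeomorph (𝓡 d) (𝓡 d) ∞ (src : PullbackArr ha → A) :=
  isLocalHomeomorph_src.pullback_isLocalDiffeomorph _

/-- The pair is a continuous lift of the smooth map `a ∘ src` through a local diffeomorphism. -/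
theorem contMDiff_elt_tgt : ContMDiff (𝓡 d) ((𝓡 k).prod (𝓡 d)) ∞
    fun x : PullbackArr ha => (x.elt, x.tgt) := by
  refine ContMDiff.of_localDiffeo_comp (Ψ := fun x : G × A => x.1⁻¹ • a x.2) ?_
    ha.isLocalDiffeomorph_inv (continuous_elt.prodMk continuous_tgt)
  refine (ha.contMDiff.comp isLocalDiffeomorph_src.contMDiff).congr fun x => ?_
  simp [← x.smul_src]

theorem contMDiff_elt : ContMDiff (𝓡 d) (𝓡 k) ∞ (elt : PullbackArr ha → G) :=
  contMDiff_fst.comp contMDiff_elt_tgt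

theorem contMDiff_tgt : ContMDiff (𝓡 d) (𝓡 d) ∞ (tgt : PullbackArr ha → A) :=
  contMDiff_snd.comp contMDiff_elt_tgt

def inv (x : PullbackArr ha) : PullbackArr ha :=
  mk ha x.tgt x.elt⁻¹ x.src (by rw [← x.smul_src, inv_smul_smul])

theorem contMDiff_inv : ContMDiff (𝓡 d) (𝓡 d) ∞ (inv : PullbackArr ha → PullbackArr ha) := by
  refine ContMDiff.of_localDiffeo_comp (Ψ := src) contMDiff_tgt isLocalDiffeomorph_src ?_
  rw [isEmbedding_val.continuous_iff]
  have : IsTopologicalGroup G := topologicalGroup_of_lieGroup (𝓡 k) ∞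
  exact continuous_tgt.prodMk (continuous_elt.inv.prodMk continuous_src)

theorem isLocalDiffeomorph_tgt : IsLocalDiffeomorph (𝓡 d) (𝓡 d) ∞ (tgt : PullbackArr ha → A) := by
  have h1 : IsLocalDiffeomorph (𝓡 d) (𝓡 d) ∞ (inv : PullbackArr ha → PullbackArr ha) :=
    Diffeomorph.isLocalDiffeomorph (𝕜 := ℝ)
      { toFun := inv
        invFun := inv
        left_inv := fun x => ext rfl (inv_inv _) rfl
        right_inv := fun x => ext rfl (inv_inv _) rfl
        contMDiff_toFun := contMDiff_inv
        contMDiff_invFun := contMDiff_inv :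
          Diffeomorph (𝓡 d) (𝓡 d) (PullbackArr ha) (PullbackArr ha) ∞ }
  exact IsLocalDiffeomorph.comp (Ψ := (src : PullbackArr ha → A)) isLocalDiffeomorph_src h1

def unit (s : A) : PullbackArr ha := mk ha s 1 s (one_smul _ _)

theorem contMDiff_unit : ContMDiff (𝓡 d) (𝓡 d) ∞ (unit : A → PullbackArr ha) := by
  refine ContMDiff.of_localDiffeo_comp (Ψ := src) contMDiff_id isLocalDiffeomorph_src ?_
  rw [isEmbedding_val.continuous_iff]
  exact continuous_id.prodMk (continuous_const.prodMk continuous_id)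

open Classical in
/-- Composition of arrows; the value for non-composable arrows is irrelevant. -/
def mul (x y : PullbackArr ha) : PullbackArr ha :=
  if h : x.src = y.tgt then
    mk ha y.src (x.elt * y.elt) x.tgt (by rw [mul_smul, y.smul_src, ← h, x.smul_src])
  else x

theorem mul_of_eq {x y : PullbackArr ha} (h : x.src = y.tgt) :
    mul x y = mk ha y.src (x.elt * y.elt) x.tgt
      (by rw [mul_smul, y.smul_src, ← h, x.smul_src]) :=
  dif_pos h

theorem contMDiffOn_mul : ContMDiffOn ((𝓡 d).prod (𝓡 d)) (𝓡 d) ∞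
    (fun p : PullbackArr ha × PullbackArr ha => mul p.1 p.2) {p | p.1.src = p.2.tgt} := by
  have hcont : ContinuousOn (fun p : PullbackArr ha × PullbackArr ha => mul p.1 p.2)
      {p | p.1.src = p.2.tgt} := by
    rw [isEmbedding_val.isInducing.continuousOn_iff]
    have hc : Continuous fun p : PullbackArr ha × PullbackArr ha =>
        (p.2.src, p.1.elt * p.2.elt, p.1.tgt) := by
      have : IsTopologicalGroup G := topologicalGroup_of_lieGroup (𝓡 k) ∞
      exact (continuous_src.comp continuous_snd).prodMk
        (((continuous_elt.comp continuous_fst).mul (continuous_elt.comp continuous_snd)).prodMk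
          (continuous_tgt.comp continuous_fst))
    refine hc.continuousOn.congr fun p hp => ?_
    simp only [Function.comp_apply]
    rw [mul_of_eq hp]
    rfl
  intro p hp
  refine ContMDiffWithinAt.of_localDiffeo_comp (Ψ := src) ?_ (isLocalDiffeomorph_src _) (hcont p hp)
  have h1 : ContMDiffWithinAt ((𝓡 d).prod (𝓡 d)) (𝓡 d) ∞
      (fun p : PullbackArr ha × PullbackArr ha => p.2.src) {p | p.1.src = p.2.tgt} p :=
    (isLocalDiffeomorph_src.contMDiff.comp contMDiff_snd).contMDiffAt.contMDiffWithinAt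
  have h2 : ∀ q ∈ {p : PullbackArr ha × PullbackArr ha | p.1.src = p.2.tgt},
      (src ∘ fun p : PullbackArr ha × PullbackArr ha => mul p.1 p.2) q = q.2.src := by
    intro q hq
    simp only [Function.comp_apply]
    rw [mul_of_eq hq]
    rfl
  exact h1.congr h2 (h2 p hp)

end PullbackArr

/-- The pullback of the translation groupoid of `G` on `M` along `a : A → M`. -/
@[reducible]
def pullbackGroupoid : LieGroupoid.{u, max uG u} (𝓡 d) (𝓡 d) where
  Ob := A
  Arr := PullbackArr ha
  src := PullbackArr.src
  tgt := PullbackArr.tgt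
  unit := PullbackArr.unit
  inv := PullbackArr.inv
  mul := PullbackArr.mul
  src_unit _ := rfl
  tgt_unit _ := rfl
  src_inv _ := rfl
  tgt_inv _ := rfl
  src_mul g h e := by rw [PullbackArr.mul_of_eq e]; rfl
  tgt_mul g h e := by rw [PullbackArr.mul_of_eq e]; rfl
  mul_assoc f g h e e' := by
    rw [PullbackArr.mul_of_eq e, PullbackArr.mul_of_eq e', PullbackArr.mul_of_eq,
      PullbackArr.mul_of_eq]
    · exact PullbackArr.ext rfl (mul_assoc _ _ _) rfl
    · exact e
    · exact e'
  mul_unit g := by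
    rw [PullbackArr.mul_of_eq rfl]
    exact PullbackArr.ext rfl (mul_one _) rfl
  unit_mul g := by
    rw [PullbackArr.mul_of_eq rfl]
    exact PullbackArr.ext rfl (one_mul _) rfl
  inv_mul g := by
    rw [PullbackArr.mul_of_eq rfl]
    exact PullbackArr.ext rfl (inv_mul_cancel _) rfl
  mul_inv g := by
    rw [PullbackArr.mul_of_eq rfl]
    exact PullbackArr.ext rfl (mul_inv_cancel _) rfl
  smooth_src := PullbackArr.isLocalDiffeomorph_src.contMDiff
  smooth_tgt := PullbackArr.contMDiff_tgt
  smooth_unit := PullbackArr.contMDiff_unit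
  smooth_inv := PullbackArr.contMDiff_inv
  smooth_mul := PullbackArr.contMDiffOn_mul
  submersion_src g := (PullbackArr.isLocalDiffeomorph_src g).mfderiv_bijective.2

/-- Properness comes from compactness of `G`: the arrows form a closed subset of `A × G × A`, and
forgetting the factor `G` is a proper map. -/
theorem pullbackGroupoid_isOrbifoldGroupoid [T2Space A] [SecondCountableTopology A] [T2Space G]
    [CompactSpace G] [T2Space M] : (pullbackGroupoid ha).IsOrbifoldGroupoid where
  t2_ob := inferInstanceAs (T2Space A)
  secondCountable_ob := inferInstanceAs (SecondCountableTopology A)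
  t2_arr := inferInstanceAs (T2Space (PullbackArr ha))
  secondCountable_arr := by
    have : SecondCountableTopology G :=
      ChartedSpace.secondCountable_of_sigmaCompact (EuclideanSpace ℝ (Fin k)) G
    exact inferInstanceAs (SecondCountableTopology (PullbackArr ha))
  proper := by
    have : ContinuousSMul G M := ContMDiffSMul.continuousSMul (I := 𝓡 k) (I' := 𝓡 m) ∞
    have hat : Continuous a := ha.contMDiff.continuous
    have hclosed : IsClosed {x : A × G × A | x.2.1 • a x.1 = a x.2.2} :=
      isClosed_eq ((continuous_fst.comp continuous_snd).smul (hat.comp continuous_fst))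
        (hat.comp (continuous_snd.comp continuous_snd))
    have h1 : IsProperMap (Subtype.val : {x : A × G × A | x.2.1 • a x.1 = a x.2.2} → A × G × A) :=
      hclosed.isProperMap_subtypeVal
    have h2 : IsProperMap (Prod.map id Prod.snd : A × G × A → A × A) :=
      isProperMap_id.prodMap isProperMap_snd_of_compactSpace
    exact h2.comp h1
  etale := ⟨PullbackArr.isLocalDiffeomorph_src, PullbackArr.isLocalDiffeomorph_tgt⟩

/-- The projection of the pullback groupoid to the translation groupoid. -/
def pullbackHom : LieGroupoid.Hom (pullbackGroupoid ha) (translationGroupoid (𝓡 k) (𝓡 m) G M) where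
  ob := a
  arr x := (PullbackArr.elt x, a (PullbackArr.src x))
  smooth_ob := ha.contMDiff
  smooth_arr := PullbackArr.contMDiff_elt.prodMk
    (ha.contMDiff.comp PullbackArr.isLocalDiffeomorph_src.contMDiff)
  src_arr _ := rfl
  tgt_arr x := PullbackArr.smul_src x
  map_unit _ := rfl
  map_inv x := Prod.ext rfl (PullbackArr.smul_src x).symm
  map_mul g h e := by
    have e' : PullbackArr.src (ha := ha) g = PullbackArr.tgt (ha := ha) h := e
    change ((PullbackArr.mul (ha := ha) g h).elt, a (PullbackArr.mul (ha := ha) g h).src) = _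
    rw [PullbackArr.mul_of_eq e']
    rfl

theorem pullbackHom_isEquivalence (hsurj : ∀ x : M, ∃ (g : G) (s : A), g • a s = x) :
    (pullbackHom ha).IsEquivalence where
  essentially_surjective x := by
    obtain ⟨g, s, h⟩ := hsurj x
    exact ⟨(g, a s), s, rfl, h⟩
  submersion := by
    rintro ⟨g, _⟩ y rfl ξ
    obtain ⟨⟨v, w⟩, h⟩ := (ha (g, y)).mfderiv_bijective.2 ξ
    have hda : MDifferentiableAt (𝓡 d) (𝓡 m) a y := ha.contMDiff.mdifferentiable (by simp) y
    have hact : MDifferentiable ((𝓡 k).prod (𝓡 m)) (𝓡 m) fun p : G × M => p.1 • p.2 :=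
      (ContMDiffSMul.contMDiff_smul (I := 𝓡 k) (I' := 𝓡 m) (n := ∞)).mdifferentiable (by simp)
    -- The étale map `(g, s) ↦ g • a s` has surjective derivative; a preimage `(v, w)` of `ξ`
    -- determines the tangent vector at the arrow, its `M`-component being forced by the fibered
    -- product.
    refine ⟨(v, mfderiv (𝓡 d) (𝓡 m) a y w), w, ?_, ?_⟩
    · change mfderiv ((𝓡 k).prod (𝓡 m)) (𝓡 m) Prod.snd (g, a y) _ = _
      rw [mfderiv_snd]
      rfl
    · rw [← h]
      have e1 : (fun x : G × A => x.1 • a x.2) = (fun p : G × M => p.1 • p.2) ∘ Prod.map id a := rfl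
      rw [e1, mfderiv_comp (I' := (𝓡 k).prod (𝓡 m)) (g, y) (hact _)
        (mdifferentiableAt_id.prodMap hda), mfderiv_prodMap mdifferentiableAt_id hda, mfderiv_id]
      rfl
  fibered_product := by
    have hs : ContMDiff (𝓡 d) (𝓡 d) ∞ (PullbackArr.src : PullbackArr ha → A) :=
      PullbackArr.isLocalDiffeomorph_src.contMDiff
    have hsm : ContMDiff (𝓡 d) (((𝓡 d).prod (𝓡 d)).prod ((𝓡 k).prod (𝓡 m))) ∞
        (fun z : PullbackArr ha => ((z.src, z.tgt), (z.elt, a z.src))) :=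
      (hs.prodMk PullbackArr.contMDiff_tgt).prodMk
        (PullbackArr.contMDiff_elt.prodMk (ha.contMDiff.comp hs))
    refine ⟨⟨hsm, fun x => ?_⟩, ?_, ?_⟩
    -- One coordinate of the map is `src`, whose derivative is already injective.
    · have hmd : MDifferentiable (((𝓡 d).prod (𝓡 d)).prod ((𝓡 k).prod (𝓡 m))) (𝓡 d)
          (fun w : (A × A) × (G × M) => w.1.1) :=
        (contMDiff_fst.comp contMDiff_fst : ContMDiff _ _ ∞ _).mdifferentiable (by simp)
      have e := mfderiv_comp (I := 𝓡 d) (I' := ((𝓡 d).prod (𝓡 d)).prod ((𝓡 k).prod (𝓡 m)))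
        (I'' := 𝓡 d) x (hmd _) (hsm.mdifferentiable (by simp) x)
      have hinj : Function.Injective
          (mfderiv (𝓡 d) (𝓡 d) (PullbackArr.src : PullbackArr ha → A) x) :=
        (PullbackArr.isLocalDiffeomorph_src x).mfderiv_bijective.1
      have e' : (mfderiv (𝓡 d) (𝓡 d) (PullbackArr.src : PullbackArr ha → A) x :
          TangentSpace (𝓡 d) x → TangentSpace (𝓡 d) x.src) = _ := congrArg DFunLike.coe e
      rw [e'] at hinj
      exact Function.Injective.of_comp hinj
    · have hc : Continuous (fun w : (A × A) × (G × M) => (w.1.1, w.2.1, w.1.2)) := by fun_prop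
      exact PullbackArr.isEmbedding_val.of_comp hsm.continuous hc
    · ext ⟨⟨s, t⟩, g, p⟩
      constructor
      · rintro ⟨x, hx⟩
        simp only [Prod.mk.injEq] at hx
        obtain ⟨⟨rfl, rfl⟩, hx⟩ := hx
        have hx' : (PullbackArr.elt (ha := ha) x, a (PullbackArr.src (ha := ha) x)) = (g, p) := hx
        rw [Prod.mk.injEq] at hx'
        obtain ⟨rfl, rfl⟩ := hx'
        exact Prod.ext rfl (PullbackArr.smul_src x).symm
      · intro h
        have h' : (a s, a t) = (p, g • p) := h
        rw [Prod.mk.injEq] at h'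
        obtain ⟨h1, h2⟩ := h'
        subst h1
        exact ⟨PullbackArr.mk ha s g t h2.symm, rfl⟩

end PullbackGroupoid

/-! ### Proper étale groupoids near a point. -/

noncomputable section EtaleGroupoids

namespace LieGroupoid

variable
  {E₀ : Type*} [NormedAddCommGroup E₀] [NormedSpace ℝ E₀] {X₀ : Type*} [TopologicalSpace X₀]
  {E₁ : Type*} [NormedAddCommGroup E₁] [NormedSpace ℝ E₁] {X₁ : Type*} [TopologicalSpace X₁]
  {I₀ : ModelWithCorners ℝ E₀ X₀} {I₁ : ModelWithCorners ℝ E₁ X₁}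
  {K : LieGroupoid.{u, v} I₀ I₁}

theorem inv_eq_of_mul_eq_unit {g h : K.Arr} (e : K.src g = K.tgt h)
    (hu : K.mul g h = K.unit (K.src h)) : K.inv h = g := by
  have h1 : K.mul (K.mul g h) (K.inv h) = K.inv h := by
    rw [hu, ← K.tgt_inv h, K.unit_mul]
  rw [← h1, K.mul_assoc _ _ _ e (K.tgt_inv h).symm, K.mul_inv, ← e, K.mul_unit]

section ActionHom

variable {Γ : Type*} [Group Γ] [TopologicalSpace Γ] [DiscreteTopology Γ]
  [ChartedSpace (EuclideanSpace ℝ (Fin 0)) Γ] [LieGroup (𝓡 0) ∞ Γ]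
  {X : Type*} [TopologicalSpace X] [ChartedSpace X₀ X] [IsManifold I₀ ∞ X]
  [MulAction Γ X] [ContMDiffSMul (𝓡 0) I₀ ∞ Γ X]

/-- A system of arrows representing an action of a discrete group on `X` in a groupoid. -/
structure IsArrowSystem (K : LieGroupoid.{u, v} I₀ I₁) (θ : X → K.Ob) (ℓ : Γ → X → K.Arr) :
    Prop where
  smooth : IsLocalDiffeomorph I₀ I₀ ∞ θ
  continuous : ∀ γ, Continuous (ℓ γ)
  src_eq : ∀ γ e, K.src (ℓ γ e) = θ e
  tgt_eq : ∀ γ e, K.tgt (ℓ γ e) = θ (γ • e)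
  map_one : ∀ e, ℓ 1 e = K.unit (θ e)
  map_mul : ∀ γ δ e, ℓ (γ * δ) e = K.mul (ℓ γ (δ • e)) (ℓ δ e)

variable {θ : X → K.Ob} {ℓ : Γ → X → K.Arr}

theorem IsArrowSystem.continuous_uncurry (h : K.IsArrowSystem θ ℓ) :
    Continuous fun p : Γ × X => ℓ p.1 p.2 :=
  continuous_prod_of_discrete_left.2 h.continuous

theorem IsArrowSystem.isLocalDiffeomorph (h : K.IsArrowSystem θ ℓ) (hK : K.IsEtale) :
    IsLocalDiffeomorph ((𝓡 0).prod I₀) I₁ ∞ fun p : Γ × X => ℓ p.1 p.2 := by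
  have h1 : IsLocalDiffeomorph ((𝓡 0).prod I₀) I₀ ∞ (θ ∘ (Prod.snd : Γ × X → X)) :=
    IsLocalDiffeomorph.comp h.smooth isLocalDiffeomorph_snd_of_discrete
  have h2 : K.src ∘ (fun p : Γ × X => ℓ p.1 p.2) = θ ∘ Prod.snd := by
    ext p
    exact h.src_eq p.1 p.2
  rw [← h2] at h1
  exact h1.of_comp_left hK.1 h.continuous_uncurry

/-- The homomorphism from a translation groupoid given by a system of arrows. -/
def IsArrowSystem.hom (h : K.IsArrowSystem θ ℓ) (hK : K.IsEtale) :
    Hom (translationGroupoid (𝓡 0) I₀ Γ X) K where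
  ob := θ
  arr p := ℓ p.1 p.2
  smooth_ob := h.smooth.contMDiff
  smooth_arr := (h.isLocalDiffeomorph hK).contMDiff
  src_arr p := h.src_eq p.1 p.2
  tgt_arr p := h.tgt_eq p.1 p.2
  map_unit e := h.map_one e
  map_inv p := by
    obtain ⟨γ, e⟩ := p
    refine (inv_eq_of_mul_eq_unit ?_ ?_).symm
    · rw [h.src_eq, h.tgt_eq]
    · change K.mul (ℓ γ⁻¹ (γ • e)) (ℓ γ e) = _
      rw [← h.map_mul, inv_mul_cancel, h.map_one, h.src_eq]
  map_mul p q e := by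
    obtain ⟨γ, a⟩ := p
    obtain ⟨δ, b⟩ := q
    have e' : a = δ • b := e
    subst e'
    exact h.map_mul γ δ b

theorem IsArrowSystem.isIsoOntoRestriction (h : K.IsArrowSystem θ ℓ) (hK : K.IsEtale)
    (hθ : Function.Injective θ) {U : Set K.Ob} (hU : range θ = U)
    (hℓ : ∀ γ δ e, ℓ γ e = ℓ δ e → γ = δ)
    (hsurj : ∀ g, K.src g ∈ U → K.tgt g ∈ U → ∃ γ e, ℓ γ e = g) :
    (h.hom hK).IsIsoOntoRestriction U where
  injective_ob := hθ
  localDiffeo_ob := h.smooth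
  range_ob := hU
  injective_arr := by
    rintro ⟨γ, e⟩ ⟨δ, e'⟩ hh
    have hh' : ℓ γ e = ℓ δ e' := hh
    have h1 : e = e' := hθ (by rw [← h.src_eq γ e, hh', h.src_eq])
    subst h1
    exact Prod.ext (hℓ _ _ _ hh') rfl
  localDiffeo_arr := h.isLocalDiffeomorph hK
  range_arr := by
    ext g
    constructor
    · rintro ⟨⟨γ, e⟩, rfl⟩
      change K.src (ℓ γ e) ∈ U ∧ K.tgt (ℓ γ e) ∈ U
      rw [h.src_eq, h.tgt_eq, ← hU]
      exact ⟨mem_range_self _, mem_range_self _⟩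
    · rintro ⟨h1, h2⟩
      obtain ⟨γ, e, rfl⟩ := hsurj g h1 h2
      exact ⟨(γ, e), rfl⟩

end ActionHom

/-- Local sections of the source map near `x`, one through each element of the isotropy group of
`x`, which describe all arrows between points of `U`. -/
structure IsLocalSections (K : LieGroupoid.{u, v} I₀ I₁) (x : K.Ob)
    (U : TopologicalSpace.Opens K.Ob) (s : K.Isotropy x → K.Ob → K.Arr) : Prop where
  mem : x ∈ U
  continuousOn : ∀ γ, ContinuousOn (s γ) U
  src_eq : ∀ γ, ∀ w ∈ U, K.src (s γ w) = w
  tgt_mem : ∀ γ, ∀ w ∈ U, K.tgt (s γ w) ∈ U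
  base : ∀ γ, s γ x = γ.1
  map_one : ∀ w ∈ U, s 1 w = K.unit w
  map_mul : ∀ γ δ, ∀ w ∈ U, s (γ * δ) w = K.mul (s γ (K.tgt (s δ w))) (s δ w)
  injective : ∀ γ δ, ∀ w ∈ U, s γ w = s δ w → γ = δ
  surjective : ∀ g, K.src g ∈ U → K.tgt g ∈ U → ∃ γ, g = s γ (K.src g)

namespace IsLocalSections

variable {x : K.Ob} {U : TopologicalSpace.Opens K.Ob} {s : K.Isotropy x → K.Ob → K.Arr}

theorem restrict (h : K.IsLocalSections x U s) {U' : TopologicalSpace.Opens K.Ob} (hx : x ∈ U')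
    (hU' : U' ≤ U) (hinv : ∀ γ, ∀ w ∈ U', K.tgt (s γ w) ∈ U') : K.IsLocalSections x U' s where
  mem := hx
  continuousOn γ := (h.continuousOn γ).mono hU'
  src_eq γ w hw := h.src_eq γ w (hU' hw)
  tgt_mem := hinv
  base := h.base
  map_one w hw := h.map_one w (hU' hw)
  map_mul γ δ w hw := h.map_mul γ δ w (hU' hw)
  injective γ δ w hw := h.injective γ δ w (hU' hw)
  surjective g h1 h2 := h.surjective g (hU' h1) (hU' h2)

theorem tgt_mul (h : K.IsLocalSections x U s) (γ δ : K.Isotropy x) {w : K.Ob} (hw : w ∈ U) :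
    K.tgt (s (γ * δ) w) = K.tgt (s γ (K.tgt (s δ w))) := by
  rw [h.map_mul γ δ w hw, K.tgt_mul]
  rw [h.src_eq γ _ (h.tgt_mem δ w hw)]

theorem tgt_one (h : K.IsLocalSections x U s) {w : K.Ob} (hw : w ∈ U) : K.tgt (s 1 w) = w := by
  rw [h.map_one w hw, K.tgt_unit]

/-- The action of the isotropy group given by the targets of the local sections. -/
@[reducible]
def mulAction (h : K.IsLocalSections x U s) : MulAction (K.Isotropy x) U where
  smul γ w := ⟨K.tgt (s γ w), h.tgt_mem γ w w.2⟩
  one_smul w := Subtype.ext (h.tgt_one w.2)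
  mul_smul γ δ w := Subtype.ext (h.tgt_mul γ δ w.2)

theorem continuous_arrows (h : K.IsLocalSections x U s) :
    Continuous fun p : K.Isotropy x × U => s p.1 p.2 :=
  continuous_prod_of_discrete_left.2 fun γ =>
    continuousOn_iff_continuous_domRestrict.1 (h.continuousOn γ)

theorem contMDiffSMul (h : K.IsLocalSections x U s) (hK : K.IsEtale) :
    letI := h.mulAction
    ContMDiffSMul (𝓡 0) I₀ ∞ (K.Isotropy x) U := by
  let _ := h.mulAction
  have h1 : ContMDiff ((𝓡 0).prod I₀) I₁ ∞ fun p : K.Isotropy x × U => s p.1 p.2 := by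
    refine ContMDiff.of_localDiffeo_comp (Ψ := K.src) ?_ hK.1 h.continuous_arrows
    refine ((isLocalDiffeomorph_subtype_val U).contMDiff.comp
      (contMDiff_snd (M := K.Isotropy x) (I := 𝓡 0))).congr fun p => ?_
    exact h.src_eq p.1 p.2 p.2.2
  have h2 : ContMDiff ((𝓡 0).prod I₀) I₀ ∞ fun p : K.Isotropy x × U => K.tgt (s p.1 p.2) :=
    K.smooth_tgt.comp h1
  refine ⟨ContMDiff.of_localDiffeo_comp (Ψ := Subtype.val) h2 (isLocalDiffeomorph_subtype_val U) ?_⟩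
  exact h2.continuous.subtype_mk fun p : K.Isotropy x × U => h.tgt_mem p.1 p.2 p.2.2

theorem isArrowSystem (h : K.IsLocalSections x U s) :
    letI := h.mulAction
    K.IsArrowSystem (Subtype.val : U → K.Ob) (fun γ w => s γ w) := by
  let _ := h.mulAction
  exact
    { smooth := isLocalDiffeomorph_subtype_val U
      continuous := fun γ => continuousOn_iff_continuous_domRestrict.1 (h.continuousOn γ)
      src_eq := fun γ w => h.src_eq γ w w.2
      tgt_eq := fun γ w => rfl
      map_one := fun w => h.map_one w w.2
      map_mul := fun γ δ w => h.map_mul γ δ w w.2 }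

/-- The chart given by local sections. -/
def localChart (h : K.IsLocalSections x U s) (hK : K.IsEtale) :
    letI := h.mulAction
    haveI := h.contMDiffSMul hK
    K.LocalChart x U :=
  letI := h.mulAction
  haveI := h.contMDiffSMul hK
  { mem := h.mem
    hom := h.isArrowSystem.hom hK
    iso := h.isArrowSystem.isIsoOntoRestriction hK Subtype.val_injective Subtype.range_val
      (fun γ δ w => h.injective γ δ w w.2) fun g h1 h2 => by
        obtain ⟨γ, hγ⟩ := h.surjective g h1 h2
        exact ⟨γ, ⟨K.src g, h1⟩, hγ.symm⟩
    hom_ob := fun _ => rfl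
    hom_arr := h.base }

end IsLocalSections

/-- The isotropy arrows are compact by properness, and discrete because the locally injective map
`src` collapses them to one point. -/
theorem IsOrbifoldGroupoid.finite_isotropy (hK : K.IsOrbifoldGroupoid) (x : K.Ob) :
    Finite (K.Isotropy x) := by
  have := hK.t2_ob
  have hc : IsCompact {g : K.Arr | K.src g = x ∧ K.tgt g = x} := by
    have := hK.proper.isCompact_preimage (isCompact_singleton (x := (x, x)))
    convert this using 1
    ext g
    simp
  have hd : IsDiscrete {g : K.Arr | K.src g = x ∧ K.tgt g = x} := by
    refine (hK.etale.1.isLocalHomeomorph.isLocalHomeomorphOn.mono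
      (subset_univ _)).isDiscrete_of_image ?_
    refine Set.Subsingleton.isDiscrete ?_
    rintro _ ⟨g, hg, rfl⟩ _ ⟨g', hg', rfl⟩
    exact hg.1.trans hg'.1.symm
  exact (hc.finite hd).to_subtype

/-- Near a point `x`, the arrows of a proper étale groupoid are given by local sections through
the isotropy group of `x`. -/
theorem IsOrbifoldGroupoid.exists_localSections (hK : K.IsOrbifoldGroupoid) (x : K.Ob)
    {W : Set K.Ob} (hW : W ∈ 𝓝 x) :
    ∃ (U : TopologicalSpace.Opens K.Ob) (s : K.Isotropy x → K.Ob → K.Arr),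
      (U : Set K.Ob) ⊆ W ∧ K.IsLocalSections x U s := by
  have := hK.t2_ob
  have := hK.t2_arr
  have := hK.finite_isotropy x
  have hsrc := hK.etale.1.isLocalHomeomorph
  have htgt : Continuous K.tgt := K.smooth_tgt.continuous
  let e := fun γ : K.Isotropy x => hsrc.localInverseAt γ.1
  have hxs : ∀ γ, x ∈ (e γ).source := fun γ => by
    have := hsrc.apply_self_mem_localInverseAt_source (x := γ.1)
    rwa [γ.2.1] at this
  have hex : ∀ γ, e γ x = γ.1 := fun γ => by
    have := hsrc.localInverseAt_apply_self (x := γ.1)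
    rwa [γ.2.1] at this
  have hes : ∀ γ, ∀ w ∈ (e γ).source, K.src (e γ w) = w := fun γ w hw =>
    hsrc.apply_localInverseAt_of_mem hw
  have hec : ∀ γ, ContinuousAt (e γ) x := fun γ => (e γ).continuousAt (hxs γ)
  have hetgt : ∀ γ, Tendsto (fun w => K.tgt (e γ w)) (𝓝 x) (𝓝 x) := fun γ => by
    have := (htgt.tendsto (e γ x)).comp (hec γ)
    rwa [hex, γ.2.2] at this
  -- uniqueness of germs of sections
  have hunique : ∀ (γ : K.Isotropy x) (c : K.Ob → K.Arr), Tendsto c (𝓝 x) (𝓝 γ.1) →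
      (∀ᶠ w in 𝓝 x, K.src (c w) = w) → ∀ᶠ w in 𝓝 x, e γ w = c w := by
    intro γ c hc hcs
    have h1 : ∀ᶠ w in 𝓝 x, c w ∈ (e γ).target := hc.eventually_mem
      ((e γ).open_target.mem_nhds hsrc.self_mem_localInverseAt_target)
    filter_upwards [h1, hcs, (e γ).open_source.mem_nhds (hxs γ)] with w h2 h3 h4
    exact hsrc.injOn_localInverseAt_target ((e γ).map_source h4) h2 ((hes γ w h4).trans h3.symm)
  have ha : ∀ᶠ w in 𝓝 x, ∀ γ, w ∈ (e γ).source :=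
    eventually_all.2 fun γ => (e γ).open_source.mem_nhds (hxs γ)
  have hb : ∀ᶠ w in 𝓝 x, ∀ γ δ, e γ w = e δ w → γ = δ := by
    refine eventually_all.2 fun γ => eventually_all.2 fun δ => ?_
    by_cases h : γ = δ
    · exact Eventually.of_forall fun _ _ => h
    · have h1 : (e γ x, e δ x) ∉ diagonal K.Arr := by
        rw [hex, hex]
        exact fun h2 => h (Subtype.ext h2)
      filter_upwards [((hec γ).prodMk_nhds (hec δ)).eventually_mem
        (isClosed_diagonal.isOpen_compl.mem_nhds h1)] with w hw h2
      exact absurd h2 hw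
  -- Both sides are germs of continuous sections of `src` through the arrow `γ * δ`, so they
  -- coincide near `x`.
  have hc : ∀ᶠ w in 𝓝 x, ∀ γ δ, e (γ * δ) w = K.mul (e γ (K.tgt (e δ w))) (e δ w) := by
    refine eventually_all.2 fun γ => eventually_all.2 fun δ => ?_
    have h1 : ∀ᶠ w in 𝓝 x, w ∈ (e δ).source ∧ K.tgt (e δ w) ∈ (e γ).source :=
      ((e δ).open_source.eventually_mem (hxs δ)).and
        ((hetgt δ).eventually_mem ((e γ).open_source.mem_nhds (hxs γ)))
    have h2 : ∀ᶠ w in 𝓝 x, (e γ (K.tgt (e δ w)), e δ w) ∈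
        {p : K.Arr × K.Arr | K.src p.1 = K.tgt p.2} := h1.mono fun w hw => hes γ _ hw.2
    refine hunique (γ * δ) _ ?_ ?_
    · have h3 : Tendsto (fun w => (e γ (K.tgt (e δ w)), e δ w)) (𝓝 x) (𝓝 (γ.1, δ.1)) := by
        refine Tendsto.prodMk_nhds ?_ ?_
        · have := (hec γ).tendsto.comp (hetgt δ)
          rwa [hex] at this
        · have := (hec δ).tendsto
          rwa [hex] at this
      have h4 := (K.smooth_mul.continuousOn (γ.1, δ.1) (γ.2.1.trans δ.2.2.symm)).tendsto
      exact h4.comp (tendsto_nhdsWithin_iff.2 ⟨h3, h2⟩)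
    · filter_upwards [h1, h2] with w h3 h4
      rw [K.src_mul _ _ h4, hes δ w h3.1]
  have hd : ∀ᶠ w in 𝓝 x, e 1 w = K.unit w :=
    hunique 1 K.unit K.smooth_unit.continuous.continuousAt (Eventually.of_forall K.src_unit)
  -- The sections fill a neighborhood `B` of the isotropy arrows. By properness the arrows outside
  -- `B` have closed image under `(src, tgt)`, and this image misses `(x, x)`.
  obtain ⟨D₁, hD₁, hD₁sub⟩ : ∃ D ∈ 𝓝 x, ∀ g, K.src g ∈ D → K.tgt g ∈ D →
      ∃ γ, g = e γ (K.src g) := by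
    let B : Set K.Arr := ⋃ γ, (e γ).target
    have hB : IsOpen B := isOpen_iUnion fun γ => (e γ).open_target
    have h1 : IsClosed ((fun g => (K.src g, K.tgt g)) '' Bᶜ) :=
      hK.proper.isClosedMap _ hB.isClosed_compl
    have h2 : (x, x) ∉ (fun g => (K.src g, K.tgt g)) '' Bᶜ := by
      rintro ⟨g, hg, h⟩
      rw [Prod.mk.injEq] at h
      exact hg (mem_iUnion.2 ⟨⟨g, h⟩, hsrc.self_mem_localInverseAt_target⟩)
    have h3 := h1.isOpen_compl.mem_nhds h2
    rw [nhds_prod_eq] at h3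
    obtain ⟨D, hD, hDsub⟩ := mem_prod_same_iff.1 h3
    refine ⟨D, hD, fun g hg hg' => ?_⟩
    have h4 : g ∈ B := by
      by_contra h
      exact hDsub (mk_mem_prod hg hg') ⟨g, h, rfl⟩
    obtain ⟨γ, hγ⟩ := mem_iUnion.1 h4
    refine ⟨γ, ?_⟩
    have h5 := (e γ).right_inv hγ
    have h6 : (e γ).symm = K.src := hsrc.localInverseAt_symm γ.1
    rw [h6] at h5
    exact h5.symm
  obtain ⟨D, hDprop, hDo, hxD⟩ := eventually_nhds_iff.1
    (ha.and (hb.and (hc.and (hd.and ((show ∀ᶠ w in 𝓝 x, w ∈ D₁ from hD₁).and hW)))))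
  -- Intersecting the finitely many preimages of `D` under the sections makes the neighborhood
  -- invariant; multiplicativity of the sections on `D` is what shows it.
  have hUopen : IsOpen (⋂ γ, (D ∩ (fun w => K.tgt (e γ w)) ⁻¹' D)) := by
    refine isOpen_iInter_of_finite fun γ => ?_
    refine ContinuousOn.isOpen_inter_preimage ?_ hDo hDo
    exact htgt.comp_continuousOn ((e γ).continuousOn.mono fun w hw => (hDprop w hw).1 γ)
  have hUD : ∀ w ∈ (⋂ γ, (D ∩ (fun w => K.tgt (e γ w)) ⁻¹' D)), w ∈ D := fun w hw =>
    (mem_iInter.1 hw 1).1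
  refine ⟨⟨_, hUopen⟩, fun γ => e γ, fun w hw => (hDprop w (hUD w hw)).2.2.2.2.2, ?_⟩
  have hmul : ∀ γ δ, ∀ w ∈ (⋂ γ, (D ∩ (fun w => K.tgt (e γ w)) ⁻¹' D)),
      e (γ * δ) w = K.mul (e γ (K.tgt (e δ w))) (e δ w) := fun γ δ w hw =>
    (hDprop w (hUD w hw)).2.2.1 γ δ
  exact
    { mem := by
        refine mem_iInter.2 fun γ => ⟨hxD, ?_⟩
        rw [mem_preimage, hex, γ.2.2]
        exact hxD
      continuousOn := fun γ => (e γ).continuousOn.mono fun w hw => (hDprop w (hUD w hw)).1 γ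
      src_eq := fun γ w hw => hes γ w ((hDprop w (hUD w hw)).1 γ)
      tgt_mem := by
        intro δ w hw
        have h1 := (mem_iInter.1 hw δ).2
        refine mem_iInter.2 fun γ => ⟨h1, ?_⟩
        have h2 : K.tgt (e γ (K.tgt (e δ w))) = K.tgt (e (γ * δ) w) := by
          rw [hmul γ δ w hw, K.tgt_mul]
          exact hes γ _ ((hDprop _ h1).1 γ)
        rw [mem_preimage, h2]
        exact (mem_iInter.1 hw (γ * δ)).2
      base := hex
      map_one := fun w hw => (hDprop w (hUD w hw)).2.2.2.1
      map_mul := hmul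
      injective := fun γ δ w hw => (hDprop w (hUD w hw)).2.1 γ δ
      surjective := fun g h1 h2 => hD₁sub g (hDprop _ (hUD _ h1)).2.2.2.2.1
        (hDprop _ (hUD _ h2)).2.2.2.2.1 }

end LieGroupoid

end EtaleGroupoids

/-! ### Lifted sections, slices and the local model. -/

noncomputable section LocalModels

namespace LieGroupoid

variable
  {E₀ : Type*} [NormedAddCommGroup E₀] [NormedSpace ℝ E₀] {X₀ : Type*} [TopologicalSpace X₀]
  {E₁ : Type*} [NormedAddCommGroup E₁] [NormedSpace ℝ E₁] {X₁ : Type*} [TopologicalSpace X₁]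
  {I₀ : ModelWithCorners ℝ E₀ X₀} {I₁ : ModelWithCorners ℝ E₁ X₁}
  {E₀' : Type*} [NormedAddCommGroup E₀'] [NormedSpace ℝ E₀'] {X₀' : Type*} [TopologicalSpace X₀']
  {E₁' : Type*} [NormedAddCommGroup E₁'] [NormedSpace ℝ E₁'] {X₁' : Type*} [TopologicalSpace X₁']
  {I₀' : ModelWithCorners ℝ E₀' X₀'} {I₁' : ModelWithCorners ℝ E₁' X₁'}
  {H : LieGroupoid.{u, v} I₀ I₁} {K : LieGroupoid.{u', v'} I₀' I₁'}

namespace Hom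

/-- Arrows are determined by their source and their image, also topologically. -/
def IsUniquelyLifting (φ : Hom H K) : Prop :=
  IsEmbedding fun h : H.Arr => (H.src h, φ.arr h)

theorem IsUniquelyLifting.eq {φ : Hom H K} (he : φ.IsUniquelyLifting) {g h : H.Arr}
    (h1 : H.src g = H.src h) (h2 : φ.arr g = φ.arr h) : g = h :=
  he.injective (Prod.ext h1 h2)

theorem IsUniquelyLifting.isotropyMap_injective {φ : Hom H K} (he : φ.IsUniquelyLifting)
    {x : K.Ob} {y : H.Ob} (hy : φ.ob y = x) : Function.Injective (φ.isotropyMap hy) := fun g h e =>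
  Subtype.ext (he.eq (g.2.1.trans h.2.1.symm) (congrArg Subtype.val e))

/-- Lifts through `φ` of local sections of the source map. -/
structure IsLiftOfSections (φ : Hom H K) {x : K.Ob} (U : TopologicalSpace.Opens K.Ob)
    (s : K.Isotropy x → K.Ob → K.Arr) (ℓ : K.Isotropy x → H.Ob → H.Arr) : Prop where
  sections : K.IsLocalSections x U s
  unique : φ.IsUniquelyLifting
  src_eq : ∀ γ z, φ.ob z ∈ U → H.src (ℓ γ z) = z
  arr_eq : ∀ γ z, φ.ob z ∈ U → φ.arr (ℓ γ z) = s γ (φ.ob z)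

namespace IsLiftOfSections

variable {φ : Hom H K} {x : K.Ob} {U : TopologicalSpace.Opens K.Ob}
  {s : K.Isotropy x → K.Ob → K.Arr} {ℓ : K.Isotropy x → H.Ob → H.Arr}

theorem restrict (h : φ.IsLiftOfSections U s ℓ) {U' : TopologicalSpace.Opens K.Ob} (hx : x ∈ U')
    (hU' : U' ≤ U) (hinv : ∀ γ, ∀ w ∈ U', K.tgt (s γ w) ∈ U') : φ.IsLiftOfSections U' s ℓ where
  sections := h.sections.restrict hx hU' hinv
  unique := h.unique
  src_eq γ z hz := h.src_eq γ z (hU' hz)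
  arr_eq γ z hz := h.arr_eq γ z (hU' hz)

theorem ob_tgt (h : φ.IsLiftOfSections U s ℓ) (γ : K.Isotropy x) {z : H.Ob} (hz : φ.ob z ∈ U) :
    φ.ob (H.tgt (ℓ γ z)) = K.tgt (s γ (φ.ob z)) := by
  rw [← φ.tgt_arr, h.arr_eq γ z hz]

theorem ob_tgt_mem (h : φ.IsLiftOfSections U s ℓ) (γ : K.Isotropy x) {z : H.Ob}
    (hz : φ.ob z ∈ U) : φ.ob (H.tgt (ℓ γ z)) ∈ U := by
  rw [h.ob_tgt γ hz]
  exact h.sections.tgt_mem γ _ hz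

/-- The lifts are only chosen pointwise. They are continuous because arrows embed through their
source and image, and these are `z` and `s γ (φ.ob z)`. -/
theorem continuousOn (h : φ.IsLiftOfSections U s ℓ) (γ : K.Isotropy x) :
    ContinuousOn (ℓ γ) (φ.ob ⁻¹' U) := by
  rw [h.unique.isInducing.continuousOn_iff]
  have h1 : ContinuousOn (fun z => (z, s γ (φ.ob z))) (φ.ob ⁻¹' U) :=
    continuousOn_id.prodMk ((h.sections.continuousOn γ).comp φ.smooth_ob.continuous.continuousOn
      fun z hz => hz)
  exact h1.congr fun z hz => Prod.ext (h.src_eq γ z hz) (h.arr_eq γ z hz)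

theorem continuousOn_tgt (h : φ.IsLiftOfSections U s ℓ) (γ : K.Isotropy x) :
    ContinuousOn (fun z => H.tgt (ℓ γ z)) (φ.ob ⁻¹' U) :=
  H.smooth_tgt.continuous.comp_continuousOn (h.continuousOn γ)

theorem map_one (h : φ.IsLiftOfSections U s ℓ) {z : H.Ob} (hz : φ.ob z ∈ U) :
    ℓ 1 z = H.unit z := by
  refine h.unique.eq ?_ ?_
  · rw [h.src_eq 1 z hz, H.src_unit]
  · rw [h.arr_eq 1 z hz, h.sections.map_one _ hz, φ.map_unit]

theorem map_mul (h : φ.IsLiftOfSections U s ℓ) (γ δ : K.Isotropy x) {z : H.Ob}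
    (hz : φ.ob z ∈ U) : ℓ (γ * δ) z = H.mul (ℓ γ (H.tgt (ℓ δ z))) (ℓ δ z) := by
  have h1 : H.src (ℓ γ (H.tgt (ℓ δ z))) = H.tgt (ℓ δ z) := h.src_eq γ _ (h.ob_tgt_mem δ hz)
  refine h.unique.eq ?_ ?_
  · rw [h.src_eq _ z hz, H.src_mul _ _ h1, h.src_eq _ z hz]
  · rw [φ.map_mul _ _ h1, h.arr_eq _ z hz, h.arr_eq _ z hz, h.arr_eq _ _ (h.ob_tgt_mem δ hz),
      h.ob_tgt δ hz, h.sections.map_mul γ δ _ hz]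

theorem tgt_one (h : φ.IsLiftOfSections U s ℓ) {z : H.Ob} (hz : φ.ob z ∈ U) :
    H.tgt (ℓ 1 z) = z := by
  rw [h.map_one hz, H.tgt_unit]

theorem tgt_mul (h : φ.IsLiftOfSections U s ℓ) (γ δ : K.Isotropy x) {z : H.Ob}
    (hz : φ.ob z ∈ U) : H.tgt (ℓ (γ * δ) z) = H.tgt (ℓ γ (H.tgt (ℓ δ z))) := by
  rw [h.map_mul γ δ hz, H.tgt_mul _ _ (h.src_eq γ _ (h.ob_tgt_mem δ hz))]

theorem tgt_inv_tgt (h : φ.IsLiftOfSections U s ℓ) (γ : K.Isotropy x) {z : H.Ob}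
    (hz : φ.ob z ∈ U) : H.tgt (ℓ γ⁻¹ (H.tgt (ℓ γ z))) = z := by
  rw [← h.tgt_mul _ _ hz, inv_mul_cancel, h.tgt_one hz]

theorem injective (h : φ.IsLiftOfSections U s ℓ) {γ δ : K.Isotropy x} {z : H.Ob}
    (hz : φ.ob z ∈ U) (e : ℓ γ z = ℓ δ z) : γ = δ :=
  h.sections.injective γ δ _ hz (by rw [← h.arr_eq γ z hz, e, h.arr_eq δ z hz])

theorem surjective (h : φ.IsLiftOfSections U s ℓ) (g : H.Arr) (h1 : φ.ob (H.src g) ∈ U)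
    (h2 : φ.ob (H.tgt g) ∈ U) : ∃ γ, g = ℓ γ (H.src g) := by
  obtain ⟨γ, hγ⟩ := h.sections.surjective (φ.arr g) (by rwa [φ.src_arr]) (by rwa [φ.tgt_arr])
  refine ⟨γ, h.unique.eq (h.src_eq γ _ h1).symm ?_⟩
  rw [h.arr_eq γ _ h1, hγ, φ.src_arr]

theorem isotropyMap_apply (h : φ.IsLiftOfSections U s ℓ) {y : H.Ob} (hy : φ.ob y = x)
    (g : H.Isotropy y) : ℓ (φ.isotropyMap hy g) y = g.1 := by
  have hyU : φ.ob y ∈ U := by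
    rw [hy]
    exact h.sections.mem
  refine h.unique.eq ((h.src_eq _ y hyU).trans g.2.1.symm) ?_
  rw [h.arr_eq _ y hyU, hy, h.sections.base]
  rfl

/-- With `isotropyMap_apply` this identifies the isotropy group of `y` with the stabilizer of `y` in
the lifted action: the required isotropy arrow is the lift `ℓ γ y` itself. -/
theorem exists_isotropyMap_eq (h : φ.IsLiftOfSections U s ℓ) {y : H.Ob} (hy : φ.ob y = x)
    {γ : K.Isotropy x} (e : H.tgt (ℓ γ y) = y) : ∃ g, φ.isotropyMap hy g = γ := by
  have hyU : φ.ob y ∈ U := by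
    rw [hy]
    exact h.sections.mem
  refine ⟨⟨ℓ γ y, h.src_eq _ y hyU, e⟩, Subtype.ext ?_⟩
  change φ.arr (ℓ γ y) = γ.1
  rw [h.arr_eq _ y hyU, hy, h.sections.base]

end IsLiftOfSections

/-- A neighborhood of `y` which is a slice for the lifted action of `K.Isotropy x` on the preimage
of `U`. -/
structure IsLiftSlice (φ : Hom H K) {x : K.Ob} {y : H.Ob} (hy : φ.ob y = x)
    (U : TopologicalSpace.Opens K.Ob) (ℓ : K.Isotropy x → H.Ob → H.Arr)
    (V : TopologicalSpace.Opens H.Ob) : Prop where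
  mem : y ∈ V
  ob_mem : ∀ z ∈ V, φ.ob z ∈ U
  tgt_mem : ∀ g, ∀ z ∈ V, H.tgt (ℓ (φ.isotropyMap hy g) z) ∈ V
  exists_isotropy : ∀ γ, ∀ z ∈ V, H.tgt (ℓ γ z) ∈ V → ∃ g, φ.isotropyMap hy g = γ
  exists_translate : ∀ z, φ.ob z ∈ U → ∃ γ, ∃ z' ∈ V, H.tgt (ℓ γ z') = z

namespace IsLiftSlice

variable {φ : Hom H K} {x : K.Ob} {y : H.Ob} {hy : φ.ob y = x} {U : TopologicalSpace.Opens K.Ob}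
  {s : K.Isotropy x → K.Ob → K.Arr} {ℓ : K.Isotropy x → H.Ob → H.Arr}
  {V : TopologicalSpace.Opens H.Ob}

theorem isLocalSections (hV : φ.IsLiftSlice hy U ℓ V) (h : φ.IsLiftOfSections U s ℓ) :
    H.IsLocalSections y V fun g => ℓ (φ.isotropyMap hy g) where
  mem := hV.mem
  continuousOn g := (h.continuousOn _).mono hV.ob_mem
  src_eq g z hz := h.src_eq _ z (hV.ob_mem z hz)
  tgt_mem := hV.tgt_mem
  base := h.isotropyMap_apply hy
  map_one z hz := by rw [_root_.map_one]; exact h.map_one (hV.ob_mem z hz)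
  map_mul g g' z hz := by rw [_root_.map_mul]; exact h.map_mul _ _ (hV.ob_mem z hz)
  injective g g' z hz e := h.unique.isotropyMap_injective hy (h.injective (hV.ob_mem z hz) e)
  surjective g h1 h2 := by
    obtain ⟨γ, hγ⟩ := h.surjective g (hV.ob_mem _ h1) (hV.ob_mem _ h2)
    obtain ⟨g', rfl⟩ := hV.exists_isotropy γ _ h1 (by rwa [← hγ])
    exact ⟨g', hγ⟩

/-- The translates of the slice. -/
def translate (hV : φ.IsLiftSlice hy U ℓ V) (h : φ.IsLiftOfSections U s ℓ) :
    letI := (hV.isLocalSections h).mulAction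
    BalancedProduct (φ.isotropyMap hy) V → H.Ob :=
  letI := (hV.isLocalSections h).mulAction
  Quotient.lift (fun p : K.Isotropy x × V => H.tgt (ℓ p.1 p.2)) (by
    rintro ⟨γ, z⟩ _ ⟨g, rfl⟩
    change H.tgt (ℓ γ z) = H.tgt (ℓ (γ * (φ.isotropyMap hy g)⁻¹) (H.tgt (ℓ (φ.isotropyMap hy g) z)))
    rw [← h.tgt_mul _ _ (hV.ob_mem z z.2), inv_mul_cancel_right])

section

variable (hV : φ.IsLiftSlice hy U ℓ V) (h : φ.IsLiftOfSections U s ℓ)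

theorem ob_translate_mem :
    letI := (hV.isLocalSections h).mulAction
    ∀ e, φ.ob (hV.translate h e) ∈ U := by
  rintro ⟨γ, z⟩
  exact h.ob_tgt_mem γ (hV.ob_mem z z.2)

theorem translate_smul :
    letI := (hV.isLocalSections h).mulAction
    ∀ (γ : K.Isotropy x) (e : BalancedProduct (φ.isotropyMap hy) V),
      hV.translate h (γ • e) = H.tgt (ℓ γ (hV.translate h e)) := by
  rintro γ ⟨δ, z⟩
  exact h.tgt_mul γ δ (hV.ob_mem z z.2)

/-- If `γ` applied to `z` equals `δ` applied to `w`, then `δ⁻¹ * γ` carries a point of the slice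
into the slice, so it comes from the isotropy group of `y`. That element relates the two
representatives. -/
theorem translate_injective : Function.Injective (hV.translate h) := by
  let _ := (hV.isLocalSections h).mulAction
  rintro ⟨γ, z⟩ ⟨δ, w⟩ e
  replace e : H.tgt (ℓ γ z) = H.tgt (ℓ δ w) := e
  have h1 : H.tgt (ℓ (δ⁻¹ * γ) z) = w := by
    rw [h.tgt_mul _ _ (hV.ob_mem z z.2), e, h.tgt_inv_tgt _ (hV.ob_mem w w.2)]
  obtain ⟨g, hg⟩ := hV.exists_isotropy (δ⁻¹ * γ) z z.2 (by rw [h1]; exact w.2)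
  refine Quotient.sound ⟨g, Prod.ext ?_ (Subtype.ext ?_)⟩
  · change δ = γ * (φ.isotropyMap hy g)⁻¹
    rw [hg]
    group
  · change (w : H.Ob) = H.tgt (ℓ (φ.isotropyMap hy g) z)
    rw [hg, h1]

theorem range_translate : range (hV.translate h) = φ.ob ⁻¹' U := by
  let _ := (hV.isLocalSections h).mulAction
  ext z
  constructor
  · rintro ⟨e, rfl⟩
    exact hV.ob_translate_mem h e
  · intro hz
    obtain ⟨γ, z', hz', rfl⟩ := hV.exists_translate z hz
    exact ⟨BalancedProduct.mk (φ.isotropyMap hy) V (γ, ⟨z', hz'⟩), rfl⟩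

theorem continuous_mk :
    letI := (hV.isLocalSections h).mulAction
    Continuous (BalancedProduct.mk (φ.isotropyMap hy) V) :=
  continuous_quotient_mk'

/-- The map is `tgt` after the lifted arrows, and these depend étale-locally on `(γ, z)` because
their source is just `z`. -/
theorem isLocalDiffeomorph_translate_mk (hH : H.IsEtale) :
    letI := (hV.isLocalSections h).mulAction
    IsLocalDiffeomorph ((𝓡 0).prod I₀) I₀ ∞
      (hV.translate h ∘ BalancedProduct.mk (φ.isotropyMap hy) V) := by
  let _ := (hV.isLocalSections h).mulAction
  have hc : Continuous fun p : K.Isotropy x × V => ℓ p.1 p.2 :=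
    continuous_prod_of_discrete_left.2 fun γ =>
      continuousOn_iff_continuous_domRestrict.1 ((h.continuousOn γ).mono hV.ob_mem)
  have h1 : IsLocalDiffeomorph ((𝓡 0).prod I₀) I₀ ∞
      (H.src ∘ fun p : K.Isotropy x × V => ℓ p.1 p.2) := by
    have h2 : H.src ∘ (fun p : K.Isotropy x × V => ℓ p.1 p.2) = Subtype.val ∘ Prod.snd := by
      ext p
      exact h.src_eq p.1 p.2 (hV.ob_mem _ p.2.2)
    rw [h2]
    exact (isLocalDiffeomorph_subtype_val V).comp isLocalDiffeomorph_snd_of_discrete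
  exact IsLocalDiffeomorph.comp (Ψ := H.tgt) hH.2 (h1.of_comp_left hH.1 hc)

theorem isOpenEmbedding_translate (hH : H.IsEtale) :
    letI := (hV.isLocalSections h).mulAction
    IsOpenEmbedding (hV.translate h) := by
  let _ := (hV.isLocalSections h).mulAction
  have h1 := hV.isLocalDiffeomorph_translate_mk h hH
  refine IsOpenEmbedding.of_continuous_injective_isOpenMap
    (continuous_quot_lift _ h1.contMDiff.continuous) (hV.translate_injective h) fun O hO => ?_
  have h2 : hV.translate h '' O = (hV.translate h ∘ BalancedProduct.mk (φ.isotropyMap hy) V) ''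
      (BalancedProduct.mk (φ.isotropyMap hy) V ⁻¹' O) := by
    rw [image_comp, image_preimage_eq]
    exact Quotient.mk_surjective
  rw [h2]
  exact h1.isLocalHomeomorph.isOpenMap _ (hO.preimage (hV.continuous_mk h))

/-- The translates of the slice form the local model. -/
theorem nonempty_localModel [IsManifold I₀ ∞ H.Ob] (hH : H.IsEtale) (hK : K.IsEtale) :
    letI := (hV.isLocalSections h).mulAction
    letI := h.sections.mulAction
    haveI := h.sections.contMDiffSMul hK
    Nonempty (LocalModel φ hy (h.sections.localChart hK) V) := by
  let _ := (hV.isLocalSections h).mulAction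
  let _ := h.sections.mulAction
  have _ := h.sections.contMDiffSMul hK
  have hopen := hV.isOpenEmbedding_translate h hH
  have hloc : IsLocalHomeomorph (hV.translate h) := hopen.isLocalHomeomorph
  -- The balanced product receives the charts of its open image in the objects of `H`; the
  -- projection from the product is étale for this structure.
  let _ : ChartedSpace X₀ (BalancedProduct (φ.isotropyMap hy) V) := hloc.pullbackChartedSpace
  have _ : IsManifold I₀ ∞ (BalancedProduct (φ.isotropyMap hy) V) := hloc.pullback_isManifold I₀
  have hdiff : IsLocalDiffeomorph I₀ I₀ ∞ (hV.translate h) := hloc.pullback_isLocalDiffeomorph I₀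
  have hmk : IsLocalDiffeomorph ((𝓡 0).prod I₀) I₀ ∞
      (BalancedProduct.mk (φ.isotropyMap hy) V) :=
    (hV.isLocalDiffeomorph_translate_mk h hH).of_comp_left hdiff (hV.continuous_mk h)
  have hcont : ∀ γ, Continuous fun e => ℓ γ (hV.translate h e) := fun γ =>
    (h.continuousOn γ).comp_continuous hopen.continuous (hV.ob_translate_mem h)
  have hcont' : Continuous fun p : K.Isotropy x × BalancedProduct (φ.isotropyMap hy) V =>
      ℓ p.1 (hV.translate h p.2) := continuous_prod_of_discrete_left.2 hcont
  have hsm : ContMDiff ((𝓡 0).prod I₀) I₀ ∞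
      fun p : K.Isotropy x × BalancedProduct (φ.isotropyMap hy) V =>
        H.tgt (ℓ p.1 (hV.translate h p.2)) := by
    refine H.smooth_tgt.comp (ContMDiff.of_localDiffeo_comp (Ψ := H.src) ?_ hH.1 hcont')
    refine (hdiff.contMDiff.comp (contMDiff_snd (M := K.Isotropy x) (I := 𝓡 0))).congr fun p => ?_
    exact h.src_eq p.1 _ (hV.ob_translate_mem h p.2)
  have hsmul : ContMDiff ((𝓡 0).prod I₀) I₀ ∞
      (hV.translate h ∘ fun p : K.Isotropy x × BalancedProduct (φ.isotropyMap hy) V =>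
        p.1 • p.2) :=
    hsm.congr fun p => hV.translate_smul h p.1 p.2
  have _ : ContMDiffSMul (𝓡 0) I₀ ∞ (K.Isotropy x) (BalancedProduct (φ.isotropyMap hy) V) :=
    ⟨hsmul.of_localDiffeo_comp hdiff (hopen.isInducing.continuous_iff.2 hsmul.continuous)⟩
  have hsys : H.IsArrowSystem (hV.translate h) fun γ e => ℓ γ (hV.translate h e) :=
    { smooth := hdiff
      continuous := hcont
      src_eq := fun γ e => h.src_eq γ _ (hV.ob_translate_mem h e)
      tgt_eq := fun γ e => (hV.translate_smul h γ e).symm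
      map_one := fun e => h.map_one (hV.ob_translate_mem h e)
      map_mul := fun γ δ e => by
        rw [hV.translate_smul h]
        exact h.map_mul γ δ (hV.ob_translate_mem h e) }
  exact ⟨{
    localDiffeo_mk := hmk
    hom := hsys.hom hH
    iso := hsys.isIsoOntoRestriction hH (hV.translate_injective h) (hV.range_translate h)
      (fun γ δ e => h.injective (hV.ob_translate_mem h e)) fun g h1 h2 => by
        obtain ⟨γ, hγ⟩ := h.surjective g h1 h2
        have h3 : H.src g ∈ range (hV.translate h) := by
          rw [hV.range_translate h]
          exact h1
        obtain ⟨e, he⟩ := h3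
        exact ⟨γ, e, by rw [he, ← hγ]⟩
    hom_mk_one := fun z => h.tgt_one (hV.ob_mem z z.2)
    map_hom := fun γ e w hw => by
      change φ.arr (ℓ γ (hV.translate h e)) = s γ w
      rw [h.arr_eq γ _ (hV.ob_translate_mem h e)]
      exact congrArg (s γ) hw }⟩

end

end IsLiftSlice

/-- Slice theorem for a finite group acting on the preimage of `U`. The fiber over `x` is a single
orbit by `htrans`; closedness of `φ.ob` upgrades "the translates of the slice cover the fiber" to
"they cover the preimage of a neighborhood". -/
theorem IsLiftOfSections.exists_slices {φ : Hom H K} {x : K.Ob} {U : TopologicalSpace.Opens K.Ob}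
    {s : K.Isotropy x → K.Ob → K.Arr} {ℓ : K.Isotropy x → H.Ob → H.Arr}
    (h : φ.IsLiftOfSections U s ℓ) [T2Space H.Ob] [Finite (K.Isotropy x)]
    (hclosed : IsClosedMap φ.ob)
    (htrans : ∀ y y', φ.ob y = φ.ob y' → ∃ g, H.src g = y ∧ H.tgt g = y') :
    ∃ U' ≤ U, x ∈ U' ∧ (∀ γ, ∀ w ∈ U', K.tgt (s γ w) ∈ U') ∧
      ∀ (y : H.Ob) (hy : φ.ob y = x), ∃ V, φ.IsLiftSlice hy U' ℓ V := by
  have hUo : IsOpen (φ.ob ⁻¹' U) := U.isOpen.preimage φ.smooth_ob.continuous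
  have hFU : ∀ y, φ.ob y = x → φ.ob y ∈ U := by
    rintro y rfl
    exact h.sections.mem
  have hmove : ∀ y y', φ.ob y = x → φ.ob y' = x → ∃ γ, H.tgt (ℓ γ y) = y' := by
    intro y y' hy hy'
    obtain ⟨g, rfl, rfl⟩ := htrans y y' (hy.trans hy'.symm)
    obtain ⟨γ, hγ⟩ := h.surjective g (hFU _ hy) (hFU _ hy')
    exact ⟨γ, by rw [← hγ]⟩
  have hfin : (φ.ob ⁻¹' {x}).Finite := by
    rcases (φ.ob ⁻¹' {x}).eq_empty_or_nonempty with he | ⟨y, hy⟩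
    · rw [he]
      exact finite_empty
    · refine (finite_range fun γ => H.tgt (ℓ γ y)).subset fun y' hy' => ?_
      exact hmove y y' hy hy'
  have hslice : ∀ (y : H.Ob) (hy : φ.ob y = x), ∃ V : Set H.Ob, IsOpen V ∧ y ∈ V ∧
      V ⊆ φ.ob ⁻¹' U ∧ (∀ g, ∀ z ∈ V, H.tgt (ℓ (φ.isotropyMap hy g) z) ∈ V) ∧
      ∀ γ, ∀ z ∈ V, H.tgt (ℓ γ z) ∈ V → ∃ g, φ.isotropyMap hy g = γ := by
    intro y hy
    have : Finite (H.Isotropy y) := Finite.of_injective _ (h.unique.isotropyMap_injective hy)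
    -- An element not coming from the isotropy of `y` moves `y` to a different point, and the
    -- Hausdorff property keeps points near `y` from being moved to points near `y`.
    have h1 : ∀ᶠ p in 𝓝 y ×ˢ 𝓝 y, ∀ γ, H.tgt (ℓ γ p.1) = p.2 → ∃ g, φ.isotropyMap hy g = γ := by
      refine eventually_all.2 fun γ => ?_
      by_cases hγ : ∃ g, φ.isotropyMap hy g = γ
      · exact Eventually.of_forall fun _ _ => hγ
      · have h2 : (H.tgt (ℓ γ y), y) ∉ diagonal H.Ob := fun e => hγ (h.exists_isotropyMap_eq hy e)
        have h3 : ContinuousAt (fun z => H.tgt (ℓ γ z)) y :=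
          (h.continuousOn_tgt γ).continuousAt (hUo.mem_nhds (hFU y hy))
        have h4 : Tendsto (fun p : H.Ob × H.Ob => (H.tgt (ℓ γ p.1), p.2)) (𝓝 y ×ˢ 𝓝 y)
            (𝓝 (H.tgt (ℓ γ y), y)) :=
          (h3.tendsto.comp tendsto_fst).prodMk_nhds tendsto_snd
        filter_upwards [h4.eventually_mem (isClosed_diagonal.isOpen_compl.mem_nhds h2)] with p hp e
        exact absurd e hp
    obtain ⟨B, hB, hBsub⟩ := mem_prod_same_iff.1 h1
    obtain ⟨V₀, hV₀B, hV₀, hyV₀⟩ := mem_nhds_iff.1 hB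
    have hV₀sep : ∀ γ, ∀ z ∈ V₀, H.tgt (ℓ γ z) ∈ V₀ → ∃ g, φ.isotropyMap hy g = γ :=
      fun γ z hz hz' => hBsub (mk_mem_prod (hV₀B hz) (hV₀B hz')) γ rfl
    -- A finite intersection makes the slice invariant under the isotropy group of `y`.
    let V : Set H.Ob := ⋂ g : H.Isotropy y,
      φ.ob ⁻¹' U ∩ (fun z => H.tgt (ℓ (φ.isotropyMap hy g) z)) ⁻¹' V₀
    have hVU : V ⊆ φ.ob ⁻¹' U := fun z hz => (mem_iInter.1 hz 1).1
    have hVV₀ : V ⊆ V₀ := fun z hz => by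
      have := (mem_iInter.1 hz 1).2
      rwa [mem_preimage, _root_.map_one, h.tgt_one (hVU hz)] at this
    refine ⟨V, isOpen_iInter_of_finite fun g =>
      (h.continuousOn_tgt _).isOpen_inter_preimage hUo hV₀,
      mem_iInter.2 fun g => ⟨hFU y hy, ?_⟩, hVU, fun g z hz => mem_iInter.2 fun g' => ⟨?_, ?_⟩,
      fun γ z hz hz' => hV₀sep γ z (hVV₀ hz) (hVV₀ hz')⟩
    · rw [mem_preimage, h.isotropyMap_apply hy, g.2.2]
      exact hyV₀
    · exact h.ob_tgt_mem _ (hVU hz)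
    · have := (mem_iInter.1 hz (g' * g)).2
      rwa [mem_preimage, _root_.map_mul, h.tgt_mul _ _ (hVU hz)] at this
  choose! V hVo hyV hVU hVinv hVsep using hslice
  have hnear : ∀ᶠ w in 𝓝 x, ∀ y ∈ φ.ob ⁻¹' {x}, ∀ z, φ.ob z = w → φ.ob z ∈ U →
      ∃ γ, H.tgt (ℓ γ z) ∈ V y := by
    refine (eventually_all_finite hfin).2 fun y hy => ?_
    let O : Set H.Ob := ⋃ γ, φ.ob ⁻¹' U ∩ (fun z => H.tgt (ℓ γ z)) ⁻¹' V y
    have hO : IsOpen O := isOpen_iUnion fun γ =>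
      (h.continuousOn_tgt γ).isOpen_inter_preimage hUo (hVo y hy)
    -- Transitivity puts the whole fiber over `x` in the open set `O`, so the closed image of its
    -- complement avoids a neighborhood of `x`.
    have hx : x ∉ φ.ob '' Oᶜ := by
      rintro ⟨y', hy', e⟩
      obtain ⟨γ, hγ⟩ := hmove y' y e hy
      refine hy' (mem_iUnion.2 ⟨γ, hFU y' e, ?_⟩)
      rw [mem_preimage, hγ]
      exact hyV y hy
    filter_upwards [(hclosed _ hO.isClosed_compl).isOpen_compl.mem_nhds hx] with w hw z hz _
    have hzO : z ∈ O := by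
      by_contra hzO
      exact hw ⟨z, hzO, hz⟩
    obtain ⟨γ, hγ⟩ := mem_iUnion.1 hzO
    exact ⟨γ, hγ.2⟩
  obtain ⟨D, hD, hDo, hxD⟩ := eventually_nhds_iff.1 hnear
  -- The good neighborhood `D` is again replaced by an invariant one, so that the sections and their
  -- lifts restrict to it.
  have hU'o : IsOpen (⋂ γ, ((U : Set K.Ob) ∩ (fun w => K.tgt (s γ w)) ⁻¹' D)) :=
    isOpen_iInter_of_finite fun γ =>
      (K.smooth_tgt.continuous.comp_continuousOn (h.sections.continuousOn γ)).isOpen_inter_preimage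
        U.isOpen hDo
  let U' : TopologicalSpace.Opens K.Ob := ⟨_, hU'o⟩
  have hmem : ∀ w, w ∈ U' ↔ ∀ γ, w ∈ U ∧ K.tgt (s γ w) ∈ D := fun w => mem_iInter
  have hU'U : U' ≤ U := fun w hw => ((hmem w).1 hw 1).1
  have hU'D : ∀ w ∈ U', w ∈ D := fun w hw => by
    have := ((hmem w).1 hw 1).2
    rwa [h.sections.tgt_one (hU'U hw)] at this
  have hinv : ∀ γ, ∀ w ∈ U', K.tgt (s γ w) ∈ U' := fun γ w hw => by
    refine (hmem _).2 fun δ => ⟨h.sections.tgt_mem γ w (hU'U hw), ?_⟩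
    rw [← h.sections.tgt_mul δ γ (hU'U hw)]
    exact ((hmem w).1 hw _).2
  have hxU' : x ∈ U' := (hmem x).2 fun γ => ⟨h.sections.mem, by rwa [h.sections.base, γ.2.2]⟩
  have h' := h.restrict hxU' hU'U hinv
  refine ⟨U', hU'U, hxU', hinv, fun y hy =>
    ⟨⟨V y ∩ φ.ob ⁻¹' U', (hVo y hy).inter (U'.isOpen.preimage φ.smooth_ob.continuous)⟩, ?_⟩⟩
  exact
    { mem := ⟨hyV y hy, by rw [mem_preimage, hy]; exact hxU'⟩
      ob_mem := fun z hz => hz.2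
      tgt_mem := fun g z hz => ⟨hVinv y hy g z hz.1, h'.ob_tgt_mem _ hz.2⟩
      exists_isotropy := fun γ z hz hz' => hVsep y hy γ z hz.1 hz'.1
      exists_translate := fun z hz => by
        obtain ⟨γ, hγ⟩ := hD _ (hU'D _ hz) y hy z rfl (hU'U hz)
        exact ⟨γ⁻¹, H.tgt (ℓ γ z), ⟨hγ, h'.ob_tgt_mem γ hz⟩, h'.tgt_inv_tgt γ hz⟩ }

/-- The local model exists near the points of the image of a homomorphism of orbifold groupoids
which is closed on objects, transitive on fibers and has unique liftings of nearby arrows. -/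
theorem exists_local_model {φ : Hom H K} (hH : H.IsOrbifoldGroupoid) (hK : K.IsOrbifoldGroupoid)
    (hclosed : IsClosedMap φ.ob)
    (htrans : ∀ y y', φ.ob y = φ.ob y' → ∃ g, H.src g = y ∧ H.tgt g = y')
    (hunique : φ.IsUniquelyLifting) {x : K.Ob}
    (hlift : ∃ W ∈ 𝓝 x, ∀ z κ, φ.ob z ∈ W → K.src κ = φ.ob z → K.tgt κ ∈ W →
      ∃ h, H.src h = z ∧ φ.arr h = κ) {W : Set K.Ob} (hW : W ∈ 𝓝 x) :
    ∃ (U : TopologicalSpace.Opens K.Ob)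
      (_ : MulAction (K.Isotropy x) U) (_ : ContMDiffSMul (𝓡 0) I₀' ∞ (K.Isotropy x) U)
      (cU : K.LocalChart x U), (U : Set K.Ob) ⊆ W ∧
      ∀ (y : H.Ob) (hy : φ.ob y = x),
        ∃ (V : TopologicalSpace.Opens H.Ob)
          (_ : MulAction (H.Isotropy y) V) (_ : ContMDiffSMul (𝓡 0) I₀ ∞ (H.Isotropy y) V),
          Nonempty (H.LocalChart y V) ∧ Nonempty (LocalModel φ hy cU V) := by
  have := hH.t2_ob
  have := hK.finite_isotropy x
  obtain ⟨W', hW', hlift⟩ := hlift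
  obtain ⟨U, s, hUW, hs⟩ := hK.exists_localSections x (inter_mem hW hW')
  have hℓ : ∀ (γ : K.Isotropy x) (z : H.Ob), ∃ g, φ.ob z ∈ U →
      H.src g = z ∧ φ.arr g = s γ (φ.ob z) := by
    intro γ z
    by_cases hz : φ.ob z ∈ U
    · obtain ⟨g, hg⟩ := hlift z (s γ (φ.ob z)) (hUW hz).2 (hs.src_eq γ _ hz)
        (hUW (hs.tgt_mem γ _ hz)).2
      exact ⟨g, fun _ => hg⟩
    · exact ⟨H.unit z, fun h => absurd h hz⟩
  choose ℓ hℓ using hℓ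
  have h : φ.IsLiftOfSections U s ℓ :=
    ⟨hs, hunique, fun γ z hz => (hℓ γ z hz).1, fun γ z hz => (hℓ γ z hz).2⟩
  obtain ⟨U', hU'U, hxU', hinv, hslice⟩ := h.exists_slices hclosed htrans
  have h' := h.restrict hxU' hU'U hinv
  refine ⟨U', h'.sections.mulAction, h'.sections.contMDiffSMul hK.etale,
    h'.sections.localChart hK.etale, fun w hw => (hUW (hU'U hw)).1, fun y hy => ?_⟩
  obtain ⟨V, hV⟩ := hslice y hy
  exact ⟨V, (hV.isLocalSections h').mulAction, (hV.isLocalSections h').contMDiffSMul hH.etale,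
    ⟨(hV.isLocalSections h').localChart hH.etale⟩, hV.nonempty_localModel h' hH.etale hK.etale⟩

end Hom

end LieGroupoid

end LocalModels

/-! ### Homomorphisms induced by maps between transversals. -/

noncomputable section PullbackMaps

variable {k m n d d' : ℕ}
  {G : Type uG} [Group G] [TopologicalSpace G] [ChartedSpace (EuclideanSpace ℝ (Fin k)) G]
  [LieGroup (𝓡 k) ∞ G]
  {M : Type uM} [TopologicalSpace M] [ChartedSpace (EuclideanSpace ℝ (Fin m)) M]
  [IsManifold (𝓡 m) ∞ M] [MulAction G M] [ContMDiffSMul (𝓡 k) (𝓡 m) ∞ G M]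
  {N : Type uN} [TopologicalSpace N] [ChartedSpace (EuclideanSpace ℝ (Fin n)) N]
  [IsManifold (𝓡 n) ∞ N] [MulAction G N] [ContMDiffSMul (𝓡 k) (𝓡 n) ∞ G N]
  {A : Type u} [TopologicalSpace A] [ChartedSpace (EuclideanSpace ℝ (Fin d')) A]
  [IsManifold (𝓡 d') ∞ A]
  {T : Type v} [TopologicalSpace T] [ChartedSpace (EuclideanSpace ℝ (Fin d)) T]
  [IsManifold (𝓡 d) ∞ T]

theorem IsEtaleTransversal.isImmersion {a : A → M} (ha : IsEtaleTransversal k m d' G a) :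
    IsImmersionOfManifolds (𝓡 d') (𝓡 m) a := by
  refine ⟨ha.contMDiff, fun s => ?_⟩
  have h1 := (ha (1, s)).mfderiv_bijective.1
  have hj : ContMDiff (𝓡 d') ((𝓡 k).prod (𝓡 d')) ∞ fun s : A => ((1 : G), s) :=
    contMDiff_const.prodMk contMDiff_id
  have e : a = (fun x : G × A => x.1 • a x.2) ∘ fun s => ((1 : G), s) := by
    ext s
    exact (one_smul G (a s)).symm
  have h2 : mfderiv (𝓡 d') (𝓡 m) a s =
      (mfderiv ((𝓡 k).prod (𝓡 d')) (𝓡 m) (fun x : G × A => x.1 • a x.2) (1, s)).comp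
        (mfderiv (𝓡 d') ((𝓡 k).prod (𝓡 d')) (fun s : A => ((1 : G), s)) s) := by
    conv_lhs => rw [e]
    exact mfderiv_comp s ((ha (1, s)).mdifferentiableAt (by simp))
      (hj.mdifferentiable (by simp) s)
  have h3 : Function.Injective
      (mfderiv (𝓡 d') ((𝓡 k).prod (𝓡 d')) (fun s : A => ((1 : G), s)) s) := by
    have e' : mfderiv (𝓡 d') ((𝓡 k).prod (𝓡 d')) (fun s : A => ((1 : G), s)) s =
        (mfderiv (𝓡 d') (𝓡 k) (fun _ : A => (1 : G)) s).prod
          (mfderiv (𝓡 d') (𝓡 d') (id : A → A) s) :=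
      mfderiv_prodMk mdifferentiableAt_const mdifferentiableAt_id
    rw [e', mfderiv_id]
    intro v w hvw
    exact congrArg Prod.snd hvw
  intro v w hvw
  refine h3 (h1 ?_)
  have hvw' : mfderiv (𝓡 d') (𝓡 m) a s v = mfderiv (𝓡 d') (𝓡 m) a s w := hvw
  rw [h2] at hvw'
  exact hvw'

/-- A smooth map `φ` between transversals which represents an equivariant map `ι`. -/
structure IsTransversalLift (k d d' : ℕ) (G : Type uG) [Group G] [TopologicalSpace G]
    [ChartedSpace (EuclideanSpace ℝ (Fin k)) G]
    {M : Type uM} [TopologicalSpace M] [MulAction G M]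
    {N : Type uN} [TopologicalSpace N] [MulAction G N]
    {A : Type u} [TopologicalSpace A] [ChartedSpace (EuclideanSpace ℝ (Fin d')) A]
    {T : Type v} [TopologicalSpace T] [ChartedSpace (EuclideanSpace ℝ (Fin d)) T]
    (a : A → M) (b : T → N) (ι : N → M) (φ : T → A) : Prop where
  contMDiff : ContMDiff (𝓡 d) (𝓡 d') ∞ φ
  comm : ∀ t, a (φ t) = ι (b t)
  equivariant : ∀ (g : G) (x : N), ι (g • x) = g • ι x

variable {a : A → M} (ha : IsEtaleTransversal k m d' G a)
  {b : T → N} (hb : IsEtaleTransversal k n d G b) {ι : N → M} {φ : T → A}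

namespace IsTransversalLift

variable (h : IsTransversalLift k d d' G a b ι φ)

/-- The map of arrows induced by a map between transversals. -/
def arr (x : PullbackArr hb) : PullbackArr ha :=
  PullbackArr.mk ha (φ x.src) x.elt (φ x.tgt) (by
    rw [h.comm, h.comm, ← h.equivariant, x.smul_src])

theorem contMDiff_arr : ContMDiff (𝓡 d) (𝓡 d') ∞ (h.arr ha hb) := by
  refine ContMDiff.of_localDiffeo_comp (Ψ := PullbackArr.src)
    (h.contMDiff.comp PullbackArr.isLocalDiffeomorph_src.contMDiff)
    PullbackArr.isLocalDiffeomorph_src ?_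
  rw [PullbackArr.isEmbedding_val.continuous_iff]
  exact (h.contMDiff.continuous.comp PullbackArr.continuous_src).prodMk
    (PullbackArr.continuous_elt.prodMk (h.contMDiff.continuous.comp PullbackArr.continuous_tgt))

/-- The homomorphism of pullback groupoids induced by a map between transversals. -/
def hom : LieGroupoid.Hom (pullbackGroupoid hb) (pullbackGroupoid ha) where
  ob := φ
  arr := h.arr ha hb
  smooth_ob := h.contMDiff
  smooth_arr := h.contMDiff_arr ha hb
  src_arr _ := rfl
  tgt_arr _ := rfl
  map_unit _ := rfl
  map_inv _ := rfl
  map_mul x y e := by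
    have e' : PullbackArr.src (ha := hb) x = PullbackArr.tgt (ha := hb) y := e
    have e'' : (h.arr ha hb x).src = (h.arr ha hb y).tgt := congrArg φ e'
    change h.arr ha hb (PullbackArr.mul (ha := hb) x y) =
      PullbackArr.mul (h.arr ha hb x) (h.arr ha hb y)
    rw [PullbackArr.mul_of_eq e', PullbackArr.mul_of_eq e'']
    rfl

theorem comp_hom (hι : ContMDiff (𝓡 n) (𝓡 m) ∞ ι) :
    (pullbackHom ha).comp (h.hom ha hb) =
      (translationHom (𝓡 k) (𝓡 n) (𝓡 m) G ι hι h.equivariant).comp (pullbackHom hb) := by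
  apply LieGroupoid.Hom.ext
  · funext t
    exact h.comm t
  · funext x
    exact Prod.ext rfl (h.comm _)

/-- An arrow is given by its source, group element and target. Its image records the group element
and `φ` of the target, while source and group element determine `b` of the target. As `(φ, b)` is
proper and injective it is a closed embedding, so the target is recovered continuously. -/
theorem isUniquelyLifting [T2Space A] [T2Space N] (hproper : IsProperMap φ)
    (hinj : ∀ t t', φ t = φ t' → b t = b t' → t = t') :
    (h.hom ha hb).IsUniquelyLifting := by
  have hcb : Continuous b := hb.contMDiff.continuous
  have : ContinuousSMul G N := ContMDiffSMul.continuousSMul (I := 𝓡 k) (I' := 𝓡 n) ∞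
  have h1 : IsProperMap fun t => (φ t, b t) :=
    isProperMap_of_comp_of_t2 (g := Prod.fst) (hproper.continuous.prodMk hcb) continuous_fst hproper
  have h2 : IsEmbedding fun t => (φ t, b t) :=
    (IsClosedEmbedding.of_continuous_injective_isClosedMap h1.continuous
      (fun t t' e => hinj t t' (congrArg Prod.fst e) (congrArg Prod.snd e))
      h1.isClosedMap).isEmbedding
  have h3 : IsEmbedding fun x : PullbackArr hb => (x.src, x.elt, (φ x.tgt, b x.tgt)) :=
    (IsEmbedding.id.prodMap (IsEmbedding.id.prodMap h2)).comp PullbackArr.isEmbedding_val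
  let g : T × PullbackArr ha → T × G × A × N := fun p =>
    (p.1, p.2.elt, p.2.tgt, p.2.elt • b p.1)
  have helt : Continuous fun p : T × PullbackArr ha => p.2.elt :=
    PullbackArr.continuous_elt.comp continuous_snd
  have hg : Continuous g := continuous_fst.prodMk (helt.prodMk
    ((PullbackArr.continuous_tgt.comp continuous_snd).prodMk
      (helt.smul (hcb.comp continuous_fst))))
  have hf : Continuous fun x : PullbackArr hb => (x.src, h.arr ha hb x) :=
    PullbackArr.continuous_src.prodMk (h.contMDiff_arr ha hb).continuous
  refine IsEmbedding.of_comp hf hg ?_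
  convert h3 using 1
  funext x
  exact Prod.ext rfl (Prod.ext rfl (Prod.ext rfl x.smul_src))

/-- By equivariance `g • b t` and `b t'` lie over the same point of `M`, and strongness moves one to
the other. The new group element may differ from `g`. -/
theorem exists_smul_eq (h : IsTransversalLift k d d' G a b ι φ)
    (hstrong : IsStrongEquivariantImmersion (𝓡 n) (𝓡 m) G ι) {t t' : T} {g : G}
    (e : g • a (φ t) = a (φ t')) : ∃ g' : G, g' • b t = b t' := by
  rw [h.comm, h.comm, ← h.equivariant] at e
  obtain ⟨g', -, hg'⟩ := hstrong.strong _ (g • b t) (b t') e rfl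
  exact ⟨g' * g, by rwa [mul_smul]⟩

theorem isInjectiveOrbifoldImmersion [T2Space A] [SecondCountableTopology A]
    [T2Space T] [SecondCountableTopology T] [T2Space G] [CompactSpace G] [T2Space M] [T2Space N]
    (hstrong : IsStrongEquivariantImmersion (𝓡 n) (𝓡 m) G ι) (hproper : IsProperMap φ)
    (hinj : ∀ t t', φ t = φ t' → b t = b t' → t = t')
    (hlift : ∀ x : A, ∃ W ∈ 𝓝 x, ∀ (t : T) (g : G), ∀ w ∈ W, φ t ∈ W → g • a (φ t) = a w →
      ∃ t', b t' = g • b t ∧ φ t' = w) :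
    (h.hom ha hb).IsInjectiveOrbifoldImmersion := by
  have hcomm : a ∘ φ = ι ∘ b := funext h.comm
  have htrans : ∀ t t' : T, φ t = φ t' →
      ∃ x : PullbackArr hb, PullbackArr.src x = t ∧ PullbackArr.tgt x = t' := by
    intro t t' e
    obtain ⟨g, hg⟩ := h.exists_smul_eq hstrong (g := (1 : G)) (t := t) (t' := t')
      (by rw [one_smul, e])
    exact ⟨PullbackArr.mk hb t g t' hg, rfl, rfl⟩
  refine
    { immersion := ⟨h.contMDiff, fun t => ?_⟩
      transitive := htrans
      local_model := fun x _ W hW => ?_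
      injective := ?_ }
  -- Since `a ∘ φ = ι ∘ b` and both `ι` and `b` are immersions, the inner factor `φ` of the left
  -- side is one too.
  · have h1 : mfderiv (𝓡 d) (𝓡 m) (a ∘ φ) t =
        (mfderiv (𝓡 d') (𝓡 m) a (φ t)).comp (mfderiv (𝓡 d) (𝓡 d') φ t) :=
      mfderiv_comp t (ha.contMDiff.mdifferentiable (by simp) _)
        (h.contMDiff.mdifferentiable (by simp) t)
    have h2 : mfderiv (𝓡 d) (𝓡 m) (ι ∘ b) t =
        (mfderiv (𝓡 n) (𝓡 m) ι (b t)).comp (mfderiv (𝓡 d) (𝓡 n) b t) :=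
      mfderiv_comp t (hstrong.immersion.1.mdifferentiable (by simp) _)
        (hb.contMDiff.mdifferentiable (by simp) t)
    have h3 : Function.Injective (mfderiv (𝓡 d) (𝓡 m) (ι ∘ b) t) := by
      rw [h2]
      exact (hstrong.immersion.2 (b t)).comp (hb.isImmersion.2 t)
    rw [← hcomm, h1] at h3
    exact Function.Injective.of_comp (f := mfderiv (𝓡 d') (𝓡 m) a (φ t)) h3
  · refine LieGroupoid.Hom.exists_local_model (pullbackGroupoid_isOrbifoldGroupoid hb)
      (pullbackGroupoid_isOrbifoldGroupoid ha) hproper.isClosedMap htrans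
      (h.isUniquelyLifting ha hb hproper hinj) ?_ hW
    obtain ⟨W', hW', hlift⟩ := hlift x
    refine ⟨W', hW', fun t κ ht hκ hκ' => ?_⟩
    obtain ⟨t', ht', e⟩ := hlift t (PullbackArr.elt (ha := ha) κ) _ hκ' ht (by
      rw [← (show PullbackArr.src (ha := ha) κ = φ t from hκ)]
      exact PullbackArr.smul_src κ)
    exact ⟨PullbackArr.mk hb t (PullbackArr.elt (ha := ha) κ) t' ht'.symm, rfl,
      PullbackArr.ext (ha := ha) hκ.symm rfl e⟩
  · rintro ⟨t⟩ ⟨t'⟩ e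
    obtain ⟨κ, hκ, hκ'⟩ := Quotient.exact e
    have hs : a (PullbackArr.src (ha := ha) κ) = a (φ t) := congrArg a hκ
    have ht : a (PullbackArr.tgt (ha := ha) κ) = a (φ t') := congrArg a hκ'
    obtain ⟨g, hg⟩ := h.exists_smul_eq hstrong (t := t) (t' := t')
      (g := PullbackArr.elt (ha := ha) κ) (by
        rw [← hs, ← ht]
        exact PullbackArr.smul_src κ)
    exact Quotient.sound ⟨PullbackArr.mk hb t g t' hg, rfl, rfl⟩

/-- A continuous injective closed map is proper, so only closedness is at stake. A closed set of
orbits becomes a closed invariant set of `N`, which `ι` maps to a closed set of `M`, and this pulls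
back to the transversal downstairs. -/
theorem isProperMap_quotientMap (hsurj : ∀ x : N, ∃ (g : G) (t : T), g • b t = x)
    (hι : IsProperMap ι) (hinj : Function.Injective (h.hom ha hb).quotientMap) :
    IsProperMap (h.hom ha hb).quotientMap := by
  have hquot : IsQuotientMap (Quotient.mk (pullbackGroupoid ha).orbitSetoid) :=
    isQuotientMap_quotient_mk'
  have hcont : Continuous (h.hom ha hb).quotientMap :=
    h.contMDiff.continuous.quotient_map' _
  refine (IsClosedEmbedding.of_continuous_injective_isClosedMap hcont hinj
    fun C hC => ?_).isProperMap
  have hCc : IsClosed (Quotient.mk (pullbackGroupoid hb).orbitSetoid ⁻¹' C) :=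
    hC.preimage continuous_quotient_mk'
  set C' : Set T := Quotient.mk (pullbackGroupoid hb).orbitSetoid ⁻¹' C with hC'
  let Φ : G × T → N := fun x => x.1 • b x.2
  have hsat : ∀ x y : G × T, Φ x = Φ y → x.2 ∈ C' → y.2 ∈ C' := by
    rintro ⟨g, t⟩ ⟨g', t'⟩ e ht
    have h1 : (g'⁻¹ * g) • b t = b t' := by
      rw [mul_smul, inv_smul_eq_iff]
      exact e
    have h2 : (Quotient.mk (pullbackGroupoid hb).orbitSetoid t) =
        Quotient.mk (pullbackGroupoid hb).orbitSetoid t' :=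
      Quotient.sound ⟨PullbackArr.mk hb t _ t' h1, rfl, rfl⟩
    change Quotient.mk (pullbackGroupoid hb).orbitSetoid t' ∈ C
    rw [← h2]
    exact ht
  have hcl : IsClosed (Φ '' (univ ×ˢ C')) := by
    rw [← isOpen_compl_iff]
    -- As `C'` is a union of orbits and `Φ` is onto, the complement of the image is the image of the
    -- complement; it is open since `Φ` is étale.
    have h1 : (Φ '' (univ ×ˢ C'))ᶜ = Φ '' (univ ×ˢ C'ᶜ) := by
      ext x
      constructor
      · intro hx
        obtain ⟨g, t, rfl⟩ := hsurj x
        exact ⟨(g, t), ⟨mem_univ _, fun ht => hx ⟨(g, t), ⟨mem_univ _, ht⟩, rfl⟩⟩, rfl⟩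
      · rintro ⟨x, hx, rfl⟩ ⟨y, hy, e⟩
        exact hx.2 (hsat y x e hy.2)
    rw [h1]
    exact (IsLocalDiffeomorph.isLocalHomeomorph hb).isOpenMap _
      (isOpen_univ.prod hCc.isOpen_compl)
  refine hquot.isClosed_preimage.1 ?_
  have h2 : Quotient.mk (pullbackGroupoid ha).orbitSetoid ⁻¹' ((h.hom ha hb).quotientMap '' C) =
      a ⁻¹' (ι '' (Φ '' (univ ×ˢ C'))) := by
    ext s
    constructor
    · rintro ⟨⟨t⟩, ht, e⟩
      obtain ⟨κ, hκ, hκ'⟩ := Quotient.exact e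
      refine ⟨_, ⟨(PullbackArr.elt (ha := ha) κ, t), ⟨mem_univ _, ht⟩, rfl⟩, ?_⟩
      have hs : a (PullbackArr.src (ha := ha) κ) = a (φ t) := congrArg a hκ
      have ht : a (PullbackArr.tgt (ha := ha) κ) = a s := congrArg a hκ'
      change ι (PullbackArr.elt (ha := ha) κ • b t) = a s
      rw [h.equivariant, ← h.comm, ← hs, ← ht]
      exact PullbackArr.smul_src κ
    · rintro ⟨_, ⟨⟨g, t⟩, ⟨-, ht⟩, rfl⟩, e⟩
      have e' : g • a (φ t) = a s := by
        rw [h.comm, ← h.equivariant]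
        exact e
      exact ⟨_, ht, Quotient.sound ⟨PullbackArr.mk ha (φ t) g s e', rfl, rfl⟩⟩
  change IsClosed (Quotient.mk (pullbackGroupoid ha).orbitSetoid ⁻¹' _)
  exact (congrArg IsClosed h2).mpr ((hι.isClosedMap _ hcl).preimage ha.contMDiff.continuous)

end IsTransversalLift

end PullbackMaps

/-! ### The groupoids of a family of transversals, and the conclusion. -/

namespace TransversalFamily

variable {k m n : ℕ}
  {G : Type uG} [Group G] [TopologicalSpace G] [ChartedSpace (EuclideanSpace ℝ (Fin k)) G]
  {M : Type uM} [TopologicalSpace M] [ChartedSpace (EuclideanSpace ℝ (Fin m)) M] [MulAction G M]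
  {N : Type uN} [TopologicalSpace N] [ChartedSpace (EuclideanSpace ℝ (Fin n)) N] [MulAction G N]
  {ι : N → M}

/-- Countably many of the transversals of the family meet all orbits. -/
theorem exists_countable [SecondCountableTopology M] [SecondCountableTopology N]
    (F : TransversalFamily k m n G ι) :
    ∃ P : Set M, P.Countable ∧ (∀ x, ∃ p ∈ P, ∃ g : G, ∃ u ∈ F.U p, g • F.σ p u = x) ∧
      ∀ y, ∃ c, ι c ∈ P ∧ ∃ g : G, ∃ v ∈ F.V c, g • F.b c v = y := by
  have hM : ∀ p : M, (fun x : G × EuclideanSpace ℝ (Fin (m - k)) => x.1 • F.σ p x.2) ''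
      (univ ×ˢ (F.U p : Set _)) ∈ 𝓝 p := fun p => by
    have h1 := (F.etale_σ p 1 0 (F.zero_mem_U p)).map_nhds_eq
    rw [F.σ_zero, one_smul] at h1
    rw [← h1]
    exact image_mem_map ((isOpen_univ.prod (F.U p).isOpen).mem_nhds ⟨mem_univ _, F.zero_mem_U p⟩)
  have hN : ∀ c : N, (fun x : G × EuclideanSpace ℝ (Fin (n - k)) => x.1 • F.b c x.2) ''
      (univ ×ˢ (F.V c : Set _)) ∈ 𝓝 c := fun c => by
    have h1 := (F.etale_b c 1 0 (F.zero_mem_V c)).map_nhds_eq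
    rw [F.b_zero, one_smul] at h1
    rw [← h1]
    exact image_mem_map ((isOpen_univ.prod (F.V c).isOpen).mem_nhds ⟨mem_univ _, F.zero_mem_V c⟩)
  obtain ⟨P, hP, hPM⟩ := TopologicalSpace.countable_cover_nhds hM
  obtain ⟨Q, hQ, hQN⟩ := TopologicalSpace.countable_cover_nhds hN
  -- The disks upstairs are indexed by all points over the chosen set, so adding the image of `Q`
  -- secures the covering of `N`.
  refine ⟨P ∪ ι '' Q, hP.union (hQ.image ι), fun x => ?_, fun y => ?_⟩
  · obtain ⟨p, hp, ⟨g, u⟩, ⟨-, hu⟩, hx⟩ := mem_iUnion₂.1 (hPM.ge (mem_univ x))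
    exact ⟨p, Or.inl hp, g, u, hu, hx⟩
  · obtain ⟨c, hc, ⟨g, v⟩, ⟨-, hv⟩, hy⟩ := mem_iUnion₂.1 (hQN.ge (mem_univ y))
    exact ⟨c, Or.inr (mem_image_of_mem ι hc), g, v, hv, hy⟩

variable (F : TransversalFamily k m n G ι) (P : Set M)

/-- The disjoint union of the transversals in `M` indexed by `P`. -/
abbrev Target : Type uM := Sheets fun p : P => F.U p

/-- The disjoint union of the transversals in `N` which lie over those indexed by `P`. -/
abbrev Source : Type uN := Sheets fun c : {c : N // ι c ∈ P} => F.V c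

/-- The map from the disjoint union of the transversals to `M`. -/
def targetMap (x : F.Target P) : M := F.σ x.1 x.coord

/-- The map from the disjoint union of the transversals to `N`. -/
def sourceMap (x : F.Source P) : N := F.b x.1 x.coord

/-- The map between the transversals. -/
def map : F.Source P → F.Target P :=
  Sheets.map (fun c : {c : N // ι c ∈ P} => (⟨ι c, c.2⟩ : P)) (fun c => F.φ c)
    fun c => F.mapsTo_φ c

theorem isEtaleTransversal_targetMap : IsEtaleTransversal k m (m - k) G (F.targetMap P) :=
  Sheets.isLocalDiffeomorph_smul (F := fun p : P => F.σ p) fun p => F.etale_σ p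

theorem isEtaleTransversal_sourceMap : IsEtaleTransversal k n (n - k) G (F.sourceMap P) :=
  Sheets.isLocalDiffeomorph_smul (F := fun c : {c : N // ι c ∈ P} => F.b c) fun c => F.etale_b c

theorem isTransversalLift (hι : ∀ (g : G) (x : N), ι (g • x) = g • ι x) :
    IsTransversalLift k (n - k) (m - k) G (F.targetMap P) (F.sourceMap P) ι (F.map P) where
  contMDiff := Sheets.contMDiff_map _ fun c => F.smooth_φ c
  comm t := F.σ_φ t.1 t.coord t.2.2
  equivariant := hι

theorem isProperMap_map (hι : ∀ p, (ι ⁻¹' {p}).Finite) : IsProperMap (F.map P) := by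
  refine Sheets.isProperMap_map _ (fun c => F.smooth_φ c) (fun p => ?_) fun c => F.proper c
  refine Finite.of_finite_image (f := Subtype.val) ((hι p).subset ?_) Subtype.val_injective.injOn
  rintro _ ⟨c, hc, rfl⟩
  exact congrArg Subtype.val (show (⟨ι c, c.2⟩ : P) = p from hc)

theorem eq_of_map_eq {t t' : F.Source P} (h : F.map P t = F.map P t')
    (h' : F.sourceMap P t = F.sourceMap P t') : t = t' := by
  have h1 : ι t.1 = ι t'.1 := congrArg (fun x : F.Target P => (x.1 : M)) h
  obtain ⟨h2, h3⟩ := F.injective t.1 t'.1 h1 t.coord t.2.2 t'.coord t'.2.2 h'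
  exact Sheets.ext (Subtype.ext h2) h3

/-- The whole sheet of `x` serves as the neighborhood, because arrows were arranged to lift over all
of `U`; the lift ends on a disk over the same `p`, which is again part of the source. -/
theorem exists_lift (x : F.Target P) :
    ∃ W ∈ 𝓝 x, ∀ (t : F.Source P) (g : G), ∀ w ∈ W, F.map P t ∈ W →
      g • F.targetMap P (F.map P t) = F.targetMap P w →
      ∃ t', F.sourceMap P t' = g • F.sourceMap P t ∧ F.map P t' = w := by
  refine ⟨_, Sheets.eventually_fst_eq x, fun t g w hw ht e => ?_⟩
  have hw' : w.1 = ⟨ι t.1, t.1.2⟩ := Eq.trans hw ht.symm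
  have hwι : (w.1 : M) = ι t.1 := congrArg Subtype.val hw'
  have hwU : w.coord ∈ F.U (ι t.1) := by
    rw [← hwι]
    exact w.2.2
  have e' : g • F.σ (ι t.1) (F.φ t.1 t.coord) = F.σ (ι t.1) w.coord := by
    rw [← hwι]
    rw [targetMap, targetMap] at e
    rw [← e, hwι]
    rfl
  obtain ⟨c', hc', v', hv', h1, h2⟩ := F.lift t.1 t.coord t.2.2 w.coord hwU g e'
  exact ⟨⟨⟨c', by rw [hc']; exact t.1.2⟩, ⟨v', hv'⟩⟩, h1,
    Sheets.ext (Subtype.ext (hc'.trans hwι.symm)) h2⟩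

end TransversalFamily

theorem proposition5 {k m n : ℕ}
    (G : Type uG) [Group G] [TopologicalSpace G] [ChartedSpace (EuclideanSpace ℝ (Fin k)) G]
    [LieGroup (𝓡 k) ∞ G] [T2Space G] [CompactSpace G]
    (M : Type uM) [TopologicalSpace M] [ChartedSpace (EuclideanSpace ℝ (Fin m)) M]
    [IsManifold (𝓡 m) ∞ M] [T2Space M] [SecondCountableTopology M]
    [MulAction G M] [ContMDiffSMul (𝓡 k) (𝓡 m) ∞ G M]
    (N : Type uN) [TopologicalSpace N] [ChartedSpace (EuclideanSpace ℝ (Fin n)) N]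
    [IsManifold (𝓡 n) ∞ N] [T2Space N] [SecondCountableTopology N]
    [MulAction G N] [ContMDiffSMul (𝓡 k) (𝓡 n) ∞ G N]
    (hM : IsLocallyFreeAction G M) (hN : IsLocallyFreeAction G N)
    (ι : N → M) (hι : IsStrongEquivariantImmersion (𝓡 n) (𝓡 m) G ι) :
    ∃ (d d' : ℕ)
      (H : LieGroupoid.{uN, max uG uN} (𝓡 d) (𝓡 d)) (K : LieGroupoid.{uM, max uG uM} (𝓡 d') (𝓡 d'))
      (εN : LieGroupoid.Hom H (translationGroupoid (𝓡 k) (𝓡 n) G N))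
      (εM : LieGroupoid.Hom K (translationGroupoid (𝓡 k) (𝓡 m) G M))
      (φ : LieGroupoid.Hom H K),
      H.IsOrbifoldGroupoid ∧ K.IsOrbifoldGroupoid ∧ εN.IsEquivalence ∧ εM.IsEquivalence ∧
      εM.comp φ =
        (translationHom (𝓡 k) (𝓡 n) (𝓡 m) G ι hι.immersion.1 hι.equivariant).comp εN ∧
      φ.IsInjectiveOrbifoldImmersion ∧
      (IsProperMap ι → φ.IsOrbifoldEmbedding) := by
  have : ContinuousSMul G M := ContMDiffSMul.continuousSMul (I := 𝓡 k) (I' := 𝓡 m) ∞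
  have hMp : ∀ p : M, DiscreteTopology (MulAction.stabilizer G p) := hM
  have hfin : ∀ p : M, (ι ⁻¹' {p}).Finite := fun p => finite_fiber_of_strong (hι.strong p)
  obtain ⟨F⟩ := exists_transversalFamily (k := k) hM hN hι
  obtain ⟨P, hP, hPM, hPN⟩ := F.exists_countable
  have : Countable P := hP.to_subtype
  -- Finite fibers keep the number of disks upstairs countable, as second countability of the
  -- objects requires.
  have hD : (ι ⁻¹' P).Countable := by
    rw [← biUnion_preimage_singleton]
    exact hP.biUnion fun p _ => (hfin p).countable
  have : Countable {c : N // ι c ∈ P} := hD.to_subtype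
  have ha := F.isEtaleTransversal_targetMap P
  have hb := F.isEtaleTransversal_sourceMap P
  have h := F.isTransversalLift P hι.equivariant
  have hsurjM : ∀ x : M, ∃ (g : G) (s : F.Target P), g • F.targetMap P s = x := fun x => by
    obtain ⟨p, hp, g, u, hu, hx⟩ := hPM x
    exact ⟨g, ⟨⟨p, hp⟩, ⟨u, hu⟩⟩, hx⟩
  have hsurjN : ∀ y : N, ∃ (g : G) (t : F.Source P), g • F.sourceMap P t = y := fun y => by
    obtain ⟨c, hc, g, v, hv, hy⟩ := hPN y
    exact ⟨g, ⟨⟨c, hc⟩, ⟨v, hv⟩⟩, hy⟩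
  have himm : (h.hom ha hb).IsInjectiveOrbifoldImmersion :=
    h.isInjectiveOrbifoldImmersion ha hb hι (F.isProperMap_map P hfin)
      (fun _ _ => F.eq_of_map_eq P) (F.exists_lift P)
  -- Truncation of `n - k` or `m - k` occurs only for an empty manifold: a point has an orbit map
  -- with injective derivative, which forces `k` to be at most the dimension.
  exact ⟨n - k, m - k, pullbackGroupoid hb, pullbackGroupoid ha, pullbackHom hb, pullbackHom ha,
    h.hom ha hb, pullbackGroupoid_isOrbifoldGroupoid hb, pullbackGroupoid_isOrbifoldGroupoid ha,
    pullbackHom_isEquivalence hb hsurjN, pullbackHom_isEquivalence ha hsurjM,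
    h.comp_hom ha hb hι.immersion.1, himm,
    fun hproper => ⟨himm, h.isProperMap_quotientMap ha hb hsurjN hproper himm.injective⟩⟩
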